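/- Let $d\ge 1$, $s\in(0,1)$, $p>\frac ds$, $\Lambda>0$, and fix a normalizing constant $c_s>0$. Let $\Omega\subset\mathbb R^{d+1}$ be a nonempty bounded open set with smooth boundary $\Sigma=\partial\Omega$ (neither convexity nor connectedness is assumed) and outward unit normal $n$, let $\mathcal H^d$ be the $d$-dimensional Hausdorff measure, and define the nonlocal bending energy $$\mathcal B_{s,p}(\Sigma)=\int_\Sigma\Big(c_s\int_\Sigma\frac{|\langle x-y,n(y)\rangle|}{|x-y|^{d+1+s}}\,d\mathcal H^d(y)\Big)^p d\mathcal H^d(x).$$ For $q\in(1,\infty)$ let $[f]_{W^{\alpha,q}(\Sigma)}$ be the Gagliardo seminorm $\big(\int_\Sigma\int_\Sigma\frac{|f(x)-f(y)|^q}{|x-y|^{d+\alpha q}}\,d\mathcal H^d(y)\,d\mathcal H^d(x)\big)^{1/q}$ if $\alpha\in(0,1)$, and the $L^q(\Sigma)$-norm of the weak tangential gradient if $\alpha=1$; $f\in W^{\alpha,q}(\Sigma)$ means that $f\in L^q(\Sigma)$ and $[f]_{W^{\alpha,q}(\Sigma)}<\infty$. Let $[f]_{C^\beta(\Sigma)}=\sup_{x\ne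 y\in\Sigma}|f(x)-f(y)|/|x-y|^\beta$. All constants below depend only on $d,s,p,\Lambda$ and $c_s$ (and, in 3, also on $\alpha,q$), not on $\Omega$. Then: 1. (Uniform parametrization.) There are $R>0$ and $C$ such that, whenever $\mathcal B_{s,p}(\Sigma)\le\Lambda$, for every $x_0\in\Sigma$ there are a rotation $P\in SO(d+1)$ and a smooth map $f:B(0,R)\subset\mathbb R^d\to\mathbb R$ with $f(0)=0$ and $|\nabla f(x)-\nabla f(y)|\le C|x-y|^{s-d/p}$ for all $x,y\in B(0,R)$, such that $\Phi(x)=x_0+P(x,f(x))$ is a local parametrization of $\Sigma$, that is, a diffeomorphism from $B(0,R)$ onto a relatively open subset $\Phi(B(0,R))$ of $\Sigma$. 2. (Lower Ahlfors regularity.) There are $c>0$ and $R_0>0$ such that, whenever $\mathcal B_{s,p}(\Sigma)\le\Lambda$, for every $x\in\Sigma$ $$\inf_{R\in(0,R_0)}R^{-d}\,\mathcal H^d(\Sigma\cap B(x,R))>c.$$ 3. (Weak Michael–Simon type inequality.) For all $\alpha\in(0,1]$ and $q\in(1,\infty)$ there is a constant $C$ such that, whenever $\mathcal B_{s,p}(\Sigma)\le\Lambda$,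 for every $f\in W^{\alpha,q}(\Sigma)$: if $q<\frac d\alpha$, then $$\|f\|_{L^{\frac{dq}{d-\alpha q}}(\Sigma)}\le C\big([f]_{W^{\alpha,q}(\Sigma)}+\|f\|_{L^q(\Sigma)}\big);$$ and if $\alpha-\frac dq=\beta$ for some $\beta\in(0,\alpha)$, then, after modification of $f$ on an $\mathcal H^d$-null set, $$\|f\|_{L^\infty(\Sigma)}+[f]_{C^\beta(\Sigma)}\le C\big([f]_{W^{\alpha,q}(\Sigma)}+\|f\|_{L^q(\Sigma)}\big).$$ 4. (Lower area bound.) There is $c>0$ such that $\mathcal H^d(\Sigma)\ge c$ whenever $\mathcal B_{s,p}(\Sigma)\le\Lambda$. -/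

import Mathlib

open MeasureTheory Set
open scoped ContDiff ENNReal NNReal

noncomputable section

/-- `ℝᵐ` with the Euclidean norm. -/
abbrev Euc (m : ℕ) : Type := EuclideanSpace ℝ (Fin m)

/-- `ρ` is a smooth local defining function of `Ω` on the open neighbourhood `U` of the boundary
point `y`: near `y` the set `Ω` is the sublevel set `{ρ < 0}`, and `∇ρ(y) ≠ 0`. -/
structure IsLocalDefiningFunction {m : ℕ} (Ω : Set (Euc m)) (y : Euc m) (U : Set (Euc m))
    (ρ : Euc m → ℝ) : Prop where
  isOpen : IsOpen U
  mem : y ∈ U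
  smooth : ContDiffOn ℝ ∞ ρ U
  eq_zero : ρ y = 0
  gradient_ne_zero : gradient ρ y ≠ 0
  mem_iff : ∀ z ∈ U, z ∈ Ω ↔ ρ z < 0

/-- A nonempty bounded open set with smooth boundary. Neither convexity nor connectedness is
required. -/
structure IsSmoothBoundedDomain {m : ℕ} (Ω : Set (Euc m)) : Prop where
  isOpen : IsOpen Ω
  nonempty : Ω.Nonempty
  bounded : Bornology.IsBounded Ω
  smooth_frontier : ∀ y ∈ frontier Ω, ∃ U ρ, IsLocalDefiningFunction Ω y U ρ

/-- `ν` is the outward pointing unit normal of `∂Ω` at `y`: it is the normalized gradient of a local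
defining function. -/
def IsOutwardUnitNormal {m : ℕ} (Ω : Set (Euc m)) (y ν : Euc m) : Prop :=
  ∃ U ρ, IsLocalDefiningFunction Ω y U ρ ∧ ν = ‖gradient ρ y‖⁻¹ • gradient ρ y

/-- The outward unit normal field `n` of `∂Ω` (of no significance away from smooth boundary
points). -/
def outwardNormal {m : ℕ} (Ω : Set (Euc m)) (y : Euc m) : Euc m :=
  Classical.epsilon (IsOutwardUnitNormal Ω y)

/-- The surface measure `ℋᵈ ⌞ ∂Ω`, where `ℋᵈ` is the `d`-dimensional Hausdorff measure, normalized so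
as to agree with Lebesgue measure on `d`-dimensional planes. -/
def surfaceMeasure {d : ℕ} (Ω : Set (Euc (d + 1))) : Measure (Euc (d + 1)) :=
  (μHE[d] : Measure (Euc (d + 1))).restrict (frontier Ω)

/-- The nonlocal curvature
`|A|_{Σ,s}(x) = c ∫_Σ |⟨x - y, n(y)⟩| / |x - y|^(d+1+s) dℋᵈ(y)`, `Σ = ∂Ω`, with normalizing constant
`c`. -/
def nonlocalCurvature {d : ℕ} (c s : ℝ) (Ω : Set (Euc (d + 1))) (x : Euc (d + 1)) : ℝ≥0∞ :=
  ENNReal.ofReal c * ∫⁻ y, ENNReal.ofReal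
    (|inner ℝ (x - y) (outwardNormal Ω y)| / ‖x - y‖ ^ ((d : ℝ) + 1 + s)) ∂(surfaceMeasure Ω)

/-- The nonlocal bending energy `ℬ_{s,p}(∂Ω) = ‖ |A|_{∂Ω,s} ‖_{Lᵖ(∂Ω)}ᵖ`, with values in
`[0, ∞]`. -/
def bendingEnergy {d : ℕ} (c s p : ℝ) (Ω : Set (Euc (d + 1))) : ℝ≥0∞ :=
  ∫⁻ x, nonlocalCurvature c s Ω x ^ p ∂(surfaceMeasure Ω)

/-- `Φ` is a smooth local parametrization of `S ⊆ ℝ^(d+1)` defined on the open set `U ⊆ ℝᵈ`: a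
diffeomorphism from `U` onto a relatively open subset of `S`. Smoothness of the inverse means that
it is the restriction of a smooth map on an open subset of the ambient space. -/
def IsLocalParametrization {d : ℕ} (S : Set (Euc (d + 1))) (U : Set (Euc d))
    (Φ : Euc d → Euc (d + 1)) : Prop :=
  IsOpen U ∧ ContDiffOn ℝ ∞ Φ U ∧
    ∃ (V : Set (Euc (d + 1))) (Ψ : Euc (d + 1) → Euc d),
      IsOpen V ∧ ContDiffOn ℝ ∞ Ψ V ∧ Φ '' U = V ∩ S ∧ ∀ u ∈ U, Ψ (Φ u) = u

/-- The point `(x, t) ∈ ℝᵈ × ℝ = ℝ^(d+1)`. -/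
def graphPoint {d : ℕ} (x : Euc d) (t : ℝ) : Euc (d + 1) :=
  WithLp.toLp 2 (Fin.snoc (fun i => x i) t : Fin (d + 1) → ℝ)

/-- The map `x ↦ x₀ + P (x, f(x))`. -/
def graphMap {d : ℕ} (x₀ : Euc (d + 1)) (P : Matrix (Fin (d + 1)) (Fin (d + 1)) ℝ)
    (f : Euc d → ℝ) (x : Euc d) : Euc (d + 1) :=
  x₀ + Matrix.toEuclideanLin P (graphPoint x (f x))

/-- `g` is a weak tangential gradient of `f` on `Σ = ∂Ω`: it is a.e. tangent to `Σ`, and in every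
smooth local parametrization `Φ` of `Σ` the function `f ∘ Φ` has the weak partial derivatives
`∂ᵢ(f ∘ Φ) = ⟨g ∘ Φ, ∂ᵢΦ⟩`. -/
def IsWeakTangentialGradient {d : ℕ} (Ω : Set (Euc (d + 1))) (f : Euc (d + 1) → ℝ)
    (g : Euc (d + 1) → Euc (d + 1)) : Prop :=
  (∀ᵐ y ∂(surfaceMeasure Ω), inner ℝ (g y) (outwardNormal Ω y) = 0) ∧
    ∀ (U : Set (Euc d)) (Φ : Euc d → Euc (d + 1)), IsLocalParametrization (frontier Ω) U Φ →
      ∀ φ : Euc d → ℝ, ContDiff ℝ ∞ φ → HasCompactSupport φ → tsupport φ ⊆ U →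
        ∀ i : Fin d,
          ∫ u in U, f (Φ u) * fderiv ℝ φ u (EuclideanSpace.single i 1) =
            - ∫ u in U, inner ℝ (g (Φ u)) (fderiv ℝ Φ u (EuclideanSpace.single i 1)) * φ u

/-- The seminorm `[f]_{W^{α,q}(∂Ω)}` with values in `[0, ∞]`: for `α = 1` the `L^q` norm of the weak
tangential gradient (`∞` if there is none in `L^q`; it is unique up to null sets), otherwise the
Gagliardo seminorm. -/
def sobolevSeminorm {d : ℕ} (Ω : Set (Euc (d + 1))) (α q : ℝ) (f : Euc (d + 1) → ℝ) : ℝ≥0∞ :=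
  if α = 1 then
    ⨅ (g : Euc (d + 1) → Euc (d + 1))
      (_ : MemLp g (ENNReal.ofReal q) (surfaceMeasure Ω) ∧ IsWeakTangentialGradient Ω f g),
      eLpNorm g (ENNReal.ofReal q) (surfaceMeasure Ω)
  else
    (∫⁻ x, ∫⁻ y, ENNReal.ofReal (|f x - f y| ^ q / ‖x - y‖ ^ ((d : ℝ) + α * q))
      ∂(surfaceMeasure Ω) ∂(surfaceMeasure Ω)) ^ (1 / q)

/-- `f ∈ W^{α,q}(∂Ω)`. -/
def MemSobolev {d : ℕ} (Ω : Set (Euc (d + 1))) (α q : ℝ) (f : Euc (d + 1) → ℝ) : Prop :=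
  MemLp f (ENNReal.ofReal q) (surfaceMeasure Ω) ∧ sobolevSeminorm Ω α q f < ⊤

/-- The Hölder seminorm `[f]_{C^β(S)} = sup |f(x) - f(y)| / |x - y|^β` over distinct `x, y ∈ S`, with
values in `[0, ∞]`. -/
def holderSeminorm {m : ℕ} (β : ℝ) (S : Set (Euc m)) (f : Euc m → ℝ) : ℝ≥0∞ :=
  ⨆ (x ∈ S) (y ∈ S) (_ : x ≠ y), ENNReal.ofReal (|f x - f y| / ‖x - y‖ ^ β)

end

/-! Without the extra power s, the curvature integrand |⟨x−y, n(y)⟩| / |x−y|^(d+1) is the density of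
the solid angle under which the surface is seen from x. A segment from x to a point at which Ω
disagrees with its tangent half-space must cross ∂Ω, so the disagreement in B(x, r) is contained, up
to a null set, in a cone over the surface. Its volume is at most 2 r^(d+1) r^s times the curvature
integral (`volume_ball_inter_symmDiff_halfSpace_le`). A point of controlled curvature is thus a
point near which Ω is close in measure to a half-space, with no density bound or graph property
assumed beforehand.

If a ball of radius t carries surface measure at least c t^d, Markov's inequality yields a point in
it with curvature O(t^(−d/p)). At scale t the relative defect from a half-space is then
O(t^(s−d/p)), which is small because p > d/s. A set close in measure to a half-space has a boundary
with a large shadow on the hyperplane, hence of large measure. The constant reproduces itself, so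
the lower density bound climbs from the tiny scales where smoothness provides it up to a uniform
scale (`exists_lower_ahlfors`). The lower area bound is a consequence.

Half-spaces that are close in measure have close normals and a small offset
(`exists_halfSpace_comparison`). Comparing points of controlled curvature at dyadic scales and
summing a geometric series gives Hölder continuity of the normal with exponent s − d/p, together
with flatness (`exists_holder_normal`). A surface that is flat on a uniform scale is a graph there
(`exists_isGraphPatch`), and the tangency relation turns the modulus of the normal into one for the
gradient.

The functional inequalities with α < 1 need only the lower density bound. Sobolev follows from a
pointwise estimate with an optimized radius (`IsLowerRegular.enorm_rpow_le`), Morrey from chains of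
well-chosen points at dyadic scales (`IsLowerRegular.exists_holder_modification`). For α = 1 the
Euclidean inequalities on balls are transferred through the graph patches, then globalized by
averaging over centres (`exists_sobolev_of_graphPatch`) or by Hölder extension
(`exists_morrey_of_graphPatch`). -/

noncomputable section

/-! ### Frames of ℝᵈ × ℝ, rotations, and half-spaces. -/

/-- The first `d` coordinates of a point of `ℝ^(d+1)`. -/
def headPart {d : ℕ} (z : Euc (d + 1)) : Euc d :=
  WithLp.toLp 2 (fun i => z (Fin.castSucc i))

section GraphPoint
variable {d : ℕ}

@[simp] lemma headPart_graphPoint (u : Euc d) (t : ℝ) : headPart (graphPoint u t) = u := by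
  ext i; simp [headPart, graphPoint]

@[simp] lemma graphPoint_last (u : Euc d) (t : ℝ) : graphPoint u t (Fin.last d) = t := by
  simp [graphPoint]

@[simp] lemma graphPoint_castSucc (u : Euc d) (t : ℝ) (i : Fin d) :
    graphPoint u t (Fin.castSucc i) = u i := by
  simp [graphPoint]

lemma graphPoint_headPart (z : Euc (d + 1)) : graphPoint (headPart z) (z (Fin.last d)) = z := by
  ext i
  refine Fin.lastCases ?_ (fun i => ?_) i
  · simp
  · simp [headPart]

lemma inner_graphPoint (u v : Euc d) (t s : ℝ) :
    inner ℝ (graphPoint u t) (graphPoint v s) = inner ℝ u v + t * s := by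
  simp [PiLp.inner_apply, Fin.sum_univ_castSucc, mul_comm]

lemma norm_graphPoint_sq (u : Euc d) (t : ℝ) : ‖graphPoint u t‖ ^ 2 = ‖u‖ ^ 2 + t ^ 2 := by
  rw [← real_inner_self_eq_norm_sq, inner_graphPoint, real_inner_self_eq_norm_sq]; ring

/-- The identification of `ℝᵈ × ℝ` with `ℝ^(d+1)` given by `graphPoint`, as an isometry for the
Euclidean norms. -/
def graphIsometry (d : ℕ) : WithLp 2 (Euc d × ℝ) ≃ₗᵢ[ℝ] Euc (d + 1) where
  toFun p := graphPoint p.fst p.snd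
  invFun z := WithLp.toLp 2 (headPart z, z (Fin.last d))
  map_add' p q := by
    ext i; refine Fin.lastCases ?_ (fun i => ?_) i <;> simp
  map_smul' c p := by
    ext i; refine Fin.lastCases ?_ (fun i => ?_) i <;> simp
  left_inv p := by simp; rfl
  right_inv z := by simp [graphPoint_headPart]
  norm_map' p := by
    have h : ‖graphPoint p.fst p.snd‖ ^ 2 = ‖p‖ ^ 2 := by
      rw [norm_graphPoint_sq, WithLp.prod_norm_sq_eq_of_L2]; simp
    exact (sq_eq_sq₀ (norm_nonneg _) (norm_nonneg _)).1 h

/-- The identification of `ℝᵈ × ℝ` with `ℝ^(d+1)` given by `graphPoint`, as a continuous linear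
equivalence. -/
def graphEquiv (d : ℕ) : (Euc d × ℝ) ≃L[ℝ] Euc (d + 1) :=
  (WithLp.prodContinuousLinearEquiv 2 ℝ (Euc d) ℝ).symm.trans
    (graphIsometry d).toContinuousLinearEquiv

@[simp] lemma graphEquiv_apply (p : Euc d × ℝ) : graphEquiv d p = graphPoint p.1 p.2 := rfl

@[simp] lemma graphEquiv_symm_apply (z : Euc (d + 1)) :
    (graphEquiv d).symm z = (headPart z, z (Fin.last d)) := by
  rw [ContinuousLinearEquiv.symm_apply_eq]; simp [graphPoint_headPart]

lemma measurePreserving_graphEquiv : MeasurePreserving (graphEquiv d) :=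
  (graphIsometry d).measurePreserving.comp (WithLp.volume_preserving_toLp (Euc d) ℝ)

lemma graphPoint_add (u v : Euc d) (t s : ℝ) :
    graphPoint (u + v) (t + s) = graphPoint u t + graphPoint v s :=
  (graphEquiv d).map_add (u, t) (v, s)

lemma graphPoint_sub (u v : Euc d) (t s : ℝ) :
    graphPoint (u - v) (t - s) = graphPoint u t - graphPoint v s :=
  (graphEquiv d).map_sub (u, t) (v, s)

lemma graphPoint_smul (c : ℝ) (u : Euc d) (t : ℝ) :
    graphPoint (c • u) (c * t) = c • graphPoint u t :=
  (graphEquiv d).map_smul c (u, t)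

@[simp] lemma graphPoint_zero_zero : graphPoint (0 : Euc d) 0 = 0 := (graphEquiv d).map_zero

lemma norm_graphPoint_le (u : Euc d) (t : ℝ) : ‖graphPoint u t‖ ≤ ‖u‖ + |t| := by
  refine abs_le_of_sq_le_sq' ?_ (by positivity) |>.2
  rw [norm_graphPoint_sq, ← sq_abs t]
  nlinarith [mul_nonneg (norm_nonneg u) (abs_nonneg t)]

lemma norm_le_norm_graphPoint (u : Euc d) (t : ℝ) : ‖u‖ ≤ ‖graphPoint u t‖ := by
  refine abs_le_of_sq_le_sq' ?_ (by positivity) |>.2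
  rw [norm_graphPoint_sq]; nlinarith [sq_nonneg t]

/-- The last standard basis vector. -/
def lastVec (d : ℕ) : Euc (d + 1) := graphPoint 0 1

lemma inner_graphPoint_lastVec (u : Euc d) (t : ℝ) :
    inner ℝ (graphPoint u t) (lastVec d) = t := by
  simp [lastVec, inner_graphPoint]

lemma norm_lastVec : ‖lastVec d‖ = 1 := by
  have := norm_graphPoint_sq (0 : Euc d) 1
  simp only [norm_zero] at this
  rw [lastVec]; nlinarith [norm_nonneg (graphPoint (0 : Euc d) 1)]

/-- Affine coordinates on `ℝ^(d+1)` adapted to the base point `x₀` and the rotation `L`. -/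
def frameMap (x₀ : Euc (d + 1)) (L : Euc (d + 1) ≃ₗᵢ[ℝ] Euc (d + 1)) (p : Euc d × ℝ) :
    Euc (d + 1) :=
  x₀ + L (graphPoint p.1 p.2)

/-- The coordinates of a point in the frame `(x₀, L)`. -/
def frameCoord (x₀ : Euc (d + 1)) (L : Euc (d + 1) ≃ₗᵢ[ℝ] Euc (d + 1)) (z : Euc (d + 1)) :
    Euc d × ℝ :=
  (graphEquiv d).symm (L.symm (z - x₀))

variable (x₀ : Euc (d + 1)) (L : Euc (d + 1) ≃ₗᵢ[ℝ] Euc (d + 1))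

@[simp] lemma frameCoord_frameMap (p : Euc d × ℝ) : frameCoord x₀ L (frameMap x₀ L p) = p := by
  simp [frameCoord, frameMap]

@[simp] lemma frameMap_frameCoord (z : Euc (d + 1)) :
    frameMap x₀ L (frameCoord x₀ L z) = z := by
  rw [frameMap, frameCoord, ← graphEquiv_apply, ContinuousLinearEquiv.apply_symm_apply]
  simp

lemma frameMap_sub (p q : Euc d × ℝ) :
    frameMap x₀ L p - frameMap x₀ L q = L (graphPoint (p.1 - q.1) (p.2 - q.2)) := by
  simp [frameMap, graphPoint_sub]

lemma norm_frameMap_sub (p q : Euc d × ℝ) :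
    ‖frameMap x₀ L p - frameMap x₀ L q‖ = ‖graphPoint (p.1 - q.1) (p.2 - q.2)‖ := by
  rw [frameMap_sub, LinearIsometryEquiv.norm_map]

@[simp] lemma frameMap_zero : frameMap x₀ L (0, 0) = x₀ := by simp [frameMap]

lemma frameCoord_self : frameCoord x₀ L x₀ = (0, 0) := by
  rw [← frameCoord_frameMap x₀ L (0, 0), frameMap_zero]

lemma contDiff_frameMap {n : WithTop ℕ∞} : ContDiff ℝ n (frameMap x₀ L) :=
  contDiff_const.add (L.contDiff.comp (graphEquiv d).contDiff)

lemma contDiff_frameCoord {n : WithTop ℕ∞} : ContDiff ℝ n (frameCoord x₀ L) :=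
  (graphEquiv d).symm.contDiff.comp (L.symm.contDiff.comp (contDiff_id.sub contDiff_const))

lemma continuous_frameMap : Continuous (frameMap x₀ L) :=
  (contDiff_frameMap x₀ L (n := 0)).continuous

lemma continuous_frameCoord : Continuous (frameCoord x₀ L) :=
  (contDiff_frameCoord x₀ L (n := 0)).continuous

lemma frameCoord_snd (z : Euc (d + 1)) :
    (frameCoord x₀ L z).2 = inner ℝ (z - x₀) (L (lastVec d)) := by
  obtain ⟨p, rfl⟩ : ∃ p, frameMap x₀ L p = z := ⟨_, frameMap_frameCoord x₀ L z⟩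
  rw [frameCoord_frameMap]
  simp [frameMap, inner_graphPoint_lastVec]

lemma lipschitzWith_frameCoord_fst : LipschitzWith 1 (fun z => (frameCoord x₀ L z).1) := by
  refine LipschitzWith.of_dist_le_mul fun z w => ?_
  have := norm_frameMap_sub x₀ L (frameCoord x₀ L z) (frameCoord x₀ L w)
  simp only [frameMap_frameCoord] at this
  rw [dist_eq_norm, dist_eq_norm, this]
  simpa using norm_le_norm_graphPoint _ _

lemma measurePreserving_frameMap : MeasurePreserving (frameMap x₀ L) :=
  (measurePreserving_add_left volume x₀).comp
    (L.measurePreserving.comp measurePreserving_graphEquiv)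

lemma measurePreserving_frameCoord : MeasurePreserving (frameCoord x₀ L) :=
  MeasurePreserving.symm (e := MeasurableEquiv.mk ⟨frameMap x₀ L, frameCoord x₀ L,
    frameCoord_frameMap x₀ L, frameMap_frameCoord x₀ L⟩ (continuous_frameMap x₀ L).measurable
    (continuous_frameCoord x₀ L).measurable) (measurePreserving_frameMap x₀ L)

lemma volume_frameMap_image {A : Set (Euc d × ℝ)} :
    volume (frameMap x₀ L '' A) = volume A := by
  have := (measurePreserving_frameMap x₀ L).measure_preimage_emb
    ((MeasurableEquiv.mk ⟨frameMap x₀ L, frameCoord x₀ L,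
    frameCoord_frameMap x₀ L, frameMap_frameCoord x₀ L⟩ (continuous_frameMap x₀ L).measurable
    (continuous_frameCoord x₀ L).measurable).measurableEmbedding) (frameMap x₀ L '' A)
  rw [← this, preimage_image_eq]
  exact (Function.LeftInverse.injective (frameCoord_frameMap x₀ L))

/-- A linear isometry of determinant one is given by a special orthogonal matrix. -/
lemma exists_specialOrthogonal_of_det_eq_one {m : ℕ} (L : Euc m ≃ₗᵢ[ℝ] Euc m)
    (hL : LinearMap.det (L.toLinearEquiv : Euc m →ₗ[ℝ] Euc m) = 1) :
    ∃ P ∈ Matrix.specialOrthogonalGroup (Fin m) ℝ, ∀ z, Matrix.toEuclideanLin P z = L z := by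
  set T : Euc m →ₗ[ℝ] Euc m := (L.toLinearEquiv : Euc m →ₗ[ℝ] Euc m) with hT
  have hP : Matrix.toEuclideanLin (Matrix.toEuclideanLin.symm T) = T :=
    LinearEquiv.apply_symm_apply _ _
  refine ⟨Matrix.toEuclideanLin.symm T, ?_, fun z => by rw [hP]; rfl⟩
  set A := Matrix.toEuclideanLin.symm T
  rw [Matrix.mem_specialOrthogonalGroup_iff]
  constructor
  · rw [Matrix.mem_orthogonalGroup_iff']
    apply Matrix.toEuclideanLin.injective
    have h2 : Matrix.toEuclideanLin (star A) = LinearMap.adjoint (Matrix.toEuclideanLin A) :=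
      Matrix.toEuclideanLin_conjTranspose_eq_adjoint A
    have h3 : Matrix.toEuclideanLin (star A * A) =
        (Matrix.toEuclideanLin (star A)) ∘ₗ (Matrix.toEuclideanLin A) := by
      ext x : 1; simp
    change Matrix.toEuclideanLin (star A * A) = _
    rw [h3, h2, hP]
    refine LinearMap.ext fun x => ext_inner_right ℝ fun y => ?_
    rw [LinearMap.comp_apply, LinearMap.adjoint_inner_left]
    simp [hT]
  · rw [← hL, ← hP, Matrix.toEuclideanLin_eq_toLin_orthonormal, LinearMap.det_toLin]

/-- Two distinct vectors `w`, `ν` of the same length are exchanged by a rotation, provided that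
some nonzero vector is orthogonal to `w`. -/
lemma exists_isometry_det_eq_one {F : Type*} [NormedAddCommGroup F] [InnerProductSpace ℝ F]
    [FiniteDimensional ℝ F] {w ν e : F} (h : ‖w‖ = ‖ν‖) (hne : w ≠ ν) (he : e ≠ 0)
    (hew : inner ℝ e w = 0) :
    ∃ L : F ≃ₗᵢ[ℝ] F, LinearMap.det (L.toLinearEquiv : F →ₗ[ℝ] F) = 1 ∧ L w = ν := by
  have hdet : ∀ v : F, v ≠ 0 →
      LinearMap.det ((Submodule.span ℝ {v}).orthogonal.reflection.toLinearEquiv : F →ₗ[ℝ] F)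
        = -1 := by
    intro v hv
    rw [Submodule.det_reflection, Submodule.orthogonal_orthogonal, finrank_span_singleton hv,
      pow_one]
  -- A product of two reflections: the one in e^⊥ fixes w, the one in (w − ν)^⊥ takes w to ν because
  -- the lengths agree, and the determinants multiply to (−1)·(−1).
  refine ⟨((Submodule.span ℝ {e}).orthogonal.reflection).trans
    ((Submodule.span ℝ {w - ν}).orthogonal.reflection), ?_, ?_⟩
  · have := LinearMap.det_comp
      ((Submodule.span ℝ {w - ν}).orthogonal.reflection.toLinearEquiv : F →ₗ[ℝ] F)
      ((Submodule.span ℝ {e}).orthogonal.reflection.toLinearEquiv : F →ₗ[ℝ] F)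
    rw [hdet _ he, hdet _ (sub_ne_zero.2 hne)] at this
    norm_num at this
    exact this
  · have h1 : (Submodule.span ℝ {e}).orthogonal.reflection w = w :=
      Submodule.reflection_mem_subspace_eq_self
        (Submodule.mem_orthogonal_singleton_iff_inner_right.2 hew)
    rw [LinearIsometryEquiv.trans_apply, h1, Submodule.reflection_sub h]

/-- Every unit vector of `ℝ^(d+1)`, `d ≥ 1`, is the image of the last basis vector under a
rotation. -/
lemma exists_rotation (hd : 1 ≤ d) (ν : Euc (d + 1)) (hν : ‖ν‖ = 1) :
    ∃ P ∈ Matrix.specialOrthogonalGroup (Fin (d + 1)) ℝ,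
      ∃ L : Euc (d + 1) ≃ₗᵢ[ℝ] Euc (d + 1), (∀ z, Matrix.toEuclideanLin P z = L z) ∧
        L (lastVec d) = ν := by
  suffices h : ∃ L : Euc (d + 1) ≃ₗᵢ[ℝ] Euc (d + 1),
      LinearMap.det (L.toLinearEquiv : Euc (d + 1) →ₗ[ℝ] Euc (d + 1)) = 1 ∧
      L (lastVec d) = ν by
    obtain ⟨L, hL, hLν⟩ := h
    obtain ⟨P, hP, hPL⟩ := exists_specialOrthogonal_of_det_eq_one L hL
    exact ⟨P, hP, L, hPL, hLν⟩
  by_cases h : lastVec d = ν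
  · exact ⟨LinearIsometryEquiv.refl ℝ _, LinearMap.det_id, h⟩
  -- d ≥ 1 supplies a nonzero horizontal vector, orthogonal to `lastVec d`.
  have he0 : graphPoint (EuclideanSpace.single (⟨0, hd⟩ : Fin d) (1 : ℝ)) 0 ≠ 0 := by
    intro h0
    have := congrArg (fun w => headPart w ⟨0, hd⟩) h0
    simp [headPart] at this
  exact exists_isometry_det_eq_one (by rw [norm_lastVec, hν]) h he0
    (inner_graphPoint_lastVec _ _)

/-- The open half-space through `x` with outward normal `ν`. -/
def halfSpace {m : ℕ} (x ν : Euc m) : Set (Euc m) := {z | inner ℝ (z - x) ν < 0}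

lemma measurableSet_halfSpace {m : ℕ} (x ν : Euc m) : MeasurableSet (halfSpace x ν) :=
  (isOpen_lt (by fun_prop) continuous_const).measurableSet

/-- Volume of the part of a slab lying in a ball. -/
lemma le_volume_ball_inter_slab (hd : 1 ≤ d) (x m : Euc (d + 1)) (hm : ‖m‖ = 1) {r a b : ℝ}
    (hr : 0 < r) (ha : -(r / 2) ≤ a) (hb : b ≤ r / 2) :
    volume (Metric.ball (0 : Euc d) 1) * ENNReal.ofReal ((r / 2) ^ d * (b - a)) ≤
      volume (Metric.ball x r ∩ {z | a ≤ inner ℝ (z - x) m ∧ inner ℝ (z - x) m < b}) := by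
  obtain ⟨-, -, L, -, hL⟩ := exists_rotation hd m hm
  -- In a frame with last axis m, the cylinder over B(0, r/2) with heights in [a, b) lies in the
  -- ball, since ‖u‖ + |t| < r there. The left side is the volume of this cylinder.
  have h1 : volume (Metric.ball (0 : Euc d) (r / 2) ×ˢ Ico a b) =
      volume (Metric.ball (0 : Euc d) 1) * ENNReal.ofReal ((r / 2) ^ d * (b - a)) := by
    rw [Measure.volume_eq_prod, Measure.prod_prod, Real.volume_Ico,
      Measure.addHaar_ball_of_pos _ _ (by positivity), ENNReal.ofReal_mul (by positivity),
      finrank_euclideanSpace_fin]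
    ring
  rw [← h1, ← volume_frameMap_image x L]
  apply measure_mono
  rintro _ ⟨⟨u, t⟩, ⟨hu, ht⟩, rfl⟩
  simp only [mem_ball_zero_iff, mem_Ico] at hu ht
  have h2 : inner ℝ (frameMap x L (u, t) - x) m = t := by
    rw [← hL, ← frameCoord_snd, frameCoord_frameMap]
  refine ⟨?_, by simpa [h2] using ht⟩
  have h3 := norm_frameMap_sub x L (u, t) (0, 0)
  rw [frameMap_zero] at h3
  rw [mem_ball_iff_norm, h3]
  refine (norm_graphPoint_le _ _).trans_lt ?_
  simp only [sub_zero]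
  have : |t| ≤ r / 2 := abs_le.2 ⟨by linarith, by linarith⟩
  linarith

end GraphPoint
end

/-! ### The outward normal and local graphs. -/

noncomputable section

section Normal
open Filter Topology
variable {m : ℕ} {Ω : Set (Euc m)} {y : Euc m}

lemma inner_gradient_eq_fderiv (ρ : Euc m → ℝ) (z w : Euc m) :
    inner ℝ (gradient ρ z) w = fderiv ℝ ρ z w := by
  rw [gradient, InnerProductSpace.toDual_symm_apply]

lemma IsLocalDefiningFunction.differentiableAt {U : Set (Euc m)} {ρ : Euc m → ℝ}
    (h : IsLocalDefiningFunction Ω y U ρ) {z : Euc m} (hz : z ∈ U) : DifferentiableAt ℝ ρ z :=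
  (h.smooth.contDiffAt (h.isOpen.mem_nhds hz)).differentiableAt (by simp)

/-- The derivative of ρ at y along w decides on which side short segments start. This describes the
normal through Ω alone, which yields its uniqueness and lets segments issuing from y be compared
with the tangent half-space. -/
lemma IsLocalDefiningFunction.eventually_sign {U : Set (Euc m)} {ρ : Euc m → ℝ}
    (h : IsLocalDefiningFunction Ω y U ρ) (w : Euc m) :
    (inner ℝ (gradient ρ y) w < 0 → ∀ᶠ t in 𝓝[>] (0 : ℝ), y + t • w ∈ Ω) ∧
    (0 < inner ℝ (gradient ρ y) w → ∀ᶠ t in 𝓝[>] (0 : ℝ), y + t • w ∉ Ω) := by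
  have hc : Tendsto (fun t : ℝ => y + t • w) (𝓝[>] 0) (𝓝 y) := by
    have : Continuous (fun t : ℝ => y + t • w) := by fun_prop
    simpa using (this.tendsto 0).mono_left nhdsWithin_le_nhds
  have hU : ∀ᶠ t in 𝓝[>] (0 : ℝ), y + t • w ∈ U := hc (h.isOpen.mem_nhds h.mem)
  have hd : HasDerivAt (fun t : ℝ => ρ (y + t • w)) (inner ℝ (gradient ρ y) w) 0 := by
    have h1 : HasDerivAt (fun t : ℝ => y + t • w) w 0 := by
      simpa using ((hasDerivAt_id (0 : ℝ)).smul_const w).const_add y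
    have h2 : HasFDerivAt ρ (fderiv ℝ ρ y) (y + (0 : ℝ) • w) := by
      simpa using (h.differentiableAt h.mem).hasFDerivAt
    simpa [inner_gradient_eq_fderiv, Function.comp_def] using h2.comp_hasDerivAt (0 : ℝ) h1
  have hs := (hasDerivAt_iff_tendsto_slope.1 hd).mono_left
    (nhdsWithin_mono 0 (fun t (ht : 0 < t) => ht.ne'))
  have hpos : ∀ᶠ t in 𝓝[>] (0 : ℝ), 0 < t := self_mem_nhdsWithin
  constructor
  · intro hneg
    filter_upwards [hU, hs.eventually_lt_const hneg, hpos] with t ht1 ht2 ht3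
    rw [h.mem_iff _ ht1]
    simp only [slope, vsub_eq_sub, sub_zero, zero_smul, add_zero, h.eq_zero, smul_eq_mul] at ht2
    by_contra hcon
    exact absurd ht2 (not_lt.2 (mul_nonneg (by positivity) (not_lt.1 hcon)))
  · intro hneg
    filter_upwards [hU, hs.eventually_const_lt hneg, hpos] with t ht1 ht2 ht3
    rw [h.mem_iff _ ht1]
    simp only [slope, vsub_eq_sub, sub_zero, zero_smul, add_zero, h.eq_zero, smul_eq_mul] at ht2
    intro hcon
    exact absurd ht2 (not_lt.2 (mul_nonpos_of_nonneg_of_nonpos (by positivity) hcon.le))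

lemma IsOutwardUnitNormal.norm_eq_one {ν : Euc m} (h : IsOutwardUnitNormal Ω y ν) : ‖ν‖ = 1 := by
  obtain ⟨U, ρ, hρ, rfl⟩ := h
  rw [norm_smul, norm_inv, norm_norm, inv_mul_cancel₀ (norm_ne_zero_iff.2 hρ.gradient_ne_zero)]

lemma IsOutwardUnitNormal.eventually_mem {ν w : Euc m} (h : IsOutwardUnitNormal Ω y ν)
    (hw : inner ℝ ν w < 0) : ∀ᶠ t in 𝓝[>] (0 : ℝ), y + t • w ∈ Ω := by
  obtain ⟨U, ρ, hρ, rfl⟩ := h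
  refine (hρ.eventually_sign w).1 ?_
  rw [real_inner_smul_left] at hw
  exact (pos_iff_neg_of_mul_neg hw).1 (inv_pos.2 (norm_pos_iff.2 hρ.gradient_ne_zero))

lemma IsOutwardUnitNormal.eventually_notMem {ν w : Euc m} (h : IsOutwardUnitNormal Ω y ν)
    (hw : 0 < inner ℝ ν w) : ∀ᶠ t in 𝓝[>] (0 : ℝ), y + t • w ∉ Ω := by
  obtain ⟨U, ρ, hρ, rfl⟩ := h
  refine (hρ.eventually_sign w).2 ?_
  rw [real_inner_smul_left] at hw
  exact (pos_iff_pos_of_mul_pos hw).1 (inv_pos.2 (norm_pos_iff.2 hρ.gradient_ne_zero))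

/-- Two distinct unit normals would make short segments in the direction ν' − ν enter Ω and avoid it
at once. Hence the choice made by `Classical.epsilon` in `outwardNormal` is immaterial. -/
lemma IsOutwardUnitNormal.unique {ν ν' : Euc m} (h : IsOutwardUnitNormal Ω y ν)
    (h' : IsOutwardUnitNormal Ω y ν') : ν = ν' := by
  by_contra hne
  have h1 := (inner_lt_one_iff_real_of_norm_eq_one h.norm_eq_one h'.norm_eq_one).2 hne
  have e1 : inner ℝ ν (ν' - ν) < 0 := by
    rw [inner_sub_right, real_inner_self_eq_norm_sq, h.norm_eq_one]; linarith
  have e2 : 0 < inner ℝ ν' (ν' - ν) := by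
    rw [inner_sub_right, real_inner_self_eq_norm_sq, h'.norm_eq_one, real_inner_comm]; linarith
  obtain ⟨t, ht1, ht2⟩ := ((h.eventually_mem e1).and (h'.eventually_notMem e2)).exists
  exact ht2 ht1

lemma IsSmoothBoundedDomain.isOutwardUnitNormal (hΩ : IsSmoothBoundedDomain Ω)
    (hy : y ∈ frontier Ω) : IsOutwardUnitNormal Ω y (outwardNormal Ω y) := by
  obtain ⟨U, ρ, hρ⟩ := hΩ.smooth_frontier y hy
  exact Classical.epsilon_spec ⟨_, U, ρ, hρ, rfl⟩

lemma IsSmoothBoundedDomain.norm_outwardNormal (hΩ : IsSmoothBoundedDomain Ω)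
    (hy : y ∈ frontier Ω) : ‖outwardNormal Ω y‖ = 1 :=
  (hΩ.isOutwardUnitNormal hy).norm_eq_one

lemma IsLocalDefiningFunction.eq_zero_of_mem_frontier (hΩ : IsOpen Ω) {U : Set (Euc m)}
    {ρ : Euc m → ℝ} (h : IsLocalDefiningFunction Ω y U ρ) {z : Euc m} (hz : z ∈ U)
    (hzΩ : z ∈ frontier Ω) : ρ z = 0 := by
  rw [hΩ.frontier_eq] at hzΩ
  have h1 : 0 ≤ ρ z := by
    by_contra hcon
    exact hzΩ.2 ((h.mem_iff z hz).2 (not_le.1 hcon))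
  refine le_antisymm ?_ h1
  by_contra hcon
  have hev : ∀ᶠ w in 𝓝 z, 0 < ρ w :=
    (h.differentiableAt hz).continuousAt.eventually_const_lt (not_le.1 hcon)
  obtain ⟨w, ⟨hw1, hw2⟩, hw3⟩ := mem_closure_iff_nhds.1 hzΩ.1 _
    (hev.and (h.isOpen.mem_nhds hz))
  exact absurd ((h.mem_iff w hw2).1 hw3) (not_lt.2 hw1.le)

lemma IsLocalDefiningFunction.continuousOn_gradient {U : Set (Euc m)} {ρ : Euc m → ℝ}
    (h : IsLocalDefiningFunction Ω y U ρ) : ContinuousOn (gradient ρ) U := by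
  have : ContinuousOn (fderiv ℝ ρ) U := h.smooth.continuousOn_fderiv_of_isOpen h.isOpen (by simp)
  exact (InnerProductSpace.toDual ℝ (Euc m)).symm.continuous.comp_continuousOn this

/-- One defining function serves at all nearby boundary points where its gradient is nonzero, so the
normal is locally given by a single formula. Continuity of the normal is read off from it. -/
lemma IsLocalDefiningFunction.outwardNormal_eq (hΩ : IsSmoothBoundedDomain Ω) {U : Set (Euc m)}
    {ρ : Euc m → ℝ} (h : IsLocalDefiningFunction Ω y U ρ) {z : Euc m} (hz : z ∈ U)
    (hzΩ : z ∈ frontier Ω) (hg : gradient ρ z ≠ 0) :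
    outwardNormal Ω z = ‖gradient ρ z‖⁻¹ • gradient ρ z :=
  (hΩ.isOutwardUnitNormal hzΩ).unique
    ⟨U, ρ, ⟨h.isOpen, hz, h.smooth, h.eq_zero_of_mem_frontier hΩ.isOpen hz hzΩ, hg, h.mem_iff⟩, rfl⟩

lemma IsSmoothBoundedDomain.continuousOn_outwardNormal (hΩ : IsSmoothBoundedDomain Ω) :
    ContinuousOn (outwardNormal Ω) (frontier Ω) := by
  intro y hy
  obtain ⟨U, ρ, h⟩ := hΩ.smooth_frontier y hy
  have hU := h.isOpen.mem_nhds h.mem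
  have hc : ContinuousAt (gradient ρ) y := (h.continuousOn_gradient y h.mem).continuousAt hU
  have hne : ∀ᶠ z in 𝓝 y, gradient ρ z ≠ 0 := hc.eventually_ne h.gradient_ne_zero
  have hc2 : ContinuousWithinAt (fun z => ‖gradient ρ z‖⁻¹ • gradient ρ z) (frontier Ω) y :=
    ((hc.norm.inv₀ (norm_ne_zero_iff.2 h.gradient_ne_zero)).smul hc).continuousWithinAt
  refine hc2.congr_of_eventuallyEq ?_ (h.outwardNormal_eq hΩ h.mem hy h.gradient_ne_zero)
  filter_upwards [nhdsWithin_le_nhds hU, nhdsWithin_le_nhds hne, self_mem_nhdsWithin] with z h1 h2 h3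
  exact h.outwardNormal_eq hΩ h1 h3 h2

end Normal

open Filter Topology in
/-- Near a point of the boundary, a smooth domain is the region below the graph of a smooth
function over any hyperplane that is transversal to the normal. -/
lemma exists_local_graph {d : ℕ} {Ω : Set (Euc (d + 1))} (hΩ : IsSmoothBoundedDomain Ω)
    {y : Euc (d + 1)} (hy : y ∈ frontier Ω) (L : Euc (d + 1) ≃ₗᵢ[ℝ] Euc (d + 1))
    (hL : 0 < inner ℝ (outwardNormal Ω y) (L (lastVec d))) :
    ∃ δ > (0 : ℝ), ∃ ε > (0 : ℝ), ∃ f : Euc d → ℝ, ContDiffOn ℝ ∞ f (Metric.ball 0 δ) ∧ f 0 = 0 ∧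
      ∀ u ∈ Metric.ball (0 : Euc d) δ, |f u| < ε ∧
        (∀ t : ℝ, |t| < ε → ((frameMap y L (u, t) ∈ Ω ↔ t < f u) ∧
          (frameMap y L (u, t) ∈ frontier Ω ↔ t = f u))) ∧
        (∀ v, inner ℝ (outwardNormal Ω (frameMap y L (u, f u)))
          (L (graphPoint v (fderiv ℝ f u v))) = 0) := by
  obtain ⟨U, ρ, hρ⟩ := hΩ.smooth_frontier y hy
  set F := frameMap y L with hF
  have hF0 : F (0, 0) = y := frameMap_zero y L
  have hFc : Continuous F := continuous_frameMap y L
  set h : Euc d × ℝ → ℝ := fun p => ρ (F p) with hh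
  have hsm : ∀ p, F p ∈ U → ContDiffAt ℝ ∞ h p := fun p hp =>
    (hρ.smooth.contDiffAt (hρ.isOpen.mem_nhds hp)).comp p (contDiff_frameMap y L).contDiffAt
  have hFd : ∀ p, HasFDerivAt F
      ((L : Euc (d + 1) →L[ℝ] Euc (d + 1)) ∘L (graphEquiv d : Euc d × ℝ →L[ℝ] Euc (d + 1))) p := by
    intro p
    exact ((L : Euc (d + 1) →L[ℝ] Euc (d + 1)) ∘L
      (graphEquiv d : Euc d × ℝ →L[ℝ] Euc (d + 1))).hasFDerivAt.const_add y
  have hder : ∀ p, F p ∈ U → ∀ v : Euc d × ℝ,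
      fderiv ℝ h p v = inner ℝ (gradient ρ (F p)) (L (graphPoint v.1 v.2)) := by
    intro p hp v
    have := ((hρ.differentiableAt hp).hasFDerivAt.comp p (hFd p)).fderiv
    rw [hh, show (fun p => ρ (F p)) = ρ ∘ F from rfl, this, inner_gradient_eq_fderiv]
    rfl
  -- positivity of the vertical derivative
  set g : Euc d × ℝ → ℝ := fun p => inner ℝ (gradient ρ (F p)) (L (lastVec d)) with hg
  have hgne : ∀ p, 0 < g p → gradient ρ (F p) ≠ 0 := by
    intro p hp h0
    simp only [hg, h0, inner_zero_left, lt_irrefl] at hp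
  have hg0 : 0 < g (0, 0) := by
    rw [hρ.outwardNormal_eq hΩ hρ.mem hy hρ.gradient_ne_zero, real_inner_smul_left] at hL
    simp only [hg, hF0]
    exact (pos_iff_pos_of_mul_pos hL).1 (inv_pos.2 (norm_pos_iff.2 hρ.gradient_ne_zero))
  have hgood : ∀ᶠ p in 𝓝 ((0, 0) : Euc d × ℝ), F p ∈ U ∧ 0 < g p := by
    have hU : ∀ᶠ p in 𝓝 ((0, 0) : Euc d × ℝ), F p ∈ U :=
      hFc.continuousAt (by rw [hF0]; exact hρ.isOpen.mem_nhds hρ.mem)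
    refine hU.and ?_
    have hc : ContinuousAt (gradient ρ) (F (0, 0)) := by
      rw [hF0]; exact (hρ.continuousOn_gradient y hρ.mem).continuousAt (hρ.isOpen.mem_nhds hρ.mem)
    have : ContinuousAt g (0, 0) :=
      (ContinuousAt.comp (f := F) (g := gradient ρ) hc hFc.continuousAt).inner
        continuousAt_const
    exact this.eventually_const_lt hg0
  have hinv : ∀ p, F p ∈ U → 0 < g p →
      (fderiv ℝ h p ∘L .inr ℝ (Euc d) ℝ).IsInvertible := by
    intro p hp hgp
    refine ⟨ContinuousLinearEquiv.unitsEquivAut ℝ (Units.mk0 (g p) hgp.ne'), ?_⟩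
    ext
    simp [hder p hp, hg, lastVec]
  obtain ⟨ε₀, hε₀, hbox⟩ := Metric.eventually_nhds_iff.1 hgood
  have hbox' : ∀ u : Euc d, ∀ t : ℝ, ‖u‖ < ε₀ → |t| < ε₀ → F (u, t) ∈ U ∧ 0 < g (u, t) := by
    intro u t hu ht
    apply hbox
    rw [Prod.dist_eq]; simp [hu, ht]
  have hUz := (hbox' 0 0 (by simpa) (by simpa)).1
  set f := (hsm (0, 0) hUz).implicitFunction (by simp) (hinv _ hUz hg0) with hf
  have hf0 : f 0 = 0 := (hsm (0, 0) hUz).implicitFunction_apply_self (by simp) (hinv _ hUz hg0)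
  have hfz : ∀ᶠ u in 𝓝 (0 : Euc d), h (u, f u) = 0 := by
    have := (hsm (0, 0) hUz).eventually_apply_implicitFunction (by simp) (hinv _ hUz hg0)
    have h0 : h (0, 0) = 0 := by simp only [hh, hF0]; exact hρ.eq_zero
    rw [h0] at this
    exact this
  have hfs : ContDiffAt ℝ ∞ f 0 :=
    (hsm (0, 0) hUz).contDiffAt_implicitFunction (by simp) (hinv _ hUz hg0)
  have hfcont : ∀ᶠ u in 𝓝 (0 : Euc d), ContinuousAt f u :=
    ((hfs.of_le (m := 1) (by norm_cast)).eventually (by simp)).mono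
      fun u hu => hu.continuousAt
  have hfε : ∀ᶠ u in 𝓝 (0 : Euc d), |f u| < ε₀ := by
    have : ContinuousAt (fun u => |f u|) 0 := hfs.continuousAt.abs
    exact this.eventually_lt_const (by simpa [hf0] using hε₀)
  obtain ⟨δ, hδ, hball⟩ := Metric.eventually_nhds_iff.1
    (hfz.and (hfcont.and hfε))
  -- Smoothness of infinite order at the single point 0 gives no common neighbourhood for all
  -- orders. The implicit function theorem is therefore applied again at each (u, f u), and its
  -- local uniqueness identifies `f` with the new implicit function.
  have hsmf : ContDiffOn ℝ ∞ f (Metric.ball 0 (min δ ε₀)) := by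
    intro u hu
    rw [mem_ball_zero_iff, lt_min_iff] at hu
    obtain ⟨-, h2, h3⟩ := hball (y := u) (by simpa using hu.1)
    obtain ⟨hU1, hg1⟩ := hbox' u (f u) hu.2 h3
    set f₁ := (hsm _ hU1).implicitFunction (by simp) (hinv _ hU1 hg1) with hf₁
    have hs1 : ContDiffAt ℝ ∞ f₁ u :=
      (hsm _ hU1).contDiffAt_implicitFunction (by simp) (hinv _ hU1 hg1)
    refine (hs1.congr_of_eventuallyEq ?_).contDiffWithinAt
    have e1 := (hsm _ hU1).eventually_apply_eq_iff_implicitFunction (by simp) (hinv _ hU1 hg1)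
    have e2 : Tendsto (fun w => (w, f w)) (𝓝 u) (𝓝 (u, f u)) := continuousAt_id.prodMk h2
    have e3 : ∀ᶠ w in 𝓝 u, w ∈ Metric.ball (0 : Euc d) δ :=
      Metric.isOpen_ball.mem_nhds (by simpa using hu.1)
    filter_upwards [e2.eventually e1, e3] with w hw1 hw2
    have hz : ∀ w ∈ Metric.ball (0 : Euc d) δ, h (w, f w) = 0 := fun w hw => (hball hw).1
    rw [hz w hw2, hz u (by simpa using hu.1)] at hw1
    exact (hw1.1 rfl).symm
  refine ⟨min δ ε₀, lt_min hδ hε₀, ε₀, hε₀, f, hsmf, hf0, ?_⟩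
  · intro u hu
    have hfd : DifferentiableAt ℝ f u :=
      (hsmf.contDiffAt (Metric.isOpen_ball.mem_nhds hu)).differentiableAt (by simp)
    rw [mem_ball_zero_iff, lt_min_iff] at hu
    obtain ⟨h1, h2, h3⟩ := hball (y := u) (by simpa using hu.1)
    -- The vertical derivative is positive in the box, so on each vertical segment the defining
    -- function vanishes only at height f u and is negative exactly below it.
    have hmono : StrictMonoOn (fun t : ℝ => h (u, t)) (Ioo (-ε₀) ε₀) := by
      have hd : ∀ t ∈ Ioo (-ε₀) ε₀, HasDerivAt (fun t : ℝ => h (u, t)) (g (u, t)) t := by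
        intro t ht
        have hU1 := (hbox' u t hu.2 (abs_lt.2 ht)).1
        have e1 := ((hsm _ hU1).differentiableAt (by simp)).hasFDerivAt
        have e2 : HasDerivAt (fun t : ℝ => (u, t)) ((0 : Euc d), (1 : ℝ)) t :=
          (hasDerivAt_const t u).prodMk (hasDerivAt_id t)
        have e3 := e1.comp_hasDerivAt t e2
        rw [hder _ hU1] at e3
        exact e3
      refine strictMonoOn_of_deriv_pos (convex_Ioo _ _)
        (fun t ht => (hd t ht).continuousAt.continuousWithinAt) ?_
      intro t ht
      rw [interior_Ioo] at ht
      rw [(hd t ht).deriv]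
      exact (hbox' u t hu.2 (abs_lt.2 ht)).2
    have hΩiff : ∀ t : ℝ, |t| < ε₀ → (F (u, t) ∈ Ω ↔ t < f u) := by
      intro t ht
      rw [hρ.mem_iff _ (hbox' u t hu.2 ht).1, ← hmono.lt_iff_lt (abs_lt.1 ht) (abs_lt.1 h3)]
      simp only [h1]; rfl
    have hfr : F (u, f u) ∈ frontier Ω := by
      rw [hΩ.isOpen.frontier_eq]
      refine ⟨?_, fun hcon => lt_irrefl _ ((hΩiff _ h3).1 hcon)⟩
      have hc : Tendsto (fun t : ℝ => F (u, t)) (𝓝[<] (f u)) (𝓝 (F (u, f u))) :=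
        ((hFc.comp (by fun_prop : Continuous fun t : ℝ => (u, t))).tendsto (f u)).mono_left
          nhdsWithin_le_nhds
      refine mem_closure_of_tendsto hc ?_
      have e1 : ∀ᶠ t in 𝓝[<] (f u), |t| < ε₀ :=
        nhdsWithin_le_nhds (continuous_abs.continuousAt.eventually_lt_const h3)
      filter_upwards [e1, self_mem_nhdsWithin] with t ht1 ht2
      exact (hΩiff t ht1).2 ht2
    refine ⟨h3, fun t ht => ⟨hΩiff t ht, ?_⟩, ?_⟩
    · refine ⟨fun hfrt => ?_, fun h => h ▸ hfr⟩
      have := hρ.eq_zero_of_mem_frontier hΩ.isOpen (hbox' u t hu.2 ht).1 hfrt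
      exact hmono.injOn (abs_lt.1 ht) (abs_lt.1 h3) (by simp only [h1]; exact this)
    · intro v
      have hU1 := hbox' u (f u) hu.2 h3
      rw [hρ.outwardNormal_eq hΩ hU1.1 hfr (hgne _ hU1.2), real_inner_smul_left]
      rw [mul_eq_zero]; right
      have e2 : HasFDerivAt (fun w => (w, f w)) ((ContinuousLinearMap.id ℝ (Euc d)).prod
          (fderiv ℝ f u)) u := (hasFDerivAt_id u).prodMk hfd.hasFDerivAt
      have e1 := ((hsm _ hU1.1).differentiableAt (by simp)).hasFDerivAt
      have e3 := HasFDerivAt.comp (g := h) (f := fun w => (w, f w)) u e1 e2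
      -- The defining function vanishes identically along the graph; comparing the two derivatives
      -- gives the tangency relation.
      have e4 : HasFDerivAt (h ∘ fun w => (w, f w)) (0 : Euc d →L[ℝ] ℝ) u := by
        refine (hasFDerivAt_const (0 : ℝ) u).congr_of_eventuallyEq ?_
        filter_upwards [Metric.isOpen_ball.mem_nhds
          (show u ∈ Metric.ball (0 : Euc d) δ by simpa using hu.1)] with w hw
        exact (hball hw).1
      have e5 := congrArg (fun A : Euc d →L[ℝ] ℝ => A v) (e3.unique e4)
      simp only [ContinuousLinearMap.comp_apply] at e5
      rw [hder _ hU1.1] at e5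
      simpa using e5
end

/-! ### Cones over the surface and the defect from the tangent half-space. -/

noncomputable section
/-- The determinant of a linear map of `ℝᵈ × ℝ` of the form `(h, τ) ↦ (t h + τ v, t φ(h) + τ c)`. -/
lemma det_cone_derivative {d : ℕ} (t c : ℝ) (ht : t ≠ 0) (φ : Euc d →L[ℝ] ℝ) (v : Euc d) :
    (t • ((ContinuousLinearMap.fst ℝ (Euc d) ℝ).prod
        (φ.comp (ContinuousLinearMap.fst ℝ (Euc d) ℝ))) +
      (ContinuousLinearMap.snd ℝ (Euc d) ℝ).smulRight (v, c)).det = t ^ d * (c - φ v) := by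
  rw [ContinuousLinearMap.det]
  set b := (EuclideanSpace.basisFun (Fin d) ℝ).toBasis with hb
  set b' := Module.Basis.singleton (Fin 1) ℝ with hb'
  rw [← LinearMap.det_toMatrix (b.prod b')]
  have hM : LinearMap.toMatrix (b.prod b') (b.prod b')
      ((t • ((ContinuousLinearMap.fst ℝ (Euc d) ℝ).prod
        (φ.comp (ContinuousLinearMap.fst ℝ (Euc d) ℝ))) +
      (ContinuousLinearMap.snd ℝ (Euc d) ℝ).smulRight (v, c) :
        Euc d × ℝ →L[ℝ] Euc d × ℝ) : Euc d × ℝ →ₗ[ℝ] Euc d × ℝ) =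
      Matrix.fromBlocks (t • (1 : Matrix (Fin d) (Fin d) ℝ)) (Matrix.of fun i _ => v i)
        (Matrix.of fun _ j => t * φ (EuclideanSpace.single j 1)) (Matrix.of fun _ _ => c) := by
    ext i j
    rcases i with i | i <;> rcases j with j | j <;>
      simp [LinearMap.toMatrix_apply, hb, hb', Matrix.one_apply]
  rw [hM]
  -- Schur complement of the block `t • 1`: the factor t in the lower left block cancels t⁻¹, which
  -- leaves c − φ v.
  let _ : Invertible (t • (1 : Matrix (Fin d) (Fin d) ℝ)) :=
    ⟨t⁻¹ • 1, by simp [smul_smul, ht], by simp [smul_smul, ht]⟩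
  rw [Matrix.det_fromBlocks₁₁]
  have hinv : ⅟(t • (1 : Matrix (Fin d) (Fin d) ℝ)) = t⁻¹ • 1 :=
    invOf_eq_right_inv (by simp [smul_smul, ht])
  rw [hinv, Matrix.det_smul, Matrix.det_one, Matrix.det_fin_one]
  have hv : φ v = ∑ j, φ (EuclideanSpace.single j 1) * v j := by
    conv_lhs => rw [← (EuclideanSpace.basisFun (Fin d) ℝ).sum_repr v]
    simp [mul_comm]
  rw [hv]
  simp [Matrix.mul_apply, Matrix.sub_apply, ht]

/-- A map that is Lipschitz on a set increases its Hausdorff measure by a bounded factor. -/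
lemma euclideanHausdorffMeasure_image_le {X Y : Type*} [EMetricSpace X] [MeasurableSpace X]
    [BorelSpace X] [EMetricSpace Y] [MeasurableSpace Y] [BorelSpace Y] {K : ℝ≥0} {f : X → Y}
    {s : Set X} (hf : LipschitzOnWith K f s) (d : ℕ) :
    (μHE[d] : Measure Y) (f '' s) ≤ (K : ℝ≥0∞) ^ d * (μHE[d] : Measure X) s := by
  simp only [Measure.euclideanHausdorffMeasure_def, Measure.smul_apply, ENNReal.smul_def,
    smul_eq_mul]
  have := hf.hausdorffMeasure_image_le (d := d) (by positivity)
  rw [ENNReal.rpow_natCast] at this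
  calc _ ≤ _ := mul_le_mul_right this _
    _ = _ := by ring

section
variable {d : ℕ} (y : Euc (d + 1)) (L : Euc (d + 1) ≃ₗᵢ[ℝ] Euc (d + 1))

/-- The `d`-dimensional measure of a set dominates the Lebesgue measure of its projections. -/
lemma volume_le_of_subset_image_frameCoord {A : Set (Euc d)} {B : Set (Euc (d + 1))}
    (h : ∀ u ∈ A, ∃ z ∈ B, (frameCoord y L z).1 = u) :
    volume A ≤ (μHE[d] : Measure (Euc (d + 1))) B := by
  have h1 := euclideanHausdorffMeasure_image_le
    ((lipschitzWith_frameCoord_fst y L).lipschitzOnWith (s := B)) d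
  rw [EuclideanSpace.euclideanHausdorffMeasure_eq_volume] at h1
  simp only [ENNReal.coe_one, one_pow, one_mul] at h1
  exact (measure_mono fun u hu => h u hu).trans h1

lemma measurable_frameCoord_fst : Measurable (fun z => (frameCoord y L z).1) :=
  (continuous_fst.comp (continuous_frameCoord y L)).measurable

/-- Integrals over a piece of a graph dominate integrals over the domain of the graph. -/
lemma lintegral_comp_le_lintegral_surface {A : Set (Euc d)} {B : Set (Euc (d + 1))}
    {Φ : Euc d → Euc (d + 1)} (hΦ : ∀ u ∈ A, Φ u ∈ B)
    (hpr : ∀ u ∈ A, (frameCoord y L (Φ u)).1 = u)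
    (hinv : ∀ z ∈ B, Φ ((frameCoord y L z).1) = z) (hB : MeasurableSet B)
    (g : Euc (d + 1) → ℝ≥0∞) :
    ∫⁻ u in A, g (Φ u) ≤ ∫⁻ z in B, g z ∂μHE[d] := by
  -- The orthogonal projection is 1-Lipschitz, so it pushes ℋᵈ on B to a measure dominating Lebesgue
  -- measure on A. This one-sided bound takes the place of the area formula, and no measurability of
  -- `g` is needed.
  have h1 : volume.restrict A ≤
      ((μHE[d] : Measure (Euc (d + 1))).restrict B).map (fun z => (frameCoord y L z).1) := by
    refine Measure.le_iff.2 fun s hs => ?_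
    rw [Measure.map_apply (measurable_frameCoord_fst y L) hs, Measure.restrict_apply hs,
      Measure.restrict_apply (measurable_frameCoord_fst y L hs)]
    refine volume_le_of_subset_image_frameCoord y L fun u hu => ⟨Φ u, ⟨?_, hΦ u hu.2⟩, hpr u hu.2⟩
    simp only [mem_preimage, hpr u hu.2, hu.1]
  calc ∫⁻ u in A, g (Φ u)
      ≤ ∫⁻ u, g (Φ u) ∂(((μHE[d] : Measure (Euc (d + 1))).restrict B).map
        (fun z => (frameCoord y L z).1)) := lintegral_mono' h1 le_rfl
    _ ≤ ∫⁻ z in B, g (Φ ((frameCoord y L z).1)) ∂μHE[d] := lintegral_map_le _ _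
    _ = ∫⁻ z in B, g z ∂μHE[d] := setLIntegral_congr_fun hB fun z hz => by rw [hinv z hz]

lemma frameMap_add_smul_sub (p q : Euc d × ℝ) (t : ℝ) :
    frameMap y L (q + t • (p - q)) = frameMap y L q + t • (frameMap y L p - frameMap y L q) := by
  rw [← sub_eq_iff_eq_add', frameMap_sub, frameMap_sub, ← map_smul, ← graphPoint_smul]
  simp
end

section Cone
variable {d : ℕ} {Ω : Set (Euc (d + 1))}

/-- The union of the segments of length `r` that start at `x` and point towards `B`. -/
def coneSet {m : ℕ} (x : Euc m) (r : ℝ) (B : Set (Euc m)) : Set (Euc m) :=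
  {w | ∃ z ∈ B, ∃ t : ℝ, 0 < t ∧ t * ‖z - x‖ < r ∧ w = x + t • (z - x)}

/-- The density of the solid angle under which the surface is seen from `x`. -/
def solidAngleDensity (Ω : Set (Euc (d + 1))) (x z : Euc (d + 1)) : ℝ≥0∞ :=
  ENNReal.ofReal (|inner ℝ (x - z) (outwardNormal Ω z)| / ‖x - z‖ ^ (d + 1))

-- In the coordinates (u, t) ↦ q + t((u, f u) − q) the cone has Jacobian t^d times the vertical
-- distance of q from the tangent plane at (u, f u). That distance is |⟨x − z, n⟩| divided by the
-- vertical component of n, which exceeds 1/2 on W; hence the factor 2. Integration over 0 < t <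
-- r/|x − z| produces the solid angle density.
open Filter Topology in
lemma exists_nhds_volume_coneSet_le (hd : 1 ≤ d) (hΩ : IsSmoothBoundedDomain Ω)
    {y : Euc (d + 1)} (hy : y ∈ frontier Ω) :
    ∃ W : Set (Euc (d + 1)), IsOpen W ∧ y ∈ W ∧ ∀ (x : Euc (d + 1)) (r : ℝ), 0 < r →
      ∀ B ⊆ W ∩ frontier Ω, MeasurableSet B → x ∉ B →
        volume (coneSet x r B) ≤
          ENNReal.ofReal (2 * r ^ (d + 1)) * ∫⁻ z in B, solidAngleDensity Ω x z ∂μHE[d] := by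
  obtain ⟨-, -, L, -, hL⟩ := exists_rotation hd _ (hΩ.norm_outwardNormal hy)
  have hpos : 0 < inner ℝ (outwardNormal Ω y) (L (lastVec d)) := by
    rw [hL, real_inner_self_eq_norm_sq, hΩ.norm_outwardNormal hy]; norm_num
  obtain ⟨δ, hδ, ε, hε, f, hf, hf0, hgraph⟩ := exists_local_graph hΩ hy L hpos
  have hball : Metric.ball (0 : Euc d) δ ∈ 𝓝 (0 : Euc d) := Metric.ball_mem_nhds _ hδ
  have hmem : ∀ u ∈ Metric.ball (0 : Euc d) δ, frameMap y L (u, f u) ∈ frontier Ω := fun u hu =>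
    ((hgraph u hu).2.1 _ (hgraph u hu).1).2.2 rfl
  have hnear : ∀ᶠ u in 𝓝 (0 : Euc d), 1 / 2 <
      inner ℝ (outwardNormal Ω (frameMap y L (u, f u))) (L (lastVec d)) := by
    have h1 : Tendsto (fun u => frameMap y L (u, f u)) (𝓝 0) (𝓝[frontier Ω] y) := by
      rw [tendsto_nhdsWithin_iff]
      refine ⟨?_, Filter.eventually_of_mem hball hmem⟩
      have hc : ContinuousAt f 0 := hf.continuousOn.continuousAt hball
      have := (continuous_frameMap y L).continuousAt.comp
        (f := fun u : Euc d => (u, f u)) (x := 0) (continuousAt_id.prodMk hc)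
      simpa [ContinuousAt, Function.comp_def, hf0] using this
    have h2 := Filter.Tendsto.inner (𝕜 := ℝ)
      ((hΩ.continuousOn_outwardNormal y hy).tendsto.comp h1) (tendsto_const_nhds (x := L (lastVec d)))
    refine h2.eventually_const_lt ?_
    rw [hL, real_inner_self_eq_norm_sq, hΩ.norm_outwardNormal hy]; norm_num
  obtain ⟨δ', hδ', hsub⟩ := Metric.eventually_nhds_iff_ball.1 (hnear.and hball)
  set U := Metric.ball (0 : Euc d) δ' with hU
  have hpc := continuous_frameCoord y L
  refine ⟨{z | (frameCoord y L z).1 ∈ U ∧ |(frameCoord y L z).2| < ε}, ?_, ?_, ?_⟩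
  · exact (Metric.isOpen_ball.preimage (continuous_fst.comp hpc)).inter
      (isOpen_lt (continuous_abs.comp (continuous_snd.comp hpc)) continuous_const)
  · simp [frameCoord_self, hU, hδ', hε]
  intro x r hr B hB hBm hxB
  -- `f` is controlled only on `U`; its extension by zero is measurable everywhere.
  set f' : Euc d → ℝ := U.indicator f with hf'
  have hfU : ContinuousOn f U := hf.continuousOn.mono fun u hu => (hsub u hu).2
  have hf'm : Measurable f' := by
    classical
    rw [hf', ← Set.piecewise_eq_indicator]
    exact hfU.measurable_piecewise continuousOn_const Metric.isOpen_ball.measurableSet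
  have hf'U : ∀ u ∈ U, f' u = f u := fun u hu => indicator_of_mem hu f
  set Φ : Euc d → Euc (d + 1) := fun u => frameMap y L (u, f' u) with hΦ
  have hΦm : Measurable Φ :=
    (continuous_frameMap y L).measurable.comp (measurable_id.prodMk hf'm)
  set A : Set (Euc d) := U ∩ Φ ⁻¹' B with hA
  have hAm : MeasurableSet A := Metric.isOpen_ball.measurableSet.inter (hΦm hBm)
  have hΦpr : ∀ u, (frameCoord y L (Φ u)).1 = u := fun u => by simp [hΦ]
  have hinv : ∀ z ∈ B, (frameCoord y L z).1 ∈ U ∧ Φ ((frameCoord y L z).1) = z := by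
    intro z hz
    obtain ⟨⟨h1, h2⟩, h3⟩ := hB hz
    refine ⟨h1, ?_⟩
    have h4 := ((hgraph _ (hsub _ h1).2).2.1 _ h2).2
    simp only [Prod.mk.eta, frameMap_frameCoord] at h4
    simp only [hΦ, hf'U _ h1, ← h4.1 h3, Prod.mk.eta, frameMap_frameCoord]
  set q := frameCoord y L x with hq
  have hqx : frameMap y L q = x := frameMap_frameCoord y L x
  set D : Set (Euc d × ℝ) := {p | p.1 ∈ A ∧ 0 < p.2 ∧ p.2 * ‖Φ p.1 - x‖ < r} with hD
  have hDm : MeasurableSet D := by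
    have e : D = Prod.fst ⁻¹' A ∩ ({p | 0 < p.2} ∩ {p | p.2 * ‖Φ p.1 - x‖ < r}) := rfl
    rw [e]
    refine (measurable_fst hAm).inter ((measurableSet_lt measurable_const measurable_snd).inter
      (measurableSet_lt ?_ measurable_const))
    exact measurable_snd.mul ((hΦm.comp measurable_fst).sub_const x).norm
  set Ψ : Euc d × ℝ → Euc d × ℝ := fun p => q + p.2 • ((p.1, f p.1) - q) with hΨ
  have hcone : coneSet x r B ⊆ frameMap y L '' (Ψ '' D) := by
    rintro w ⟨z, hz, t, ht0, ht1, rfl⟩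
    obtain ⟨h1, h2⟩ := hinv z hz
    refine ⟨_, ⟨((frameCoord y L z).1, t), ⟨⟨h1, ?_⟩, ht0, ?_⟩, rfl⟩, ?_⟩
    · rwa [mem_preimage, h2]
    · simpa only [h2] using ht1
    · rw [hΨ]
      simp only
      rw [frameMap_add_smul_sub, hqx, ← hf'U _ h1]
      congr 3
  set Ψ' : Euc d × ℝ → (Euc d × ℝ →L[ℝ] Euc d × ℝ) := fun p =>
    p.2 • ((ContinuousLinearMap.fst ℝ (Euc d) ℝ).prod
        ((fderiv ℝ f p.1).comp (ContinuousLinearMap.fst ℝ (Euc d) ℝ))) +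
      (ContinuousLinearMap.snd ℝ (Euc d) ℝ).smulRight (p.1 - q.1, f p.1 - q.2) with hΨ'
  have hderiv : ∀ p ∈ D, HasFDerivWithinAt Ψ (Ψ' p) D p := by
    intro p hp
    have hfd : HasFDerivAt f (fderiv ℝ f p.1) p.1 :=
      ((hf.contDiffAt (Metric.isOpen_ball.mem_nhds (hsub _ hp.1.1).2)).differentiableAt
        (by simp)).hasFDerivAt
    have h1 : HasFDerivAt (fun p : Euc d × ℝ => ((p.1, f p.1) : Euc d × ℝ) - q) _ p :=
      (hasFDerivAt_fst.prodMk (hfd.comp p hasFDerivAt_fst)).sub_const q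
    exact ((hasFDerivAt_snd.smul h1).const_add q).hasFDerivWithinAt
  have hdet : ∀ p ∈ D, |(Ψ' p).det| ≤
      2 * p.2 ^ d * |inner ℝ (x - Φ p.1) (outwardNormal Ω (Φ p.1))| := by
    intro p hp
    have hpU := hp.1.1
    rw [hΨ', det_cone_derivative _ _ hp.2.1.ne', abs_mul, abs_pow, abs_of_pos hp.2.1]
    have h1 : Φ p.1 = frameMap y L (p.1, f p.1) := by simp only [hΦ, hf'U _ hpU]
    have h2 := (hgraph p.1 (hsub _ hpU).2).2.2 (p.1 - q.1)
    have h3 := (hsub _ hpU).1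
    rw [← h1] at h2 h3
    set n := outwardNormal Ω (Φ p.1)
    set φ := fderiv ℝ f p.1
    -- Split Φ(u) − x into a tangent vector, which n annihilates, and a vertical vector whose length
    -- is the factor left over in the Jacobian.
    have h4 : inner ℝ (x - Φ p.1) n =
        -((f p.1 - q.2 - φ (p.1 - q.1)) * inner ℝ n (L (lastVec d))) := by
      have e1 : x - Φ p.1 = -(L (graphPoint (p.1 - q.1) (φ (p.1 - q.1))) +
          (f p.1 - q.2 - φ (p.1 - q.1)) • L (lastVec d)) := by
        rw [h1, ← hqx, ← neg_sub, frameMap_sub, ← map_smul, ← map_add, lastVec,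
          ← graphPoint_smul, ← graphPoint_add]
        simp
      rw [e1, inner_neg_left, inner_add_left, real_inner_smul_left, real_inner_comm, h2,
        real_inner_comm n]
      ring
    rw [h4, abs_neg, abs_mul, abs_of_pos (by linarith : 0 < inner ℝ n (L (lastVec d)))]
    have h5 : 0 ≤ p.2 ^ d * |f p.1 - q.2 - φ (p.1 - q.1)| :=
      mul_nonneg (pow_nonneg hp.2.1.le _) (abs_nonneg _)
    nlinarith
  have : (volume : Measure (Euc d × ℝ)).IsAddHaarMeasure := by
    rw [Measure.volume_eq_prod]; infer_instance
  calc volume (coneSet x r B) ≤ volume (Ψ '' D) := by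
        rw [← volume_frameMap_image y L]; exact measure_mono hcone
    -- Only an upper bound for the image is used, so Ψ need not be injective: a ray may cross the
    -- surface several times.
    _ ≤ ∫⁻ p in D, ENNReal.ofReal |(Ψ' p).det| :=
        addHaar_image_le_lintegral_abs_det_fderiv volume hDm hderiv
    _ = ∫⁻ p, D.indicator (fun p => ENNReal.ofReal |(Ψ' p).det|) p :=
        (lintegral_indicator hDm _).symm
    _ ≤ ∫⁻ u, ∫⁻ t, D.indicator (fun p => ENNReal.ofReal |(Ψ' p).det|) (u, t) :=
        lintegral_prod_le _
    _ ≤ ∫⁻ u, A.indicator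
          (fun u => ENNReal.ofReal (2 * r ^ (d + 1)) * solidAngleDensity Ω x (Φ u)) u := by
        refine lintegral_mono fun u => ?_
        by_cases hu : u ∈ A
        · rw [indicator_of_mem hu]
          have hne : 0 < ‖Φ u - x‖ := by
            rw [norm_pos_iff, sub_ne_zero]; rintro h; exact hxB (h ▸ hu.2)
          -- For fixed u the parameter ranges over (0, R); bounding t ^ d by R ^ d instead of
          -- integrating it loses only a dimensional factor.
          set R := r / ‖Φ u - x‖ with hR
          have hRpos : 0 < R := div_pos hr hne
          set κ := 2 * R ^ d * |inner ℝ (x - Φ u) (outwardNormal Ω (Φ u))| with hκ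
          calc ∫⁻ t, D.indicator (fun p => ENNReal.ofReal |(Ψ' p).det|) (u, t)
              ≤ ∫⁻ t, (Ioo 0 R).indicator (fun _ => ENNReal.ofReal κ) t := by
                refine lintegral_mono fun t => ?_
                by_cases hp : (u, t) ∈ D
                · have htR : t < R := by rw [hR, lt_div_iff₀ hne]; exact hp.2.2
                  rw [indicator_of_mem hp, indicator_of_mem (show t ∈ Ioo 0 R from ⟨hp.2.1, htR⟩)]
                  refine ENNReal.ofReal_le_ofReal ((hdet _ hp).trans ?_)
                  rw [hκ]
                  have := pow_le_pow_left₀ hp.2.1.le htR.le d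
                  gcongr
                · rw [indicator_of_notMem hp]; exact zero_le
            _ = ENNReal.ofReal κ * ENNReal.ofReal R := by
                rw [lintegral_indicator measurableSet_Ioo, setLIntegral_const, Real.volume_Ioo,
                  sub_zero]
            _ = ENNReal.ofReal (2 * r ^ (d + 1)) * solidAngleDensity Ω x (Φ u) := by
                rw [solidAngleDensity, ← ENNReal.ofReal_mul (by positivity),
                  ← ENNReal.ofReal_mul (by positivity), hκ, hR, norm_sub_rev x]
                congr 1
                rw [div_pow]
                field_simp
                ring
        · rw [indicator_of_notMem hu]
          refine (lintegral_eq_zero_of_ae_eq_zero (Filter.Eventually.of_forall fun t => ?_)).le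
          exact indicator_of_notMem (fun h => hu h.1) _
    _ = ENNReal.ofReal (2 * r ^ (d + 1)) * ∫⁻ u in A, solidAngleDensity Ω x (Φ u) := by
        rw [lintegral_indicator hAm, lintegral_const_mul' _ _ ENNReal.ofReal_ne_top]
    _ ≤ _ := by
        gcongr
        exact lintegral_comp_le_lintegral_surface y L (fun u hu => hu.2) (fun u _ => hΦpr u)
          (fun z hz => (hinv z hz).2) hBm _

lemma IsSmoothBoundedDomain.isCompact_frontier (hΩ : IsSmoothBoundedDomain Ω) :
    IsCompact (frontier Ω) :=
  Metric.isCompact_of_isClosed_isBounded isClosed_frontier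
    (hΩ.bounded.closure.subset frontier_subset_closure)

lemma coneSet_union {m : ℕ} (x : Euc m) (r : ℝ) (B C : Set (Euc m)) :
    coneSet x r (B ∪ C) = coneSet x r B ∪ coneSet x r C := by
  ext w
  simp only [coneSet, mem_ofPred_eq, mem_union, or_and_right, exists_or]

/-- The volume of the cone over the surface is controlled by its solid angle. -/
lemma volume_coneSet_le (hd : 1 ≤ d) (hΩ : IsSmoothBoundedDomain Ω) (x : Euc (d + 1)) {r : ℝ}
    (hr : 0 < r) {B : Set (Euc (d + 1))} (hB : B ⊆ frontier Ω) (hBm : MeasurableSet B)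
    (hx : x ∉ B) :
    volume (coneSet x r B) ≤
      ENNReal.ofReal (2 * r ^ (d + 1)) * ∫⁻ z in B, solidAngleDensity Ω x z ∂μHE[d] := by
  have key : ∃ W : Set (Euc (d + 1)), MeasurableSet W ∧ frontier Ω ⊆ W ∧
      ∀ B ⊆ W ∩ frontier Ω, MeasurableSet B → x ∉ B →
        volume (coneSet x r B) ≤
          ENNReal.ofReal (2 * r ^ (d + 1)) * ∫⁻ z in B, solidAngleDensity Ω x z ∂μHE[d] := by
    -- When B is split, the cone volume is subadditive and the integral additive, so the estimate
    -- passes to unions with the same constant and compactness applies.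
    refine hΩ.isCompact_frontier.induction_on (p := fun s => ∃ W : Set (Euc (d + 1)),
      MeasurableSet W ∧ s ⊆ W ∧ ∀ B ⊆ W ∩ frontier Ω, MeasurableSet B → x ∉ B →
        volume (coneSet x r B) ≤
          ENNReal.ofReal (2 * r ^ (d + 1)) * ∫⁻ z in B, solidAngleDensity Ω x z ∂μHE[d])
      ?_ ?_ ?_ ?_
    · refine ⟨∅, MeasurableSet.empty, Subset.rfl, fun B hB _ _ => ?_⟩
      have : B = ∅ := by simpa using hB
      simp [this, coneSet]
    · rintro s t hst ⟨W, hW, hs, h⟩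
      exact ⟨W, hW, hst.trans hs, h⟩
    · rintro s t ⟨W, hW, hs, h⟩ ⟨W', hW', ht, h'⟩
      refine ⟨W ∪ W', hW.union hW', union_subset_union hs ht, fun B hB hBm hx => ?_⟩
      have e : B = (B ∩ W) ∪ (B \ W) := (inter_union_sdiff B W).symm
      calc volume (coneSet x r B) = volume (coneSet x r ((B ∩ W) ∪ (B \ W))) := by rw [← e]
        _ ≤ volume (coneSet x r (B ∩ W)) + volume (coneSet x r (B \ W)) := by
            rw [coneSet_union]; exact measure_union_le _ _
        _ ≤ _ := add_le_add
            (h _ (fun z hz => ⟨hz.2, (hB hz.1).2⟩) (hBm.inter hW) fun hh => hx hh.1)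
            (h' _ (fun z hz => ⟨(hB hz.1).1.resolve_left hz.2, (hB hz.1).2⟩) (hBm.diff hW)
              fun hh => hx hh.1)
        _ = _ := by
            rw [← mul_add, ← lintegral_union (hBm.diff hW)
              (disjoint_sdiff_right.mono_left inter_subset_right), ← e]
    · intro y hy
      obtain ⟨W, hW, hyW, h⟩ := exists_nhds_volume_coneSet_le hd hΩ hy
      exact ⟨W, mem_nhdsWithin_of_mem_nhds (hW.mem_nhds hyW), W, hW.measurableSet, Subset.rfl,
        h x r hr⟩
  obtain ⟨W, -, hW, h⟩ := key
  exact h B (fun z hz => ⟨hW (hB hz), hB hz⟩) hBm hx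

lemma volume_hyperplane (hd : 1 ≤ d) (x ν : Euc (d + 1)) (hν : ‖ν‖ = 1) :
    volume {z : Euc (d + 1) | inner ℝ (z - x) ν = 0} = 0 := by
  obtain ⟨-, -, L, -, hL⟩ := exists_rotation hd ν hν
  have h1 : {z : Euc (d + 1) | inner ℝ (z - x) ν = 0} =
      frameCoord x L ⁻¹' (univ ×ˢ {0}) := by
    ext z; simp [← hL, frameCoord_snd]
  rw [h1, (measurePreserving_frameCoord x L).measure_preimage
    (MeasurableSet.univ.prod (measurableSet_singleton 0)).nullMeasurableSet]
  simp [Measure.volume_eq_prod]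

/-- Off the frontier, the interiors of s and sᶜ are two disjoint open sets that would disconnect T.
-/
lemma IsPreconnected.inter_frontier_nonempty_of_mem {X : Type*} [TopologicalSpace X] {T s : Set X}
    (hT : IsPreconnected T) (h1 : (T ∩ s).Nonempty) (h2 : (T ∩ sᶜ).Nonempty) :
    (T ∩ frontier s).Nonempty := by
  by_contra hcon
  rw [not_nonempty_iff_eq_empty, ← disjoint_iff_inter_eq_empty,
    ← subset_compl_iff_disjoint_right, compl_frontier_eq_union_interior] at hcon
  obtain ⟨a, ha, has⟩ := h1
  obtain ⟨b, hb, hbs⟩ := h2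
  obtain ⟨z, -, hz1, hz2⟩ := hT _ _ isOpen_interior isOpen_interior hcon
    ⟨a, ha, (hcon ha).resolve_right fun h => interior_subset h has⟩
    ⟨b, hb, (hcon hb).resolve_left fun h => hbs (interior_subset h)⟩
  exact interior_subset hz2 (interior_subset hz1)

/-- A segment from `x ∈ ∂Ω` to `w` that starts on one side of `∂Ω` and ends on the other one meets
`∂Ω`. -/
lemma mem_coneSet_of_not_iff {m : ℕ} {Ω : Set (Euc m)} {x w : Euc m} {r τ : ℝ}
    (hw : w ∈ Metric.ball x r) (hwx : w ≠ x) (hτ : 0 < τ) (hτ1 : τ < 1)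
    (h : ¬(x + τ • (w - x) ∈ Ω ↔ w ∈ Ω)) :
    w ∈ coneSet x r ((frontier Ω ∩ Metric.ball x r) \ {x}) := by
  have hpre : IsPreconnected ((fun t : ℝ => x + t • (w - x)) '' Icc τ 1) :=
    isPreconnected_Icc.image _ (by fun_prop)
  have e1 : x + τ • (w - x) ∈ (fun t : ℝ => x + t • (w - x)) '' Icc τ 1 :=
    ⟨τ, ⟨le_rfl, hτ1.le⟩, rfl⟩
  have e2 : w ∈ (fun t : ℝ => x + t • (w - x)) '' Icc τ 1 :=
    ⟨1, ⟨hτ1.le, le_rfl⟩, by simp⟩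
  have h3 : ((fun t : ℝ => x + t • (w - x)) '' Icc τ 1 ∩ frontier Ω).Nonempty := by
    by_cases hwΩ : w ∈ Ω
    · have : x + τ • (w - x) ∉ Ω := fun hc => h ⟨fun _ => hwΩ, fun _ => hc⟩
      exact hpre.inter_frontier_nonempty_of_mem ⟨w, e2, hwΩ⟩ ⟨_, e1, this⟩
    · have : x + τ • (w - x) ∈ Ω := by
        by_contra hc
        exact h ⟨fun h1 => absurd h1 hc, fun h1 => absurd h1 hwΩ⟩
      exact hpre.inter_frontier_nonempty_of_mem ⟨_, e1, this⟩ ⟨w, e2, hwΩ⟩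
  obtain ⟨z, ⟨t, ⟨ht1, ht2⟩, rfl⟩, hz⟩ := h3
  have ht : 0 < t := hτ.trans_le ht1
  rw [mem_ball_iff_norm] at hw
  have hwn : 0 < ‖w - x‖ := norm_pos_iff.2 (sub_ne_zero.2 hwx)
  refine ⟨_, ⟨⟨hz, ?_⟩, ?_⟩, t⁻¹, inv_pos.2 ht, ?_, ?_⟩
  · rw [mem_ball_iff_norm, add_sub_cancel_left, norm_smul, Real.norm_of_nonneg ht.le]
    nlinarith
  · simp [ht.ne', sub_ne_zero.2 hwx]
  · rw [add_sub_cancel_left, norm_smul, Real.norm_of_nonneg ht.le]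
    field_simp
    exact hw
  · rw [add_sub_cancel_left, smul_smul, inv_mul_cancel₀ ht.ne', one_smul]; abel

/-- Near a boundary point at which the nonlocal curvature is under control, a smooth domain is close
in measure to its tangent half-space. -/
lemma volume_ball_inter_symmDiff_halfSpace_le (hd : 1 ≤ d) (hΩ : IsSmoothBoundedDomain Ω)
    {x : Euc (d + 1)} (hx : x ∈ frontier Ω) {r s : ℝ} (hr : 0 < r) (hs : 0 < s) :
    volume (Metric.ball x r ∩ symmDiff Ω (halfSpace x (outwardNormal Ω x))) ≤
      ENNReal.ofReal (2 * r ^ (d + 1) * r ^ s) * ∫⁻ y, ENNReal.ofReal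
        (|inner ℝ (x - y) (outwardNormal Ω y)| / ‖x - y‖ ^ ((d : ℝ) + 1 + s))
        ∂(surfaceMeasure Ω) := by
  have hn := hΩ.isOutwardUnitNormal hx
  set n := outwardNormal Ω x with hndef
  set B := (frontier Ω ∩ Metric.ball x r) \ {x} with hB
  have hBm : MeasurableSet B :=
    (isClosed_frontier.measurableSet.inter measurableSet_ball).diff (measurableSet_singleton x)
  -- Just after leaving x, the segment towards w is on the side given by the sign of ⟨w − x, n⟩,
  -- whereas w is on the other side of ∂Ω. So the segment crosses ∂Ω inside the ball. Points with
  -- vanishing inner product form a null set.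
  have hsub : Metric.ball x r ∩ symmDiff Ω (halfSpace x n) ⊆
      coneSet x r B ∪ {z | inner ℝ (z - x) n = 0} := by
    rintro w ⟨hwr, hw⟩
    by_cases h0 : inner ℝ (w - x) n = 0
    · exact Or.inr h0
    left
    have hwx : w ≠ x := by rintro rfl; simp at h0
    have hlt : ∀ᶠ t in nhdsWithin (0 : ℝ) (Ioi 0), 0 < t ∧ t < 1 :=
      Ioo_mem_nhdsGT one_pos
    rcases lt_or_gt_of_ne h0 with hneg | hpos
    · have hwΩ : w ∉ Ω := by
        rcases hw with h | h
        · exact absurd hneg h.2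
        · exact h.2
      rw [real_inner_comm] at hneg
      obtain ⟨τ, h1, h2, h3⟩ := ((hn.eventually_mem hneg).and hlt).exists
      exact mem_coneSet_of_not_iff hwr hwx h2 h3 fun h => hwΩ (h.1 h1)
    · have hwΩ : w ∈ Ω := by
        rcases hw with h | h
        · exact h.1
        · exact absurd h.1 (not_lt.2 hpos.le)
      rw [real_inner_comm] at hpos
      obtain ⟨τ, h1, h2, h3⟩ := ((hn.eventually_notMem hpos).and hlt).exists
      exact mem_coneSet_of_not_iff hwr hwx h2 h3 fun h => h1 (h.2 hwΩ)
  calc volume (Metric.ball x r ∩ symmDiff Ω (halfSpace x n))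
      ≤ volume (coneSet x r B) + 0 := by
        rw [← volume_hyperplane hd x n hn.norm_eq_one]
        exact (measure_mono hsub).trans (measure_union_le _ _)
    _ ≤ ENNReal.ofReal (2 * r ^ (d + 1)) * ∫⁻ z in B, solidAngleDensity Ω x z ∂μHE[d] := by
        rw [add_zero]
        exact volume_coneSet_le hd hΩ x hr (fun z hz => hz.1.1) hBm fun h => h.2 rfl
    _ ≤ ENNReal.ofReal (2 * r ^ (d + 1)) * ∫⁻ z in B, ENNReal.ofReal (r ^ s) * ENNReal.ofReal
        (|inner ℝ (x - z) (outwardNormal Ω z)| / ‖x - z‖ ^ ((d : ℝ) + 1 + s)) ∂μHE[d] := by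
        -- Inside the ball, ‖x − z‖ ≤ r trades the exponent d + 1 for d + 1 + s at the price r^s.
        refine mul_le_mul_right (setLIntegral_mono' hBm fun z hz => ?_) _
        rw [solidAngleDensity, ← ENNReal.ofReal_mul (by positivity)]
        refine ENNReal.ofReal_le_ofReal ?_
        have hzn : 0 < ‖x - z‖ := norm_pos_iff.2 (sub_ne_zero.2 fun h => hz.2 h.symm)
        have hzr : ‖x - z‖ ≤ r := by
          have := hz.1.2
          rw [mem_ball_iff_norm'] at this
          exact this.le
        have e : ‖x - z‖ ^ ((d : ℝ) + 1 + s) = ‖x - z‖ ^ (d + 1) * ‖x - z‖ ^ s := by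
          rw [Real.rpow_add hzn]; norm_cast
        rw [e, ← mul_div_assoc, div_le_div_iff₀ (by positivity) (by positivity)]
        have h2 : ‖x - z‖ ^ s ≤ r ^ s := Real.rpow_le_rpow hzn.le hzr hs.le
        have h3 : 0 ≤ |inner ℝ (x - z) (outwardNormal Ω z)| * ‖x - z‖ ^ (d + 1) := by positivity
        nlinarith
    _ = ENNReal.ofReal (2 * r ^ (d + 1) * r ^ s) * ∫⁻ z in B, ENNReal.ofReal
        (|inner ℝ (x - z) (outwardNormal Ω z)| / ‖x - z‖ ^ ((d : ℝ) + 1 + s)) ∂μHE[d] := by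
        rw [lintegral_const_mul' _ _ ENNReal.ofReal_ne_top, ← mul_assoc,
          ← ENNReal.ofReal_mul (by positivity)]
    _ ≤ _ := by
        refine mul_le_mul_right (lintegral_mono_set ?_) _
        exact fun z hz => hz.1.1

end Cone
end

/-! ### Half-spaces that are close in measure. -/

noncomputable section

section HalfSpaceComparison
variable {d : ℕ}

/-- The volume of the unit ball of `ℝᵐ`. -/
def unitBallVolume (m : ℕ) : ℝ := (volume (Metric.ball (0 : Euc m) 1)).toReal

lemma volume_unit_ball (m : ℕ) :
    volume (Metric.ball (0 : Euc m) 1) = ENNReal.ofReal (unitBallVolume m) :=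
  (ENNReal.ofReal_toReal measure_ball_lt_top.ne).symm

lemma unitBallVolume_pos (m : ℕ) : 0 < unitBallVolume m :=
  ENNReal.toReal_pos (Metric.measure_ball_pos _ _ one_pos).ne' measure_ball_lt_top.ne

lemma volume_ball_euc {m : ℕ} (x : Euc m) {r : ℝ} (hr : 0 < r) :
    volume (Metric.ball x r) = ENNReal.ofReal (unitBallVolume m * r ^ m) := by
  rw [Measure.addHaar_ball_of_pos _ _ hr, volume_unit_ball, ← ENNReal.ofReal_mul (by positivity),
    finrank_euclideanSpace_fin, mul_comm]

lemma measurableSet_symmDiff_halfSpace (x y n m : Euc (d + 1)) (r : ℝ) :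
    MeasurableSet (Metric.ball x r ∩ symmDiff (halfSpace x n) (halfSpace y m)) :=
  measurableSet_ball.inter
    ((measurableSet_halfSpace x n).symmDiff (measurableSet_halfSpace y m))

lemma ofReal_le_two_mul {a b : ℝ} (hb : 0 ≤ b) {η : ℝ≥0∞} (h : ENNReal.ofReal a ≤ η + η)
    (hη : η ≤ ENNReal.ofReal b) : a ≤ 2 * b := by
  have : ENNReal.ofReal a ≤ ENNReal.ofReal (2 * b) := by
    rw [two_mul, ENNReal.ofReal_add hb hb]; exact h.trans (add_le_add hη hη)
  exact (ENNReal.ofReal_le_ofReal_iff (by positivity)).1 this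

variable {x y n m : Euc (d + 1)} {r b : ℝ}

/-- The point reflection in x exchanges `halfSpace x n` with its complement up to a hyperplane. A
slab of width |⟨y − x, m⟩| centred at x is symmetric but lies on one side of the boundary of
`halfSpace y m`. So for almost every point of the slab inside the ball, the point or its reflection
lies in the symmetric difference. -/
lemma offset_le_of_symmDiff_le (hd : 1 ≤ d) (hn : ‖n‖ = 1) (hm : ‖m‖ = 1) (hr : 0 < r)
    (ha : |inner ℝ (y - x) m| ≤ r / 2) (hb : 0 ≤ b)
    (h : volume (Metric.ball x r ∩ symmDiff (halfSpace x n) (halfSpace y m)) ≤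
      ENNReal.ofReal b) :
    unitBallVolume d * ((r / 2) ^ d * |inner ℝ (y - x) m|) ≤ 2 * b := by
  set a := inner ℝ (y - x) m with hadef
  set T := Metric.ball x r ∩ symmDiff (halfSpace x n) (halfSpace y m) with hT
  have hTm : MeasurableSet T := measurableSet_symmDiff_halfSpace x y n m r
  have hH2 : ∀ z, z ∈ halfSpace y m ↔ inner ℝ (z - x) m < a := by
    intro z
    rw [halfSpace, mem_ofPred_eq, hadef, ← sub_neg (a := inner ℝ (z - x) m), ← inner_sub_left,
      sub_sub_sub_cancel_right]
  have hR : MeasurePreserving (fun z : Euc (d + 1) => (x + x) - z) :=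
    Measure.measurePreserving_sub_left volume (x + x)
  refine ofReal_le_two_mul hb (η := volume T) ?_ h
  have hslab := le_volume_ball_inter_slab hd x m hm (a := -(|a| / 2)) (b := |a| / 2) hr
    (by linarith [abs_nonneg a]) (by linarith [abs_nonneg a])
  rw [volume_unit_ball, ← ENNReal.ofReal_mul (unitBallVolume_pos d).le] at hslab
  have e : |a| / 2 - -(|a| / 2) = |a| := by ring
  rw [e] at hslab
  refine hslab.trans ?_
  rcases (abs_nonneg a).eq_or_lt with h0 | h0
  · rw [← h0]
    refine (measure_mono_null (t := ∅) ?_ measure_empty).le.trans zero_le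
    rintro z ⟨-, hz1, hz2⟩
    linarith
  have hnull := volume_hyperplane hd x n hn
  have hsub : Metric.ball x r ∩ {z | -(|a| / 2) ≤ inner ℝ (z - x) m ∧ inner ℝ (z - x) m < |a| / 2} ⊆
      (T ∪ (fun z => (x + x) - z) ⁻¹' T) ∪ {z | inner ℝ (z - x) n = 0} := by
    rintro z ⟨hzr, hz1, hz2⟩
    by_cases hz0 : inner ℝ (z - x) n = 0
    · exact Or.inr hz0
    left
    have e1 : (x + x) - z - x = -(z - x) := by abel
    have hRr : (x + x) - z ∈ Metric.ball x r := by
      rw [mem_ball_iff_norm, e1, norm_neg, ← mem_ball_iff_norm]; exact hzr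
    have m1 : ∀ w, w ∈ halfSpace x n ↔ inner ℝ (w - x) n < 0 := fun w => Iff.rfl
    rcases lt_or_ge a 0 with hneg | hpos
    · rw [abs_of_neg hneg] at hz1 hz2
      have k1 : z ∉ halfSpace y m := by rw [hH2]; linarith
      have k2 : (x + x) - z ∉ halfSpace y m := by rw [hH2, e1, inner_neg_left]; linarith
      rcases lt_or_gt_of_ne hz0 with hlt | hgt
      · exact Or.inl ⟨hzr, Or.inl ⟨hlt, k1⟩⟩
      · refine Or.inr ⟨hRr, Or.inl ⟨?_, k2⟩⟩
        rw [m1, e1, inner_neg_left]; linarith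
    · rw [abs_of_nonneg hpos] at hz1 hz2 h0
      have k1 : z ∈ halfSpace y m := by rw [hH2]; linarith
      have k2 : (x + x) - z ∈ halfSpace y m := by rw [hH2, e1, inner_neg_left]; linarith
      rcases lt_or_gt_of_ne hz0 with hlt | hgt
      · refine Or.inr ⟨hRr, Or.inr ⟨k2, ?_⟩⟩
        rw [m1, e1, inner_neg_left]; linarith
      · refine Or.inl ⟨hzr, Or.inr ⟨k1, ?_⟩⟩
        rw [m1]; linarith
  calc _ ≤ volume ((T ∪ (fun z => (x + x) - z) ⁻¹' T) ∪ {z | inner ℝ (z - x) n = 0}) :=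
        measure_mono hsub
    _ ≤ (volume T + volume ((fun z => (x + x) - z) ⁻¹' T)) + 0 := by
        rw [← hnull]
        exact (measure_union_le _ _).trans (add_le_add (measure_union_le _ _) le_rfl)
    _ = volume T + volume T := by rw [add_zero, hR.measure_preimage hTm.nullMeasurableSet]

/-- Translation by a multiple of w preserves `halfSpace x n`, but it shifts the boundary of
`halfSpace y m`. Over the slab swept by that boundary, either z or z − v lies in the symmetric
difference. -/
lemma tangential_le_of_symmDiff_le (hd : 1 ≤ d) (hm : ‖m‖ = 1) (hr : 0 < r)
    (ha : |inner ℝ (y - x) m| ≤ r / 8) (hb : 0 ≤ b)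
    (h : volume (Metric.ball x r ∩ symmDiff (halfSpace x n) (halfSpace y m)) ≤
      ENNReal.ofReal b) {w : Euc (d + 1)} (hw : ‖w‖ = 1) (hwn : inner ℝ w n = 0) :
    unitBallVolume d * ((r / 4) ^ d * (r / 8 * inner ℝ w m)) ≤ 2 * b := by
  set a := inner ℝ (y - x) m with hadef
  set T := Metric.ball x r ∩ symmDiff (halfSpace x n) (halfSpace y m) with hT
  have hTm : MeasurableSet T := measurableSet_symmDiff_halfSpace x y n m r
  have hH2 : ∀ z, z ∈ halfSpace y m ↔ inner ℝ (z - x) m < a := by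
    intro z
    rw [halfSpace, mem_ofPred_eq, hadef, ← sub_neg (a := inner ℝ (z - x) m), ← inner_sub_left,
      sub_sub_sub_cancel_right]
  set v := (r / 8) • w with hv
  have hR : MeasurePreserving (fun z : Euc (d + 1) => z - v) := measurePreserving_sub_right volume v
  have hwm1 : inner ℝ w m ≤ 1 := by
    have := real_inner_le_norm w m
    rwa [hw, hm, one_mul] at this
  have hvn : ‖v‖ = r / 8 := by rw [hv, norm_smul, hw, Real.norm_of_nonneg (by positivity), mul_one]
  have hvm : inner ℝ v m = r / 8 * inner ℝ w m := real_inner_smul_left _ _ _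
  have hvn0 : inner ℝ v n = 0 := by rw [hv, real_inner_smul_left, hwn, mul_zero]
  obtain ⟨ha1, ha2⟩ := abs_le.1 ha
  refine ofReal_le_two_mul hb (η := volume T) ?_ h
  have hslab := le_volume_ball_inter_slab hd x m hm (a := a) (b := a + inner ℝ v m)
    (r := r / 2) (by positivity) (by linarith) (by rw [hvm]; nlinarith)
  rw [volume_unit_ball, ← ENNReal.ofReal_mul (unitBallVolume_pos d).le] at hslab
  have e : a + inner ℝ v m - a = r / 8 * inner ℝ w m := by rw [hvm]; ring
  have e' : r / 2 / 2 = r / 4 := by ring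
  rw [e, e'] at hslab
  refine hslab.trans ?_
  have hsub : Metric.ball x (r / 2) ∩ {z | a ≤ inner ℝ (z - x) m ∧
      inner ℝ (z - x) m < a + inner ℝ v m} ⊆ T ∪ (fun z => z - v) ⁻¹' T := by
    rintro z ⟨hzr, hz1, hz2⟩
    rw [mem_ball_iff_norm] at hzr
    have e1 : z - v - x = (z - x) - v := by abel
    have hzr' : z ∈ Metric.ball x r := by rw [mem_ball_iff_norm]; linarith
    have hRr : z - v ∈ Metric.ball x r := by
      rw [mem_ball_iff_norm, e1]
      exact (norm_sub_le _ _).trans_lt (by rw [hvn]; linarith)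
    have k1 : z ∉ halfSpace y m := by rw [hH2]; linarith
    have k2 : z - v ∈ halfSpace y m := by rw [hH2, e1, inner_sub_left]; linarith
    have k3 : z - v ∈ halfSpace x n ↔ z ∈ halfSpace x n := by
      rw [halfSpace, mem_ofPred_eq, mem_ofPred_eq, e1, inner_sub_left, hvn0, sub_zero]
    by_cases hz : z ∈ halfSpace x n
    · exact Or.inl ⟨hzr', Or.inl ⟨hz, k1⟩⟩
    · exact Or.inr ⟨hRr, Or.inr ⟨k2, fun hc => hz (k3.1 hc)⟩⟩
  calc _ ≤ volume (T ∪ (fun z => z - v) ⁻¹' T) := measure_mono hsub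
    _ ≤ volume T + volume ((fun z => z - v) ⁻¹' T) := measure_union_le _ _
    _ = volume T + volume T := by rw [hR.measure_preimage hTm.nullMeasurableSet]

/-- Rules out nearly opposite normals, which the tangential estimate cannot see: if ⟨n, m⟩ ≤ 0, the
ball of radius r/16 about x + (r/8)(m − n) lies inside the first half-space and outside the second.
-/
lemma const_le_of_symmDiff_le (hn : ‖n‖ = 1) (hm : ‖m‖ = 1) (hr : 0 < r)
    (ha : |inner ℝ (y - x) m| ≤ r / 16) (hb : 0 ≤ b)
    (h : volume (Metric.ball x r ∩ symmDiff (halfSpace x n) (halfSpace y m)) ≤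
      ENNReal.ofReal b) (hmn : inner ℝ n m ≤ 0) :
    unitBallVolume (d + 1) * (r / 16) ^ (d + 1) ≤ b := by
  rw [← ENNReal.ofReal_le_ofReal_iff hb,
    ← volume_ball_euc (x + (r / 8) • (m - n)) (by positivity)]
  refine (measure_mono ?_).trans h
  intro z hz
  rw [mem_ball_iff_norm] at hz
  obtain ⟨p, rfl⟩ : ∃ p, z = x + (r / 8) • (m - n) + p := ⟨z - (x + (r / 8) • (m - n)), by abel⟩
  rw [add_sub_cancel_left] at hz
  have e : x + (r / 8) • (m - n) + p - x = p + (r / 8) • (m - n) := by abel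
  have hpn := abs_le.1 (abs_real_inner_le_norm p n)
  have hpm := abs_le.1 (abs_real_inner_le_norm p m)
  rw [hn, mul_one] at hpn
  rw [hm, mul_one] at hpm
  have hmn1 : ‖m - n‖ ≤ 2 := (norm_sub_le _ _).trans (by rw [hn, hm]; norm_num)
  have i1 : inner ℝ (x + (r / 8) • (m - n) + p - x) n = inner ℝ p n + r / 8 * (inner ℝ n m - 1) := by
    rw [e, inner_add_left, real_inner_smul_left, inner_sub_left, real_inner_self_eq_norm_sq, hn,
      real_inner_comm n m]
    ring
  have i2 : inner ℝ (x + (r / 8) • (m - n) + p - x) m = inner ℝ p m + r / 8 * (1 - inner ℝ n m) := by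
    rw [e, inner_add_left, real_inner_smul_left, inner_sub_left, real_inner_self_eq_norm_sq, hm]
    ring
  refine ⟨?_, Or.inl ⟨?_, ?_⟩⟩
  · rw [mem_ball_iff_norm, e]
    refine (norm_add_le _ _).trans_lt ?_
    rw [norm_smul, Real.norm_of_nonneg (by positivity)]
    nlinarith
  · rw [halfSpace, mem_ofPred_eq, i1]; nlinarith
  · rw [halfSpace, mem_ofPred_eq, not_lt, ← sub_add_sub_cancel _ x y, inner_add_left, i2,
      ← neg_sub y x, inner_neg_left]
    nlinarith [abs_le.1 ha]

/-- Two half-spaces that are close in measure on a ball have close normals and a small offset. -/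
lemma exists_halfSpace_comparison (hd : 1 ≤ d) :
    ∃ C > (0 : ℝ), ∀ (Ω : Set (Euc (d + 1))) (x y n m : Euc (d + 1)) (r ε : ℝ), ‖n‖ = 1 → ‖m‖ = 1 →
      0 < r → 0 ≤ ε → ‖x - y‖ ≤ r / 2 →
      volume (Metric.ball x r ∩ symmDiff Ω (halfSpace x n)) ≤ ENNReal.ofReal (ε * r ^ (d + 1)) →
      volume (Metric.ball y (2 * r) ∩ symmDiff Ω (halfSpace y m)) ≤
        ENNReal.ofReal (ε * r ^ (d + 1)) →
      ‖n - m‖ ≤ C * ε ∧ |inner ℝ (x - y) m| ≤ C * ε * r := by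
  set κ := unitBallVolume d
  set κ' := unitBallVolume (d + 1)
  have hκ : 0 < κ := unitBallVolume_pos d
  have hκ' : 0 < κ' := unitBallVolume_pos (d + 1)
  set C₁ := 4 * 2 ^ d / κ with hC₁
  set C₂ := 64 * 4 ^ d / κ with hC₂
  set C₃ := 4 * 16 ^ (d + 1) / κ' with hC₃
  have h1 : 0 < C₁ := by positivity
  have h2 : 0 < C₂ := by positivity
  have h3 : 0 < C₃ := by positivity
  refine ⟨32 * C₁ + C₂ + C₃, by positivity, ?_⟩
  intro Ω x y n m r ε hn hm hr hε hxy hA hB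
  -- Triangle inequality for symmetric differences, using B(x, r) ⊆ B(y, 2r).
  have hT : volume (Metric.ball x r ∩ symmDiff (halfSpace x n) (halfSpace y m)) ≤
      ENNReal.ofReal (2 * (ε * r ^ (d + 1))) := by
    rw [two_mul, ENNReal.ofReal_add (by positivity) (by positivity)]
    refine (measure_mono ?_).trans ((measure_union_le _ _).trans (add_le_add hA hB))
    rintro z ⟨hz, hz'⟩
    have hzy : z ∈ Metric.ball y (2 * r) := by
      rw [mem_ball_iff_norm] at hz ⊢
      calc ‖z - y‖ ≤ ‖z - x‖ + ‖x - y‖ := norm_sub_le_norm_sub_add_norm_sub _ _ _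
        _ < _ := by linarith
    by_cases hzΩ : z ∈ Ω
    · rcases hz' with h | h
      · exact Or.inr ⟨hzy, Or.inl ⟨hzΩ, h.2⟩⟩
      · exact Or.inl ⟨hz, Or.inl ⟨hzΩ, h.2⟩⟩
    · rcases hz' with h | h
      · exact Or.inl ⟨hz, Or.inr ⟨h.1, hzΩ⟩⟩
      · exact Or.inr ⟨hzy, Or.inr ⟨h.1, hzΩ⟩⟩
  have hb : 0 ≤ 2 * (ε * r ^ (d + 1)) := by positivity
  set a := inner ℝ (y - x) m with ha
  have ha2 : |a| ≤ r / 2 := by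
    have := abs_real_inner_le_norm (y - x) m
    rw [hm, mul_one, norm_sub_rev] at this
    exact this.trans hxy
  have hoff : |a| ≤ C₁ * ε * r := by
    have := offset_le_of_symmDiff_le hd hn hm hr ha2 hb hT
    rw [hC₁, div_mul_eq_mul_div, div_mul_eq_mul_div, le_div_iff₀ hκ]
    have hrd : 0 < r ^ d := by positivity
    rw [div_pow, pow_succ] at this
    refine le_of_mul_le_mul_left ?_ hrd
    have h2d : (0 : ℝ) < 2 ^ d := by positivity
    have e : r ^ d * (|a| * κ) = 2 ^ d * (κ * (r ^ d / 2 ^ d * |a|)) := by field_simp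
    rw [e]
    calc _ ≤ 2 ^ d * (2 * (2 * (ε * (r ^ d * r)))) := by gcongr
      _ = _ := by ring
  have hnm2 : ‖n - m‖ ≤ 2 := (norm_sub_le _ _).trans (by rw [hn, hm]; norm_num)
  have hn0 := norm_nonneg (n - m)
  constructor
  · by_cases hac : |a| ≤ r / 16
    swap
    -- A large offset bounds ε from below, and then ‖n − m‖ ≤ 2 is enough.
    · have : 1 ≤ 16 * C₁ * ε := by
        by_contra hcon
        push Not at hcon hac
        nlinarith
      nlinarith [mul_nonneg h2.le hε, mul_nonneg h3.le hε]
    by_cases hmn : inner ℝ n m ≤ 0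
    · have := const_le_of_symmDiff_le hn hm hr hac hb hT hmn
      have h4 : 2 ≤ C₃ * ε := by
        rw [hC₃, div_mul_eq_mul_div, le_div_iff₀ hκ']
        have hrd : 0 < r ^ (d + 1) := by positivity
        refine le_of_mul_le_mul_left ?_ hrd
        rw [div_pow] at this
        have e : r ^ (d + 1) * (2 * κ') = 2 * 16 ^ (d + 1) * (κ' * (r ^ (d + 1) / 16 ^ (d + 1))) := by
          field_simp
        rw [e]
        calc _ ≤ 2 * 16 ^ (d + 1) * (2 * (ε * r ^ (d + 1))) := by gcongr
          _ = _ := by ring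
      nlinarith [mul_nonneg h2.le hε, mul_nonneg h1.le hε]
    push Not at hmn
    -- The part of m orthogonal to n is the translation direction to use; since ⟨n, m⟩ > 0, it
    -- controls ‖n − m‖ up to a factor 2.
    set q := m - inner ℝ n m • n with hq
    have hqn : inner ℝ q n = 0 := by
      rw [hq, inner_sub_left, real_inner_smul_left, real_inner_self_eq_norm_sq, hn, real_inner_comm]
      ring
    have hqm : inner ℝ q m = 1 - inner ℝ n m ^ 2 := by
      rw [hq, inner_sub_left, real_inner_smul_left, real_inner_self_eq_norm_sq, hm]
      ring
    have hq2 : ‖q‖ ^ 2 = inner ℝ q m := by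
      rw [← real_inner_self_eq_norm_sq]
      nth_rw 2 [hq]
      rw [inner_sub_right, real_inner_smul_right, hqn]; ring
    have hnm1 : inner ℝ n m ≤ 1 := by
      have := real_inner_le_norm n m
      rwa [hn, hm, one_mul] at this
    have hkey : ‖n - m‖ ≤ 2 * ‖q‖ := by
      have : ‖n - m‖ ^ 2 = 2 - 2 * inner ℝ n m := by
        rw [norm_sub_sq_real, hn, hm]; ring
      have : ‖n - m‖ ^ 2 ≤ (2 * ‖q‖) ^ 2 := by rw [this, mul_pow, hq2, hqm]; nlinarith
      exact (sq_le_sq₀ hn0 (by positivity)).1 this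
    rcases (norm_nonneg q).eq_or_lt with h0 | h0
    · have : ‖n - m‖ = 0 := by rw [← h0] at hkey; linarith
      rw [this]; positivity
    have hw := tangential_le_of_symmDiff_le hd hm hr (hac.trans (by linarith)) hb hT
      (w := ‖q‖⁻¹ • q) (by rw [norm_smul, norm_inv, norm_norm, inv_mul_cancel₀ h0.ne'])
      (by rw [real_inner_smul_left, hqn, mul_zero])
    have e : inner ℝ (‖q‖⁻¹ • q) m = ‖q‖ := by
      rw [real_inner_smul_left, ← hq2]; field_simp
    rw [e] at hw
    have h4 : 2 * ‖q‖ ≤ C₂ * ε := by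
      rw [hC₂, div_mul_eq_mul_div, le_div_iff₀ hκ]
      have hrd : 0 < r ^ (d + 1) := by positivity
      refine le_of_mul_le_mul_left ?_ hrd
      rw [div_pow] at hw
      have e : r ^ (d + 1) * (2 * ‖q‖ * κ) =
          16 * 4 ^ d * (κ * (r ^ d / 4 ^ d * (r / 8 * ‖q‖))) := by
        field_simp
        ring
      rw [e]
      calc _ ≤ 16 * 4 ^ d * (2 * (2 * (ε * r ^ (d + 1)))) := by gcongr
        _ = _ := by ring
    nlinarith [mul_nonneg h1.le hε, mul_nonneg h3.le hε]
  · rw [← neg_sub y x, inner_neg_left, abs_neg]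
    refine hoff.trans ?_
    have : 0 ≤ ε * r := by positivity
    nlinarith [mul_nonneg h1.le this, mul_nonneg h2.le this, mul_nonneg h3.le this]

end HalfSpaceComparison
end

/-! ### Lower Ahlfors regularity. -/

noncomputable section

section Ahlfors
variable {d : ℕ} {Ω : Set (Euc (d + 1))}

lemma frameMap_mem_ball (x : Euc (d + 1)) (L : Euc (d + 1) ≃ₗᵢ[ℝ] Euc (d + 1)) {u : Euc d} {t r : ℝ}
    (h : ‖u‖ + |t| < r) : frameMap x L (u, t) ∈ Metric.ball x r := by
  have h3 := norm_frameMap_sub x L (u, t) (0, 0)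
  rw [frameMap_zero] at h3
  rw [mem_ball_iff_norm, h3]
  simpa using (norm_graphPoint_le u t).trans_lt h

lemma inner_frameMap_sub (x : Euc (d + 1)) (L : Euc (d + 1) ≃ₗᵢ[ℝ] Euc (d + 1)) (u : Euc d) (t : ℝ) :
    inner ℝ (frameMap x L (u, t) - x) (L (lastVec d)) = t := by
  rw [← frameCoord_snd, frameCoord_frameMap]

/-- If a domain is close in measure to a half-space whose boundary contains the center of a ball,
then its boundary has a large measure in this ball. -/
lemma le_surface_of_volume_symmDiff_le (hd : 1 ≤ d) (hΩ : IsOpen Ω) {x ν : Euc (d + 1)}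
    (hν : ‖ν‖ = 1) {r : ℝ} (hr : 0 < r)
    (h : volume (Metric.ball x r ∩ symmDiff Ω (halfSpace x ν)) ≤
      ENNReal.ofReal (unitBallVolume d / (4 * 2 ^ d) * r ^ (d + 1))) :
    ENNReal.ofReal (unitBallVolume d / (2 * 2 ^ d) * r ^ d) ≤
      (μHE[d] : Measure (Euc (d + 1))) (frontier Ω ∩ Metric.ball x r) := by
  obtain ⟨-, -, L, -, hL⟩ := exists_rotation hd ν hν
  set T := Metric.ball x r ∩ symmDiff Ω (halfSpace x ν) with hT
  have hTm : MeasurableSet T :=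
    measurableSet_ball.inter (hΩ.measurableSet.symmDiff (measurableSet_halfSpace x ν))
  set G := {u : Euc d | ∃ z ∈ frontier Ω ∩ Metric.ball x r, (frameCoord x L z).1 = u} with hG
  have hGm : volume G ≤ (μHE[d] : Measure (Euc (d + 1))) (frontier Ω ∩ Metric.ball x r) :=
    volume_le_of_subset_image_frameCoord x L fun u hu => hu
  set T' := frameMap x L ⁻¹' T with hT'
  have hT'm : MeasurableSet T' := (continuous_frameMap x L).measurable hTm
  have hT'v : volume T' = volume T :=
    (measurePreserving_frameMap x L).measure_preimage hTm.nullMeasurableSet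
  set φ : Euc d → ℝ≥0∞ := fun u => volume (Prod.mk u ⁻¹' T') with hφ
  have hφm : Measurable φ := measurable_measure_prodMk_left hT'm
  have hφi : ∫⁻ u, φ u = volume T := by
    rw [← hT'v, Measure.volume_eq_prod, Measure.prod_apply hT'm]
  have hmarkov := mul_meas_ge_le_lintegral (μ := volume) hφm (ENNReal.ofReal (r / 2))
  -- If the vertical segment over u misses ∂Ω, it lies wholly in Ω or wholly outside. Then its upper
  -- or its lower half, of length r/2, belongs to the symmetric difference. Markov's inequality
  -- bounds the set of such u; all others are in the shadow G of the surface.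
  have hcover : Metric.ball (0 : Euc d) (r / 2) ⊆ G ∪ {u | ENNReal.ofReal (r / 2) ≤ φ u} := by
    intro u hu
    by_cases hug : u ∈ G
    · exact Or.inl hug
    right
    rw [mem_ball_zero_iff] at hu
    have hball : ∀ t ∈ Ioo (-(r / 2)) (r / 2), frameMap x L (u, t) ∈ Metric.ball x r := by
      intro t ht
      have := abs_lt.2 ht
      exact frameMap_mem_ball x L (by linarith)
    have hfr : ∀ t ∈ Ioo (-(r / 2)) (r / 2), frameMap x L (u, t) ∉ frontier Ω := by
      intro t ht hc
      exact hug ⟨_, ⟨hc, hball t ht⟩, by simp⟩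
    have hpre : IsPreconnected ((fun t : ℝ => frameMap x L (u, t)) '' Ioo (-(r / 2)) (r / 2)) :=
      isPreconnected_Ioo.image _
        ((continuous_frameMap x L).comp (by fun_prop : Continuous fun t : ℝ => (u, t))).continuousOn
    have hdich : (∀ t ∈ Ioo (-(r / 2)) (r / 2), frameMap x L (u, t) ∈ Ω) ∨
        (∀ t ∈ Ioo (-(r / 2)) (r / 2), frameMap x L (u, t) ∉ Ω) := by
      by_contra hcon
      push Not at hcon
      obtain ⟨⟨t, ht, h1⟩, ⟨t', ht', h2⟩⟩ := hcon
      obtain ⟨z, ⟨τ, hτ, rfl⟩, hz⟩ := hpre.inter_frontier_nonempty_of_mem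
        ⟨_, ⟨t', ht', rfl⟩, h2⟩ ⟨_, ⟨t, ht, rfl⟩, h1⟩
      exact hfr τ hτ hz
    have hH : ∀ t, frameMap x L (u, t) ∈ halfSpace x ν ↔ t < 0 := by
      intro t
      rw [halfSpace, mem_ofPred_eq, ← hL, inner_frameMap_sub]
    rw [mem_ofPred_eq, hφ]
    rcases hdich with hin | hout
    · have : Ico 0 (r / 2) ⊆ Prod.mk u ⁻¹' T' := by
        intro t ht
        have ht' : t ∈ Ioo (-(r / 2)) (r / 2) := ⟨by linarith [ht.1], ht.2⟩
        exact ⟨hball t ht', Or.inl ⟨hin t ht', fun hc => absurd ((hH t).1 hc) (not_lt.2 ht.1)⟩⟩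
      refine le_trans ?_ (measure_mono this)
      rw [Real.volume_Ico, sub_zero]
    · have : Ioo (-(r / 2)) 0 ⊆ Prod.mk u ⁻¹' T' := by
        intro t ht
        have ht' : t ∈ Ioo (-(r / 2)) (r / 2) := ⟨ht.1, by linarith [ht.2]⟩
        exact ⟨hball t ht', Or.inr ⟨(hH t).2 ht.2, hout t ht'⟩⟩
      refine le_trans ?_ (measure_mono this)
      rw [Real.volume_Ioo, zero_sub, neg_neg]
  set κ := unitBallVolume d with hκ
  have hκ0 : 0 < κ := unitBallVolume_pos d
  have hbad : volume {u | ENNReal.ofReal (r / 2) ≤ φ u} ≤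
      ENNReal.ofReal (κ / (2 * 2 ^ d) * r ^ d) := by
    rw [hφi] at hmarkov
    have h1 := hmarkov.trans h
    rw [mul_comm, ← ENNReal.le_div_iff_mul_le (Or.inl (by simp; linarith)) (Or.inl (by simp)),
      ← ENNReal.ofReal_div_of_pos (by positivity)] at h1
    refine h1.trans_eq ?_
    congr 1
    rw [pow_succ]
    field_simp
    ring
  have htot : ENNReal.ofReal (κ / (2 * 2 ^ d) * r ^ d) + ENNReal.ofReal (κ / (2 * 2 ^ d) * r ^ d) ≤
      volume G + ENNReal.ofReal (κ / (2 * 2 ^ d) * r ^ d) := by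
    calc _ = volume (Metric.ball (0 : Euc d) (r / 2)) := by
          rw [volume_ball_euc _ (by positivity), ← ENNReal.ofReal_add (by positivity) (by positivity)]
          congr 1
          rw [div_pow, ← hκ]
          field_simp
          ring
      _ ≤ volume G + volume {u | ENNReal.ofReal (r / 2) ≤ φ u} :=
          (measure_mono hcover).trans (measure_union_le _ _)
      _ ≤ _ := by gcongr
  exact ((ENNReal.add_le_add_iff_right ENNReal.ofReal_ne_top).1 htot).trans hGm

open Filter Topology in
/-- Lower density bound at small scales. -/
lemma eventually_le_surface (hd : 1 ≤ d) (hΩ : IsSmoothBoundedDomain Ω) {x : Euc (d + 1)}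
    (hx : x ∈ frontier Ω) :
    ∃ t₀ > (0 : ℝ), ∀ r, 0 < r → r < t₀ → ENNReal.ofReal (unitBallVolume d / 2 ^ d * r ^ d) ≤
      (μHE[d] : Measure (Euc (d + 1))) (frontier Ω ∩ Metric.ball x r) := by
  obtain ⟨-, -, L, -, hL⟩ := exists_rotation hd _ (hΩ.norm_outwardNormal hx)
  have hpos : 0 < inner ℝ (outwardNormal Ω x) (L (lastVec d)) := by
    rw [hL, real_inner_self_eq_norm_sq, hΩ.norm_outwardNormal hx]; norm_num
  obtain ⟨δ, hδ, ε, hε, f, hf, hf0, hgraph⟩ := exists_local_graph hΩ hx L hpos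
  have hball : Metric.ball (0 : Euc d) δ ∈ 𝓝 (0 : Euc d) := Metric.ball_mem_nhds _ hδ
  -- The frame is aligned with the normal, so the graph is horizontal at 0 and |f u| ≤ ‖u‖ nearby.
  -- The resulting scale t₀ depends on Ω and x; it only starts the induction in
  -- `exists_lower_ahlfors`.
  have hfd : HasFDerivAt f (0 : Euc d →L[ℝ] ℝ) 0 := by
    have h1 : DifferentiableAt ℝ f 0 := (hf.contDiffAt hball).differentiableAt (by simp)
    have h2 : fderiv ℝ f 0 = 0 := by
      ext v
      have := (hgraph 0 (Metric.mem_ball_self hδ)).2.2 v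
      rw [hf0, frameMap_zero, ← hL, real_inner_comm, LinearIsometryEquiv.inner_map_map,
        inner_graphPoint_lastVec] at this
      exact this
    rw [← h2]; exact h1.hasFDerivAt
  have hsmall : ∀ᶠ u in 𝓝 (0 : Euc d), |f u| ≤ ‖u‖ := by
    have := hfd.isLittleO.bound one_pos
    filter_upwards [this] with u hu
    simpa [hf0] using hu
  obtain ⟨t₀, ht₀, hsub⟩ := Metric.eventually_nhds_iff_ball.1 (hsmall.and hball)
  refine ⟨t₀, ht₀, fun r hr hrt => ?_⟩
  have e : ENNReal.ofReal (unitBallVolume d / 2 ^ d * r ^ d) =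
      volume (Metric.ball (0 : Euc d) (r / 2)) := by
    rw [volume_ball_euc _ (by positivity), div_pow]
    congr 1
    ring
  rw [e]
  refine volume_le_of_subset_image_frameCoord x L fun u hu => ?_
  have hu' : ‖u‖ < r / 2 := by simpa using hu
  have huδ := hsub u (by simp; linarith)
  refine ⟨frameMap x L (u, f u), ⟨?_, ?_⟩, by simp⟩
  · exact ((hgraph u huδ.2).2.1 _ (hgraph u huδ.2).1).2.2 rfl
  · exact frameMap_mem_ball x L (by linarith [huδ.1])

/-- The nonlocal curvature with normalizing constant one. -/
def curvatureIntegral (s : ℝ) (Ω : Set (Euc (d + 1))) (x : Euc (d + 1)) : ℝ≥0∞ :=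
  ∫⁻ y, ENNReal.ofReal
    (|inner ℝ (x - y) (outwardNormal Ω y)| / ‖x - y‖ ^ ((d : ℝ) + 1 + s)) ∂(surfaceMeasure Ω)

lemma surfaceMeasure_ball (Ω : Set (Euc (d + 1))) (x : Euc (d + 1)) (r : ℝ) :
    surfaceMeasure Ω (Metric.ball x r) =
      (μHE[d] : Measure (Euc (d + 1))) (frontier Ω ∩ Metric.ball x r) := by
  rw [surfaceMeasure, Measure.restrict_apply measurableSet_ball, inter_comm]

/-- A ball with a lower bound for its surface measure contains a boundary point at which the
curvature is controlled. -/
lemma exists_curvatureIntegral_le {c s p Λ c₁ : ℝ} (hc : 0 < c) (hp : 0 < p)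
    (hΛ : 0 < Λ) (hc₁ : 0 < c₁) (hE : bendingEnergy c s p Ω ≤ ENNReal.ofReal Λ)
    {x : Euc (d + 1)} {t : ℝ} (ht : 0 < t)
    (h : ENNReal.ofReal (c₁ * t ^ d) ≤ surfaceMeasure Ω (Metric.ball x t)) :
    ∃ y ∈ frontier Ω, y ∈ Metric.ball x t ∧
      curvatureIntegral s Ω y ≤
        ENNReal.ofReal (((Λ + 1) / c₁) ^ (1 / p) / c * t ^ (-((d : ℝ) / p))) := by
  -- If the curvature exceeded the threshold on all of ∂Ω ∩ B(x, t), its p-th power integrated over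
  -- a set of measure at least c₁ t^d would give an energy of at least Λ + 1.
  by_contra hcon
  push Not at hcon
  set M := ((Λ + 1) / c₁) ^ (1 / p) with hM
  have hM0 : 0 < M := by positivity
  have hA : MeasurableSet (frontier Ω ∩ Metric.ball x t) :=
    isClosed_frontier.measurableSet.inter measurableSet_ball
  have h1 : ∀ y ∈ frontier Ω ∩ Metric.ball x t,
      ENNReal.ofReal ((Λ + 1) / c₁ * t ^ (-(d : ℝ))) ≤ nonlocalCurvature c s Ω y ^ p := by
    intro y hy
    have h2 := (hcon y hy.1 hy.2).le
    have h3 : ENNReal.ofReal (M * t ^ (-((d : ℝ) / p))) ≤ nonlocalCurvature c s Ω y := by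
      rw [nonlocalCurvature]
      calc _ = ENNReal.ofReal c * ENNReal.ofReal (M / c * t ^ (-((d : ℝ) / p))) := by
            rw [← ENNReal.ofReal_mul hc.le]
            congr 1
            field_simp
        _ ≤ _ := mul_le_mul_right h2 _
    have h4 := ENNReal.rpow_le_rpow h3 hp.le
    rw [ENNReal.ofReal_rpow_of_pos (by positivity)] at h4
    refine le_trans (le_of_eq ?_) h4
    rw [Real.mul_rpow (by positivity) (by positivity), hM, ← Real.rpow_mul (by positivity),
      ← Real.rpow_mul (by positivity)]
    congr 2
    · rw [one_div_mul_cancel hp.ne', Real.rpow_one]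
    · congr 1; field_simp
  have h2 : ENNReal.ofReal (Λ + 1) ≤ ENNReal.ofReal Λ := by
    calc ENNReal.ofReal (Λ + 1)
        = ENNReal.ofReal ((Λ + 1) / c₁ * t ^ (-(d : ℝ))) * ENNReal.ofReal (c₁ * t ^ d) := by
          rw [← ENNReal.ofReal_mul (by positivity)]
          congr 1
          rw [Real.rpow_neg ht.le, Real.rpow_natCast]
          field_simp
      _ ≤ ENNReal.ofReal ((Λ + 1) / c₁ * t ^ (-(d : ℝ))) * surfaceMeasure Ω
          (frontier Ω ∩ Metric.ball x t) := by
          gcongr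
          rw [surfaceMeasure_ball] at h
          rwa [surfaceMeasure, Measure.restrict_apply hA, inter_right_comm, inter_self]
      _ ≤ ∫⁻ y in frontier Ω ∩ Metric.ball x t, nonlocalCurvature c s Ω y ^ p
          ∂(surfaceMeasure Ω) := by
          rw [← setLIntegral_const]
          exact setLIntegral_mono' hA h1
      _ ≤ _ := (setLIntegral_le_lintegral _ _).trans hE
  rw [ENNReal.ofReal_le_ofReal_iff hΛ.le] at h2
  linarith

lemma volume_symmDiff_le_of_curvatureIntegral_le (hd : 1 ≤ d) (hΩ : IsSmoothBoundedDomain Ω)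
    {y : Euc (d + 1)} (hy : y ∈ frontier Ω) {s K r : ℝ} (hr : 0 < r) (hs : 0 < s)
    (hK : curvatureIntegral s Ω y ≤ ENNReal.ofReal K) :
    volume (Metric.ball y r ∩ symmDiff Ω (halfSpace y (outwardNormal Ω y))) ≤
      ENNReal.ofReal (2 * K * r ^ s * r ^ (d + 1)) := by
  refine (volume_ball_inter_symmDiff_halfSpace_le hd hΩ hy hr hs).trans ?_
  calc _ ≤ ENNReal.ofReal (2 * r ^ (d + 1) * r ^ s) * ENNReal.ofReal K := mul_le_mul_right hK _
    _ = _ := by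
      rw [← ENNReal.ofReal_mul (by positivity)]
      congr 1
      ring

/-- Uniform lower Ahlfors regularity of surfaces with bounded nonlocal bending energy. -/
lemma exists_lower_ahlfors (hd : 1 ≤ d) {c s p Λ : ℝ} (hc : 0 < c) (hs₀ : 0 < s)
    (hp : (d : ℝ) / s < p) (hΛ : 0 < Λ) :
    ∃ c₁ > (0 : ℝ), ∃ R₀ > (0 : ℝ), ∀ Ω : Set (Euc (d + 1)), IsSmoothBoundedDomain Ω →
      bendingEnergy c s p Ω ≤ ENNReal.ofReal Λ → ∀ x ∈ frontier Ω, ∀ r, 0 < r → r < R₀ →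
        ENNReal.ofReal (c₁ * r ^ d) ≤ surfaceMeasure Ω (Metric.ball x r) := by
  have hd0 : (0 : ℝ) < d := by exact_mod_cast hd
  have hp0 : 0 < p := (div_pos hd0 hs₀).trans hp
  set κ := unitBallVolume d with hκ
  have hκ0 : 0 < κ := unitBallVolume_pos d
  -- A constant that reproduces itself: the shadow bound at radius 3r/4 is κ/(2·2^d)·(3r/4)^d = 3^d
  -- c₁ r^d.
  set c₁ := κ / (2 * 8 ^ d) with hc₁
  have hc₁0 : 0 < c₁ := by positivity
  set M := ((Λ + 1) / c₁) ^ (1 / p) / c with hM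
  have hM0 : 0 < M := by positivity
  set γ := s - d / p with hγ
  have hγ0 : 0 < γ := by
    rw [hγ, sub_pos, div_lt_iff₀ hp0]; rwa [div_lt_iff₀ hs₀, mul_comm] at hp
  -- For t ≤ E^(1/γ) the relative defect 2M·3^s·t^γ at radius 3t is at most the threshold κ/(4·2^d)
  -- of `le_surface_of_volume_symmDiff_le`.
  set E := κ / (4 * 2 ^ d) / (2 * M * 3 ^ s) with hE
  have hE0 : 0 < E := by positivity
  refine ⟨c₁, hc₁0, E ^ (1 / γ), by positivity, fun Ω hΩ hEn x hx => ?_⟩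
  obtain ⟨t₀, ht₀, hsmall⟩ := eventually_le_surface hd hΩ hx
  have h8 : (2 : ℝ) ^ d ≤ 2 * 8 ^ d := by
    have : (2 : ℝ) ^ d ≤ 8 ^ d := pow_le_pow_left₀ (by norm_num) (by norm_num) d
    nlinarith [pow_pos (show (0 : ℝ) < 8 by norm_num) d]
  -- Induction over scales. The bound at radius r/4 provides y ∈ B(x, r/4) with controlled
  -- curvature, and Ω is close to the half-space at y in B(y, 3r/4) ⊆ B(x, r). Only the number of
  -- steps depends on Ω, not the final scale.
  have key : ∀ k : ℕ, ∀ r, 0 < r → r < E ^ (1 / γ) → r < 4 ^ k * t₀ →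
      ENNReal.ofReal (c₁ * r ^ d) ≤ surfaceMeasure Ω (Metric.ball x r) := by
    intro k
    induction k with
    | zero =>
      intro r hr _ hr2
      rw [pow_zero, one_mul] at hr2
      rw [surfaceMeasure_ball]
      refine le_trans (ENNReal.ofReal_le_ofReal ?_) (hsmall r hr hr2)
      rw [hc₁, ← hκ]
      gcongr
    | succ k ih =>
      intro r hr hr1 hr2
      have ht : 0 < r / 4 := by positivity
      have h1 := ih (r / 4) ht (by linarith) (by rw [pow_succ] at hr2; linarith)
      obtain ⟨y, hy, hyx, hyK⟩ := exists_curvatureIntegral_le hc hp0 hΛ hc₁0 hEn ht h1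
      rw [← hM] at hyK
      have h2 := volume_symmDiff_le_of_curvatureIntegral_le hd hΩ hy (r := 3 * (r / 4))
        (by positivity) hs₀ hyK
      have h3 : 2 * (M * (r / 4) ^ (-((d : ℝ) / p))) * (3 * (r / 4)) ^ s ≤ κ / (4 * 2 ^ d) := by
        have e : 2 * (M * (r / 4) ^ (-((d : ℝ) / p))) * (3 * (r / 4)) ^ s =
            (2 * M * 3 ^ s) * (r / 4) ^ γ := by
          rw [Real.mul_rpow (by norm_num) ht.le, hγ, sub_eq_add_neg, Real.rpow_add ht]
          ring
        have h4 : (r / 4) ^ γ ≤ E := by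
          calc (r / 4) ^ γ ≤ (E ^ (1 / γ)) ^ γ :=
                Real.rpow_le_rpow ht.le (by linarith) hγ0.le
            _ = E := by rw [← Real.rpow_mul hE0.le, one_div_mul_cancel hγ0.ne', Real.rpow_one]
        rw [e]
        calc _ ≤ (2 * M * 3 ^ s) * E := by gcongr
          _ = _ := by rw [hE]; field_simp
      have h4 := le_surface_of_volume_symmDiff_le hd hΩ.isOpen (hΩ.norm_outwardNormal hy)
        (r := 3 * (r / 4)) (by positivity)
        (h2.trans (ENNReal.ofReal_le_ofReal (mul_le_mul_of_nonneg_right h3 (by positivity))))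
      rw [surfaceMeasure_ball]
      refine (ENNReal.ofReal_le_ofReal ?_).trans (h4.trans (measure_mono ?_))
      · rw [← hκ, hc₁]
        have e1 : (3 * (r / 4)) ^ d = 3 ^ d * r ^ d / 4 ^ d := by
          rw [mul_pow, div_pow]; ring
        have e2 : (8 : ℝ) ^ d = 2 ^ d * 4 ^ d := by rw [← mul_pow]; norm_num
        have e3 : (1 : ℝ) ≤ 3 ^ d := one_le_pow₀ (by norm_num)
        rw [e1, e2]
        have : 0 ≤ κ / (2 * (2 ^ d * 4 ^ d)) * r ^ d := by positivity
        calc _ ≤ κ / (2 * (2 ^ d * 4 ^ d)) * r ^ d * 3 ^ d := le_mul_of_one_le_right this e3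
          _ = _ := by field_simp
      · refine inter_subset_inter_right _ fun z hz => ?_
        rw [mem_ball_iff_norm] at hz hyx ⊢
        calc ‖z - x‖ ≤ ‖z - y‖ + ‖y - x‖ := norm_sub_le_norm_sub_add_norm_sub _ _ _
          _ < _ := by linarith
  intro r hr hr1
  obtain ⟨k, hk⟩ := pow_unbounded_of_one_lt (r / t₀) (show (1 : ℝ) < 4 by norm_num)
  exact key k r hr hr1 (by rwa [div_lt_iff₀ ht₀] at hk)

end Ahlfors
end

/-! ### Hölder continuity of the normal and flatness. -/

noncomputable section

section Flatness
variable {d : ℕ}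

/-- Comparison of the tangent planes at two points with controlled curvature. -/
lemma exists_normal_comparison (hd : 1 ≤ d) {s : ℝ} (hs : 0 < s) :
    ∃ C > (0 : ℝ), ∀ Ω : Set (Euc (d + 1)), IsSmoothBoundedDomain Ω →
      ∀ y ∈ frontier Ω, ∀ z ∈ frontier Ω, ∀ K ρ : ℝ, 0 ≤ K → 0 < ρ →
      curvatureIntegral s Ω y ≤ ENNReal.ofReal K → curvatureIntegral s Ω z ≤ ENNReal.ofReal K →
      ‖y - z‖ ≤ ρ / 2 →
      ‖outwardNormal Ω y - outwardNormal Ω z‖ ≤ C * K * ρ ^ s ∧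
        |inner ℝ (y - z) (outwardNormal Ω z)| ≤ C * K * ρ ^ s * ρ := by
  obtain ⟨C, hC, h⟩ := exists_halfSpace_comparison hd
  refine ⟨C * (2 * 2 ^ s * 2 ^ (d + 1)), by positivity, ?_⟩
  intro Ω hΩ y hy z hz K ρ hK hρ hKy hKz hyz
  have h2 : (1 : ℝ) ≤ 2 ^ s := Real.one_le_rpow (by norm_num) hs.le
  have h2' : (1 : ℝ) ≤ 2 ^ (d + 1) := one_le_pow₀ (by norm_num)
  -- Covers both hypotheses of the comparison; the powers of 2 come from the doubled radius at z.
  set ε := 2 * K * ρ ^ s * (2 ^ s * 2 ^ (d + 1)) with hε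
  have hε0 : 0 ≤ ε := by positivity
  have hA := volume_symmDiff_le_of_curvatureIntegral_le hd hΩ hy hρ hs hKy
  have hB := volume_symmDiff_le_of_curvatureIntegral_le hd hΩ hz (r := 2 * ρ) (by positivity) hs hKz
  have hA' : 2 * K * ρ ^ s * ρ ^ (d + 1) ≤ ε * ρ ^ (d + 1) := by
    rw [hε]
    refine mul_le_mul_of_nonneg_right ?_ (by positivity)
    exact le_mul_of_one_le_right (by positivity) (one_le_mul_of_one_le_of_one_le h2 h2')
  have hB' : 2 * K * (2 * ρ) ^ s * (2 * ρ) ^ (d + 1) = ε * ρ ^ (d + 1) := by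
    rw [hε, Real.mul_rpow (by norm_num) hρ.le, mul_pow]
    ring
  rw [hB'] at hB
  obtain ⟨h3, h4⟩ := h Ω y z _ _ ρ ε (hΩ.norm_outwardNormal hy) (hΩ.norm_outwardNormal hz) hρ hε0
    hyz (hA.trans (ENNReal.ofReal_le_ofReal hA')) hB
  refine ⟨h3.trans_eq ?_, h4.trans_eq ?_⟩ <;> rw [hε] <;> ring

/-- `γ = s - d / p` is positive. -/
lemma exponent_pos (hd : 1 ≤ d) {s p : ℝ} (hs : 0 < s) (hp : (d : ℝ) / s < p) :
    0 < s - d / p := by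
  have hd0 : (0 : ℝ) < d := by exact_mod_cast hd
  have hp0 : 0 < p := (div_pos hd0 hs).trans hp
  rw [sub_pos, div_lt_iff₀ hp0]; rwa [div_lt_iff₀ hs, mul_comm] at hp

open Filter Topology in
/-- Each boundary point is close to a point with controlled curvature whose tangent plane is
close. -/
lemma exists_good_point (hd : 1 ≤ d) {c s p Λ c₁ R₀ : ℝ} (hc : 0 < c) (hs : 0 < s)
    (hp : (d : ℝ) / s < p) (hΛ : 0 < Λ) (hc₁ : 0 < c₁) :
    ∃ M > (0 : ℝ), ∃ C > (0 : ℝ), ∀ Ω : Set (Euc (d + 1)), IsSmoothBoundedDomain Ω →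
      bendingEnergy c s p Ω ≤ ENNReal.ofReal Λ →
      (∀ x ∈ frontier Ω, ∀ r, 0 < r → r < R₀ →
        ENNReal.ofReal (c₁ * r ^ d) ≤ surfaceMeasure Ω (Metric.ball x r)) →
      ∀ x ∈ frontier Ω, ∀ r, 0 < r → r < R₀ →
        ∃ y ∈ frontier Ω, ‖y - x‖ ≤ r ∧
          curvatureIntegral s Ω y ≤ ENNReal.ofReal (M * r ^ (-((d : ℝ) / p))) ∧
          ‖outwardNormal Ω y - outwardNormal Ω x‖ ≤ C * r ^ (s - d / p) ∧
          |inner ℝ (y - x) (outwardNormal Ω y)| ≤ C * r ^ (s - d / p) * r := by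
  obtain ⟨C₀, hC₀, hcomp⟩ := exists_normal_comparison hd hs
  have hγ := exponent_pos hd hs hp
  set γ := s - d / p with hγdef
  have hd0 : (0 : ℝ) < d := by exact_mod_cast hd
  have hp0 : 0 < p := (div_pos hd0 hs).trans hp
  set M := ((Λ + 1) / c₁) ^ (1 / p) / c with hM
  have hM0 : 0 < M := by positivity
  set θ : ℝ := (1 / 2) ^ γ with hθ
  have hθ0 : 0 < θ := by positivity
  have hθ1 : θ < 1 := Real.rpow_lt_one (by norm_num) (by norm_num) hγ
  set C₁ := C₀ * M * (1 / 2) ^ (-((d : ℝ) / p)) * 4 ^ s with hC₁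
  have hC₁0 : 0 < C₁ := by positivity
  set C₂ := C₁ / (1 - θ) with hC₂
  have h1θ : 0 < 1 - θ := by linarith
  have hC₂0 : 0 < C₂ := by positivity
  refine ⟨M, hM0, 2 * (4 * C₁ + 4 * C₂) + C₂, by positivity, ?_⟩
  intro Ω hΩ hE hreg x hx r hr hrR
  -- Points of controlled curvature are chosen at all dyadic radii. Consecutive normals differ by a
  -- multiple of ri^γ, a geometric sequence with ratio θ = 2^(−γ).
  set ri : ℕ → ℝ := fun i => r * (1 / 2) ^ i with hri
  have hri0 : ∀ i, 0 < ri i := fun i => by positivity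
  have hrile : ∀ i, ri i ≤ r := fun i =>
    mul_le_of_le_one_right hr.le (pow_le_one₀ (by norm_num) (by norm_num))
  have hrs : ∀ i, ri (i + 1) = ri i / 2 := fun i => by simp only [hri, pow_succ]; ring
  have hgood : ∀ i, ∃ y ∈ frontier Ω, y ∈ Metric.ball x (ri i) ∧
      curvatureIntegral s Ω y ≤ ENNReal.ofReal (M * ri i ^ (-((d : ℝ) / p))) := fun i =>
    exists_curvatureIntegral_le hc hp0 hΛ hc₁ hE (hri0 i)
      (hreg x hx _ (hri0 i) ((hrile i).trans_lt hrR))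
  choose y hyS hyb hyK using hgood
  have hyx : ∀ i, ‖y i - x‖ < ri i := fun i => by rw [← mem_ball_iff_norm]; exact hyb i
  have hriγ : ∀ i, ri i ^ γ = r ^ γ * θ ^ i := fun i => by
    simp only [hri]
    rw [Real.mul_rpow hr.le (by positivity), hθ, ← Real.rpow_natCast, ← Real.rpow_natCast,
      ← Real.rpow_mul (by norm_num), ← Real.rpow_mul (by norm_num), mul_comm (i : ℝ)]
  have hstep : ∀ i, ‖y i - y (i + 1)‖ ≤ 2 * ri i := fun i => by
    have h1 := norm_sub_le_norm_sub_add_norm_sub (y i) x (y (i + 1))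
    rw [norm_sub_rev x] at h1
    have := (hyx i).le; have h3 := (hyx (i + 1)).le
    rw [hrs] at h3
    linarith [hri0 i]
  have hpair : ∀ i, ‖outwardNormal Ω (y i) - outwardNormal Ω (y (i + 1))‖ ≤ C₁ * r ^ γ * θ ^ i ∧
      |inner ℝ (y i - y (i + 1)) (outwardNormal Ω (y (i + 1)))| ≤
        C₁ * r ^ γ * θ ^ i * (4 * ri i) := by
    intro i
    have hK : M * ri i ^ (-((d : ℝ) / p)) ≤ M * ri (i + 1) ^ (-((d : ℝ) / p)) := by
      refine mul_le_mul_of_nonneg_left ?_ hM0.le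
      refine Real.rpow_le_rpow_of_nonpos (hri0 _) ?_ (by rw [neg_nonpos]; positivity)
      rw [hrs]; linarith [hri0 i]
    have hK0 : 0 ≤ M * ri (i + 1) ^ (-((d : ℝ) / p)) :=
      mul_nonneg hM0.le (Real.rpow_nonneg (hri0 _).le _)
    have := hcomp Ω hΩ (y i) (hyS i) (y (i + 1)) (hyS _) _ (4 * ri i) hK0
      (by linarith [hri0 i]) ((hyK i).trans (ENNReal.ofReal_le_ofReal hK)) (hyK _)
      ((hstep i).trans (by linarith [hri0 i]))
    have e : C₀ * (M * ri (i + 1) ^ (-((d : ℝ) / p))) * (4 * ri i) ^ s = C₁ * r ^ γ * θ ^ i := by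
      rw [mul_assoc C₁, ← hriγ, hrs, Real.mul_rpow (by norm_num) (hri0 i).le, hγdef, sub_eq_add_neg,
        Real.rpow_add (hri0 i), div_eq_mul_one_div (ri i),
        Real.mul_rpow (hri0 i).le (by norm_num), hC₁]
      ring
    rwa [e] at this
  have hylim : Tendsto y atTop (𝓝 x) := by
    rw [tendsto_iff_norm_sub_tendsto_zero]
    refine squeeze_zero (fun _ => norm_nonneg _) (fun i => (hyx i).le) ?_
    have := (tendsto_pow_atTop_nhds_zero_of_lt_one (show (0 : ℝ) ≤ 1 / 2 by norm_num)
      (by norm_num)).const_mul r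
    simpa [hri] using this
  -- Smoothness of ∂Ω enters only qualitatively here, to identify the limit of the normals.
  have hnlim : Tendsto (fun i => outwardNormal Ω (y i)) atTop (𝓝 (outwardNormal Ω x)) :=
    (hΩ.continuousOn_outwardNormal x hx).tendsto.comp
      (tendsto_nhdsWithin_iff.2 ⟨hylim, Eventually.of_forall hyS⟩)
  have hrγ : 0 < r ^ γ := by positivity
  have hn : ∀ i, ‖outwardNormal Ω (y i) - outwardNormal Ω x‖ ≤ C₂ * r ^ γ := by
    intro i
    have := dist_le_of_le_geometric_of_tendsto θ (C₁ * r ^ γ) hθ1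
      (fun k => by rw [dist_eq_norm]; exact (hpair k).1) hnlim i
    rw [dist_eq_norm] at this
    refine this.trans ?_
    rw [hC₂, div_mul_eq_mul_div]
    refine div_le_div_of_nonneg_right ?_ h1θ.le
    exact mul_le_of_le_one_right (by positivity) (pow_le_one₀ hθ0.le hθ1.le)
  refine ⟨y 0, hyS 0, by simpa [hri] using (hyx 0).le, by simpa [hri] using hyK 0, ?_, ?_⟩
  · refine (hn 0).trans ?_
    gcongr
    linarith
  -- Compare heights over the tangent plane at y 0. The difference of normals is merely bounded by a
  -- multiple of r^γ; summability comes from the distances ‖y i − y (i + 1)‖ ≤ 2 ri, which halve at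
  -- every step.
  · have hflat : ∀ i, dist (inner ℝ (y i) (outwardNormal Ω (y 0)))
        (inner ℝ (y (i + 1)) (outwardNormal Ω (y 0))) ≤
        (4 * C₁ + 4 * C₂) * r ^ γ * r * (1 / 2) ^ i := by
      intro i
      rw [Real.dist_eq, ← inner_sub_left]
      have e : inner ℝ (y i - y (i + 1)) (outwardNormal Ω (y 0)) =
          inner ℝ (y i - y (i + 1)) (outwardNormal Ω (y (i + 1))) +
          inner ℝ (y i - y (i + 1)) (outwardNormal Ω (y 0) - outwardNormal Ω (y (i + 1))) := by
        rw [← inner_add_right]; congr 1; abel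
      have h1 : ‖outwardNormal Ω (y 0) - outwardNormal Ω (y (i + 1))‖ ≤ 2 * (C₂ * r ^ γ) := by
        refine (norm_sub_le_norm_sub_add_norm_sub _ (outwardNormal Ω x) _).trans ?_
        rw [norm_sub_rev (outwardNormal Ω x)]
        linarith [hn 0, hn (i + 1)]
      have h2 := (abs_real_inner_le_norm (y i - y (i + 1))
        (outwardNormal Ω (y 0) - outwardNormal Ω (y (i + 1)))).trans
        (mul_le_mul (hstep i) h1 (norm_nonneg _) (by linarith [hri0 i]))
      have h3 : C₁ * r ^ γ * θ ^ i * (4 * ri i) ≤ C₁ * r ^ γ * (4 * ri i) := by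
        refine mul_le_mul_of_nonneg_right ?_ (by linarith [hri0 i])
        exact mul_le_of_le_one_right (by positivity) (pow_le_one₀ hθ0.le hθ1.le)
      rw [e]
      refine (abs_add_le _ _).trans ?_
      have e2 : (4 * C₁ + 4 * C₂) * r ^ γ * r * (1 / 2) ^ i =
          C₁ * r ^ γ * (4 * ri i) + 2 * ri i * (2 * (C₂ * r ^ γ)) := by
        simp only [hri]; ring
      rw [e2]
      exact add_le_add ((hpair i).2.trans h3) h2
    have hl : Tendsto (fun i => inner ℝ (y i) (outwardNormal Ω (y 0))) atTop
        (𝓝 (inner ℝ x (outwardNormal Ω (y 0)))) :=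
      Filter.Tendsto.inner (𝕜 := ℝ) hylim tendsto_const_nhds
    have := dist_le_of_le_geometric_of_tendsto₀ (1 / 2) _ (by norm_num) hflat hl
    rw [Real.dist_eq, ← inner_sub_left] at this
    refine this.trans ?_
    have h4 : 0 ≤ C₂ * r ^ γ * r := by positivity
    have e : (4 * C₁ + 4 * C₂) * r ^ γ * r / (1 - 1 / 2) =
      2 * (4 * C₁ + 4 * C₂) * r ^ γ * r := by ring
    rw [e]
    nlinarith

/-- Hölder continuity of the normal and the corresponding flatness estimate. -/
lemma exists_holder_normal (hd : 1 ≤ d) {c s p Λ : ℝ} (hc : 0 < c) (hs : 0 < s)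
    (hp : (d : ℝ) / s < p) (hΛ : 0 < Λ) :
    ∃ R₀ > (0 : ℝ), ∃ C > (0 : ℝ), ∀ Ω : Set (Euc (d + 1)), IsSmoothBoundedDomain Ω →
      bendingEnergy c s p Ω ≤ ENNReal.ofReal Λ →
      ∀ x ∈ frontier Ω, ∀ x' ∈ frontier Ω, ‖x - x'‖ < R₀ →
        ‖outwardNormal Ω x - outwardNormal Ω x'‖ ≤ C * ‖x - x'‖ ^ (s - d / p) ∧
        |inner ℝ (x - x') (outwardNormal Ω x)| ≤ C * ‖x - x'‖ ^ (s - d / p) * ‖x - x'‖ := by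
  obtain ⟨c₁, hc₁, R₀, hR₀, hreg⟩ := exists_lower_ahlfors hd hc hs hp hΛ
  obtain ⟨M, hM, C, hC, hgood⟩ := exists_good_point (R₀ := R₀) hd hc hs hp hΛ hc₁
  obtain ⟨C₀, hC₀, hcomp⟩ := exists_normal_comparison hd hs
  have hγ := exponent_pos hd hs hp
  set γ := s - d / p with hγdef
  set C₁ := C₀ * M * 6 ^ s with hC₁
  have hC₁0 : 0 < C₁ := by positivity
  refine ⟨R₀, hR₀, 10 * C + 10 * C₁, by positivity, fun Ω hΩ hE x hx x' hx' hxx => ?_⟩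
  rcases (norm_nonneg (x - x')).eq_or_lt with h0 | hr
  · have : x = x' := by rw [← sub_eq_zero, ← norm_eq_zero]; exact h0.symm
    subst this
    simp [hγ.ne']
  set r := ‖x - x'‖ with hrdef
  -- The comparison of x with x' passes through points y and z of controlled curvature, chosen near
  -- each of them at the scale r = ‖x − x'‖.
  obtain ⟨y, hy, hyx, hyK, hyn, hyf⟩ := hgood Ω hΩ hE (hreg Ω hΩ hE) x hx r hr hxx
  obtain ⟨z, hz, hzx, hzK, hzn, hzf⟩ := hgood Ω hΩ hE (hreg Ω hΩ hE) x' hx' r hr hxx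
  have hyz : ‖y - z‖ ≤ 3 * r := by
    have h1 := norm_sub_le_norm_sub_add_norm_sub y x z
    have h2 := norm_sub_le_norm_sub_add_norm_sub x x' z
    rw [norm_sub_rev x' z] at h2
    linarith
  obtain ⟨hn, hf⟩ := hcomp Ω hΩ y hy z hz _ (6 * r) (by positivity) (by positivity) hyK hzK
    (by linarith)
  have e : C₀ * (M * r ^ (-((d : ℝ) / p))) * (6 * r) ^ s = C₁ * r ^ γ := by
    rw [Real.mul_rpow (by norm_num) hr.le, hγdef, sub_eq_add_neg, Real.rpow_add hr, hC₁]
    ring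
  rw [e] at hn hf
  set T := r ^ γ with hT
  have hT0 : 0 < T := by positivity
  set nx := outwardNormal Ω x
  set nx' := outwardNormal Ω x'
  set ny := outwardNormal Ω y
  set nz := outwardNormal Ω z
  have hxz : ‖nx - nz‖ ≤ C * T + C₁ * T := by
    have h1 := norm_sub_le_norm_sub_add_norm_sub nx ny nz
    rw [norm_sub_rev nx ny] at h1
    linarith
  have hCT : 0 ≤ C * T := by positivity
  have hC₁T : 0 ≤ C₁ * T := by positivity
  constructor
  · have h1 := norm_sub_le_norm_sub_add_norm_sub nx nz nx'
    nlinarith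
  -- x − x' = −(y − x) + (y − z) + (z − x'), each piece being paired with the normal for which its
  -- flatness is known; the remainders are differences of normals.
  · have e1 : inner ℝ (x - x') nx = (-(inner ℝ (y - x) ny) - inner ℝ (y - x) (nx - ny)) +
        (inner ℝ (y - z) nz + inner ℝ (y - z) (nx - nz)) +
        (inner ℝ (z - x') nz + inner ℝ (z - x') (nx - nz)) := by
      simp only [inner_sub_left, inner_sub_right]
      ring
    have b1 : |inner ℝ (y - x) (nx - ny)| ≤ r * (C * T) := by
      refine (abs_real_inner_le_norm _ _).trans ?_
      rw [norm_sub_rev nx]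
      exact mul_le_mul hyx hyn (norm_nonneg _) hr.le
    have b2 : |inner ℝ (y - z) (nx - nz)| ≤ 3 * r * (C * T + C₁ * T) :=
      (abs_real_inner_le_norm _ _).trans (mul_le_mul hyz hxz (norm_nonneg _) (by positivity))
    have b3 : |inner ℝ (z - x') (nx - nz)| ≤ r * (C * T + C₁ * T) :=
      (abs_real_inner_le_norm _ _).trans (mul_le_mul hzx hxz (norm_nonneg _) hr.le)
    rw [e1]
    have := abs_le.1 hyf; have := abs_le.1 hzf; have := abs_le.1 hf
    have := abs_le.1 b1; have := abs_le.1 b2; have := abs_le.1 b3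
    have k1 : 0 ≤ C * T * r := by positivity
    have k2 : 0 ≤ C₁ * T * r := by positivity
    rw [abs_le]
    constructor <;> linarith

end Flatness
end

/-! ### Graph patches of uniform size. -/

noncomputable section

section Patch
variable {d : ℕ} {Ω : Set (Euc (d + 1))}

/-- In the cylinder of radius and half-height `R` around `x₀`, in the frame given by `L`, the surface
`∂Ω` is the graph of the smooth `1`-Lipschitz function `f`. -/
structure IsGraphPatch (Ω : Set (Euc (d + 1))) (x₀ : Euc (d + 1))
    (L : Euc (d + 1) ≃ₗᵢ[ℝ] Euc (d + 1)) (R : ℝ) (f : Euc d → ℝ) : Prop where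
  pos : 0 < R
  smooth : ContDiffOn ℝ ∞ f (Metric.ball 0 R)
  map_zero : f 0 = 0
  lipschitz : ∀ u ∈ Metric.ball (0 : Euc d) R, ∀ v ∈ Metric.ball (0 : Euc d) R,
    |f u - f v| ≤ ‖u - v‖
  mem_iff : ∀ u ∈ Metric.ball (0 : Euc d) R, ∀ t : ℝ, |t| < R →
    (frameMap x₀ L (u, t) ∈ frontier Ω ↔ t = f u)

lemma IsGraphPatch.abs_lt {x₀ : Euc (d + 1)} {L : Euc (d + 1) ≃ₗᵢ[ℝ] Euc (d + 1)} {R : ℝ}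
    {f : Euc d → ℝ} (h : IsGraphPatch Ω x₀ L R f) {u : Euc d} (hu : u ∈ Metric.ball (0 : Euc d) R) :
    |f u| < R := by
  have := h.lipschitz u hu 0 (Metric.mem_ball_self h.pos)
  rw [h.map_zero, sub_zero, sub_zero] at this
  rw [mem_ball_zero_iff] at hu
  exact this.trans_lt hu

lemma graphMap_eq_frameMap {x₀ : Euc (d + 1)} {L : Euc (d + 1) ≃ₗᵢ[ℝ] Euc (d + 1)}
    {P : Matrix (Fin (d + 1)) (Fin (d + 1)) ℝ} (hP : ∀ z, Matrix.toEuclideanLin P z = L z)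
    (f : Euc d → ℝ) (u : Euc d) : graphMap x₀ P f u = frameMap x₀ L (u, f u) := by
  rw [graphMap, hP, frameMap]

lemma IsGraphPatch.isLocalParametrization {x₀ : Euc (d + 1)}
    {L : Euc (d + 1) ≃ₗᵢ[ℝ] Euc (d + 1)} {R : ℝ} {f : Euc d → ℝ} (h : IsGraphPatch Ω x₀ L R f) :
    IsLocalParametrization (frontier Ω) (Metric.ball 0 R) (fun u => frameMap x₀ L (u, f u)) := by
  have hpc := continuous_frameCoord x₀ L
  refine ⟨Metric.isOpen_ball, ?_, {z | (frameCoord x₀ L z).1 ∈ Metric.ball (0 : Euc d) R ∧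
    |(frameCoord x₀ L z).2| < R}, fun z => (frameCoord x₀ L z).1, ?_, ?_, ?_, ?_⟩
  · exact (contDiff_frameMap x₀ L).comp_contDiffOn (contDiffOn_id.prodMk h.smooth)
  · exact (Metric.isOpen_ball.preimage (continuous_fst.comp hpc)).inter
      (isOpen_lt (continuous_abs.comp (continuous_snd.comp hpc)) continuous_const)
  · exact (contDiff_fst.comp (contDiff_frameCoord x₀ L)).contDiffOn
  · ext z
    constructor
    · rintro ⟨u, hu, rfl⟩
      refine ⟨?_, (h.mem_iff u hu _ (h.abs_lt hu)).2 rfl⟩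
      simp only [mem_ofPred_eq, frameCoord_frameMap]
      exact ⟨hu, h.abs_lt hu⟩
    · rintro ⟨⟨h1, h2⟩, h3⟩
      refine ⟨_, h1, ?_⟩
      have h4 := h.mem_iff _ h1 _ h2
      simp only [Prod.mk.eta, frameMap_frameCoord] at h4
      change frameMap x₀ L _ = z
      rw [← h4.1 h3, Prod.mk.eta, frameMap_frameCoord]
  · intro u _
    simp

lemma frameMap_add (x : Euc (d + 1)) (L : Euc (d + 1) ≃ₗᵢ[ℝ] Euc (d + 1)) (p q : Euc d × ℝ) :
    frameMap (frameMap x L p) L q = frameMap x L (p + q) := by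
  simp only [frameMap, Prod.fst_add, Prod.snd_add, graphPoint_add, map_add, add_assoc]

/-- The segment from `x₀` in a direction that leaves the tangent plane stays on one side, as long as
it does not meet `∂Ω`. -/
lemma mem_iff_inner_neg (hΩ : IsSmoothBoundedDomain Ω) {x₀ w : Euc (d + 1)} (hx : x₀ ∈ frontier Ω)
    (hw : inner ℝ (outwardNormal Ω x₀) w ≠ 0)
    (h : ∀ t : ℝ, 0 < t → t ≤ 1 → x₀ + t • w ∉ frontier Ω) :
    x₀ + w ∈ Ω ↔ inner ℝ (outwardNormal Ω x₀) w < 0 := by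
  have hn := hΩ.isOutwardUnitNormal hx
  have hlt : ∀ᶠ t in nhdsWithin (0 : ℝ) (Ioi 0), 0 < t ∧ t < 1 := Ioo_mem_nhdsGT one_pos
  have key : ∀ τ : ℝ, 0 < τ → τ < 1 → (x₀ + τ • w ∈ Ω ↔ x₀ + w ∈ Ω) := by
    intro τ hτ hτ1
    have hpre : IsPreconnected ((fun t : ℝ => x₀ + t • w) '' Icc τ 1) :=
      isPreconnected_Icc.image _ (by fun_prop)
    have e1 : x₀ + τ • w ∈ (fun t : ℝ => x₀ + t • w) '' Icc τ 1 := ⟨τ, ⟨le_rfl, hτ1.le⟩, rfl⟩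
    have e2 : x₀ + w ∈ (fun t : ℝ => x₀ + t • w) '' Icc τ 1 := ⟨1, ⟨hτ1.le, le_rfl⟩, by simp⟩
    by_contra hcon
    have h3 : ((fun t : ℝ => x₀ + t • w) '' Icc τ 1 ∩ frontier Ω).Nonempty := by
      by_cases hwΩ : x₀ + w ∈ Ω
      · exact hpre.inter_frontier_nonempty_of_mem ⟨_, e2, hwΩ⟩
          ⟨_, e1, fun hc => hcon ⟨fun _ => hwΩ, fun _ => hc⟩⟩
      · refine hpre.inter_frontier_nonempty_of_mem ⟨_, e1, ?_⟩ ⟨_, e2, hwΩ⟩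
        by_contra hc
        exact hcon ⟨fun h1 => absurd h1 hc, fun h1 => absurd h1 hwΩ⟩
    obtain ⟨z, ⟨t, ht, rfl⟩, hz⟩ := h3
    exact h t (hτ.trans_le ht.1) ht.2 hz
  rcases lt_or_gt_of_ne hw with hneg | hpos
  · obtain ⟨τ, h1, h2, h3⟩ := ((hn.eventually_mem hneg).and hlt).exists
    exact ⟨fun _ => hneg, fun _ => (key τ h2 h3).1 h1⟩
  · obtain ⟨τ, h1, h2, h3⟩ := ((hn.eventually_notMem hpos).and hlt).exists
    exact ⟨fun hc => absurd ((key τ h2 h3).2 hc) h1, fun hc => absurd hc (not_lt.2 hpos.le)⟩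

open Filter Topology in
/-- A surface whose normal varies little and that is flat at small scales is the graph of a
function. -/
lemma exists_isGraphPatch (hΩ : IsSmoothBoundedDomain Ω) {x₀ : Euc (d + 1)} (hx₀ : x₀ ∈ frontier Ω)
    {L : Euc (d + 1) ≃ₗᵢ[ℝ] Euc (d + 1)} (hL : L (lastVec d) = outwardNormal Ω x₀) {R : ℝ}
    (hR : 0 < R)
    (hn : ∀ y ∈ frontier Ω, ∀ y' ∈ frontier Ω, ‖y - y'‖ < 4 * R →
      ‖outwardNormal Ω y - outwardNormal Ω y'‖ ≤ 1 / 4)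
    (hflat : ∀ y ∈ frontier Ω, ∀ y' ∈ frontier Ω, ‖y - y'‖ < 4 * R →
      |inner ℝ (y - y') (outwardNormal Ω y)| ≤ 1 / 4 * ‖y - y'‖) :
    ∃ f : Euc d → ℝ, IsGraphPatch Ω x₀ L R f ∧
      ∀ u ∈ Metric.ball (0 : Euc d) R,
        3 / 4 ≤ inner ℝ (outwardNormal Ω (frameMap x₀ L (u, f u))) (L (lastVec d)) ∧
        ∀ v, inner ℝ (outwardNormal Ω (frameMap x₀ L (u, f u)))
          (L (graphPoint v (fderiv ℝ f u v))) = 0 := by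
  set F := frameMap x₀ L with hF
  have hF0 : F (0, 0) = x₀ := frameMap_zero x₀ L
  have hFc : Continuous F := continuous_frameMap x₀ L
  have hdist : ∀ u u' : Euc d, ∀ t t' : ℝ, ‖u‖ < R → ‖u'‖ < R → |t| < R → |t'| < R →
      ‖F (u, t) - F (u', t')‖ < 4 * R := by
    intro u u' t t' h1 h2 h3 h4
    rw [hF, norm_frameMap_sub]
    refine (norm_graphPoint_le _ _).trans_lt ?_
    have h5 := norm_sub_le u u'
    have h6 := abs_sub t t'
    simp only at h5 h6 ⊢
    linarith
  -- the normal stays close to the normal at `x₀`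
  have hνn : ∀ u : Euc d, ∀ t : ℝ, ‖u‖ < R → |t| < R → F (u, t) ∈ frontier Ω →
      ‖outwardNormal Ω (F (u, t)) - L (lastVec d)‖ ≤ 1 / 4 ∧
      3 / 4 ≤ inner ℝ (outwardNormal Ω (F (u, t))) (L (lastVec d)) := by
    intro u t hu ht hfr
    have h1 := hdist u 0 t 0 hu (by simpa) ht (by simpa)
    rw [hF0] at h1
    have h2 := hn _ hfr _ hx₀ h1
    rw [← hL] at h2
    refine ⟨h2, ?_⟩
    have hLn : ‖L (lastVec d)‖ = 1 := by rw [LinearIsometryEquiv.norm_map, norm_lastVec]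
    have h3 := abs_le.1 (abs_real_inner_le_norm (outwardNormal Ω (F (u, t)) - L (lastVec d))
      (L (lastVec d)))
    rw [inner_sub_left, real_inner_self_eq_norm_sq, hLn] at h3
    linarith
  -- the Lipschitz estimate
  have hlip : ∀ u u' : Euc d, ∀ t t' : ℝ, ‖u‖ < R → ‖u'‖ < R → |t| < R → |t'| < R →
      F (u, t) ∈ frontier Ω → F (u', t') ∈ frontier Ω → |t - t'| ≤ ‖u - u'‖ := by
    intro u u' t t' hu hu' ht ht' h1 h2
    have h3 := hdist u u' t t' hu hu' ht ht'
    have h4 := hflat _ h1 _ h2 h3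
    have h5 := (hνn u t hu ht h1).1
    have h6 : inner ℝ (F (u, t) - F (u', t')) (L (lastVec d)) = t - t' := by
      rw [hF, frameMap_sub, LinearIsometryEquiv.inner_map_map, inner_graphPoint_lastVec]
    have h7 : ‖F (u, t) - F (u', t')‖ ≤ ‖u - u'‖ + |t - t'| := by
      rw [hF, norm_frameMap_sub]; exact norm_graphPoint_le _ _
    -- Flatness contributes 1/4 and the deviation of the normal from the axis another 1/4. With
    -- `h7`, half of |t − t'| is absorbed on the left.
    have h8 : |t - t'| ≤ 1 / 2 * ‖F (u, t) - F (u', t')‖ := by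
      rw [← h6]
      have e : inner ℝ (F (u, t) - F (u', t')) (L (lastVec d)) =
          inner ℝ (F (u, t) - F (u', t')) (outwardNormal Ω (F (u, t))) -
          inner ℝ (F (u, t) - F (u', t')) (outwardNormal Ω (F (u, t)) - L (lastVec d)) := by
        rw [inner_sub_right]; ring
      rw [e]
      have h9 := abs_real_inner_le_norm (F (u, t) - F (u', t'))
        (outwardNormal Ω (F (u, t)) - L (lastVec d))
      have h10 : ‖F (u, t) - F (u', t')‖ * ‖outwardNormal Ω (F (u, t)) - L (lastVec d)‖ ≤
        ‖F (u, t) - F (u', t')‖ * (1 / 4) := mul_le_mul_of_nonneg_left h5 (norm_nonneg _)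
      refine (abs_sub _ _).trans ?_
      linarith
    linarith
  -- existence of a point above each point of the disc
  have hex : ∀ u : Euc d, ‖u‖ < R → ∃ t : ℝ, |t| < R ∧ F (u, t) ∈ frontier Ω := by
    intro u hu
    -- A height with ‖u‖ < τ < R. By the Lipschitz estimate, the segments from x₀ to (u, ±τ) are too
    -- steep to meet ∂Ω again, so the tangent plane decides their endpoints: (u, −τ) is in Ω and (u,
    -- τ) is not.
    set τ := (‖u‖ + R) / 2 with hτ
    have hτ0 : 0 < τ := by positivity
    have hτR : τ < R := by rw [hτ]; linarith
    have huτ : ‖u‖ < τ := by rw [hτ]; linarith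
    have hside : ∀ σ : ℝ, |σ| = τ → (F (u, σ) ∈ Ω ↔ σ < 0) := by
      intro σ hσ
      have e : F (u, σ) = x₀ + L (graphPoint u σ) := rfl
      have hi : inner ℝ (outwardNormal Ω x₀) (L (graphPoint u σ)) = σ := by
        rw [← hL, LinearIsometryEquiv.inner_map_map, real_inner_comm, inner_graphPoint_lastVec]
      rw [e, mem_iff_inner_neg hΩ hx₀, hi]
      · rw [hi]; intro h0; rw [h0, abs_zero] at hσ; exact hτ0.ne hσ
      · intro t ht0 ht1 hfr
        rw [← map_smul, ← graphPoint_smul] at hfr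
        have h1 : ‖t • u‖ = t * ‖u‖ := by rw [norm_smul, Real.norm_of_nonneg ht0.le]
        have h2 : |t * σ| = t * τ := by rw [abs_mul, abs_of_pos ht0, hσ]
        have h3 := hlip (t • u) 0 (t * σ) 0 (by rw [h1]; nlinarith [norm_nonneg u]) (by simpa)
          (by rw [h2]; nlinarith) (by simpa) hfr (by rw [hF0]; exact hx₀)
        rw [sub_zero, sub_zero, h1, h2] at h3
        nlinarith
    have hpre : IsPreconnected ((fun t : ℝ => F (u, t)) '' Icc (-τ) τ) :=
      isPreconnected_Icc.image _
        (hFc.comp (by fun_prop : Continuous fun t : ℝ => (u, t))).continuousOn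
    obtain ⟨z, ⟨t, ht, rfl⟩, hz⟩ := hpre.inter_frontier_nonempty_of_mem (s := Ω)
      ⟨_, ⟨-τ, ⟨le_rfl, by linarith⟩, rfl⟩,
        (hside (-τ) (by rw [abs_neg, abs_of_pos hτ0])).2 (by linarith)⟩
      ⟨_, ⟨τ, ⟨by linarith, le_rfl⟩, rfl⟩,
        fun hc => absurd ((hside τ (abs_of_pos hτ0)).1 hc) (by linarith)⟩
    exact ⟨t, (abs_le.2 ht).trans_lt hτR, hz⟩
  choose! f hfR hfS using hex
  have huniq : ∀ u : Euc d, ∀ t : ℝ, ‖u‖ < R → |t| < R → F (u, t) ∈ frontier Ω → t = f u := by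
    intro u t hu ht hfr
    have := hlip u u t (f u) hu hu ht (hfR u hu) hfr (hfS u hu)
    rw [sub_self, norm_zero] at this
    exact sub_eq_zero.1 (abs_eq_zero.1 (le_antisymm this (abs_nonneg _)))
  -- `f` was obtained by choice. Around each of its points ∂Ω is also a smooth local graph in the
  -- same frame, and uniqueness of the height identifies the two functions.
  have hloc : ∀ u : Euc d, ‖u‖ < R → ContDiffAt ℝ ∞ f u ∧
      ∀ v, inner ℝ (outwardNormal Ω (F (u, f u))) (L (graphPoint v (fderiv ℝ f u v))) = 0 := by
    intro u hu
    obtain ⟨δ, hδ, ε, hε, g, hg, hg0, hgraph⟩ := exists_local_graph hΩ (hfS u hu) L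
      (by linarith [(hνn u (f u) hu (hfR u hu) (hfS u hu)).2])
    have hgs : ContDiffAt ℝ ∞ g 0 := hg.contDiffAt (Metric.ball_mem_nhds _ hδ)
    have hgs' : ContDiffAt ℝ ∞ g (u - u) := by rwa [sub_self]
    have hsub : ContDiffAt ℝ ∞ (fun v : Euc d => v - u) u := contDiffAt_id.sub contDiffAt_const
    have hcomp : ContDiffAt ℝ ∞ (fun v => f u + g (v - u)) u :=
      contDiffAt_const.add (ContDiffAt.comp (g := g) (f := fun v => v - u) u hgs' hsub)
    have hev : f =ᶠ[𝓝 u] fun v => f u + g (v - u) := by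
      have h1 : ∀ᶠ v in 𝓝 u, ‖v‖ < R := continuous_norm.continuousAt.eventually_lt_const hu
      have h2 : ∀ᶠ v in 𝓝 u, |f u + g (v - u)| < R := by
        have : ContinuousAt (fun v => |f u + g (v - u)|) u := hcomp.continuousAt.abs
        refine this.eventually_lt_const ?_
        simp only [sub_self, hg0, add_zero]; exact hfR u hu
      have h3 : ∀ᶠ v in 𝓝 u, v - u ∈ Metric.ball (0 : Euc d) δ := by
        have : ContinuousAt (fun v => v - u) u := hsub.continuousAt
        exact this (by simp only [sub_self]; exact Metric.ball_mem_nhds _ hδ)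
      filter_upwards [h1, h2, h3] with v hv1 hv2 hv3
      refine (huniq v _ hv1 hv2 ?_).symm
      have h4 := ((hgraph _ hv3).2.1 _ (hgraph _ hv3).1).2.2 rfl
      rw [hF, frameMap_add] at h4
      simpa using h4
    refine ⟨hcomp.congr_of_eventuallyEq hev, fun v => ?_⟩
    have hD : fderiv ℝ f u = fderiv ℝ g 0 := by
      rw [hev.fderiv_eq, fderiv_const_add, fderiv_comp_sub, sub_self]
    have h5 := (hgraph 0 (Metric.mem_ball_self hδ)).2.2 v
    rw [hg0, frameMap_zero] at h5
    rw [hD]; exact h5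
  have hbn : ∀ u, u ∈ Metric.ball (0 : Euc d) R → ‖u‖ < R := fun u hu => by simpa using hu
  refine ⟨f, ⟨hR, fun u hu => (hloc u (hbn u hu)).1.contDiffWithinAt, ?_, ?_, ?_⟩, ?_⟩
  · exact (huniq 0 0 (by simpa) (by simpa) (by rw [hF0]; exact hx₀)).symm
  · intro u hu v hv
    have hu := hbn u hu
    have hv := hbn v hv
    exact hlip u v _ _ hu hv (hfR u hu) (hfR v hv) (hfS u hu) (hfS v hv)
  · intro u hu t ht
    have hu := hbn u hu
    exact ⟨fun h => huniq u t hu ht h, fun h => h ▸ hfS u hu⟩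
  · intro u hu
    have hu := hbn u hu
    exact ⟨(hνn u (f u) hu (hfR u hu) (hfS u hu)).2, (hloc u hu).2⟩

/-- Uniform parametrization of surfaces with bounded nonlocal bending energy by graphs. -/
lemma exists_uniform_graphPatch (hd : 1 ≤ d) {c s p Λ : ℝ} (hc : 0 < c) (hs : 0 < s)
    (hp : (d : ℝ) / s < p) (hΛ : 0 < Λ) :
    ∃ R > (0 : ℝ), ∃ C : ℝ, ∀ Ω : Set (Euc (d + 1)), IsSmoothBoundedDomain Ω →
      bendingEnergy c s p Ω ≤ ENNReal.ofReal Λ →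
      ∀ x₀ ∈ frontier Ω, ∃ P ∈ Matrix.specialOrthogonalGroup (Fin (d + 1)) ℝ,
        ∃ L : Euc (d + 1) ≃ₗᵢ[ℝ] Euc (d + 1), (∀ z, Matrix.toEuclideanLin P z = L z) ∧
        ∃ f : Euc d → ℝ, IsGraphPatch Ω x₀ L R f ∧
          ∀ u ∈ Metric.ball (0 : Euc d) R, ∀ v ∈ Metric.ball (0 : Euc d) R,
            ‖gradient f u - gradient f v‖ ≤ C * ‖u - v‖ ^ (s - (d : ℝ) / p) := by
  obtain ⟨R₀, hR₀, C, hC, hmain⟩ := exists_holder_normal hd hc hs hp hΛ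
  have hγ := exponent_pos hd hs hp
  set γ := s - d / p with hγdef
  -- Distances below 4R are then less than R₀ and satisfy C ρ^γ ≤ 1/4, the smallness required by
  -- `exists_isGraphPatch`.
  set R := min (R₀ / 4) ((1 / (4 * C)) ^ (1 / γ) / 4) with hR
  have hR0 : 0 < R := lt_min (by positivity) (by positivity)
  have h4R : 4 * R ≤ R₀ := by linarith [min_le_left (R₀ / 4) ((1 / (4 * C)) ^ (1 / γ) / 4)]
  have h4R' : ∀ ρ, 0 ≤ ρ → ρ < 4 * R → C * ρ ^ γ ≤ 1 / 4 := by
    intro ρ hρ hρR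
    have h1 : ρ ≤ (1 / (4 * C)) ^ (1 / γ) := by
      linarith [min_le_right (R₀ / 4) ((1 / (4 * C)) ^ (1 / γ) / 4)]
    have h2 : ρ ^ γ ≤ 1 / (4 * C) := by
      calc ρ ^ γ ≤ ((1 / (4 * C)) ^ (1 / γ)) ^ γ := Real.rpow_le_rpow hρ h1 hγ.le
        _ = _ := by rw [← Real.rpow_mul (by positivity), one_div_mul_cancel hγ.ne', Real.rpow_one]
    calc C * ρ ^ γ ≤ C * (1 / (4 * C)) := by gcongr
      _ = 1 / 4 := by field_simp
  refine ⟨R, hR0, 3 * C * 2 ^ γ, fun Ω hΩ hE x₀ hx₀ => ?_⟩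
  obtain ⟨P, hP, L, hPL, hL⟩ := exists_rotation hd _ (hΩ.norm_outwardNormal hx₀)
  have hn : ∀ y ∈ frontier Ω, ∀ y' ∈ frontier Ω, ‖y - y'‖ < 4 * R →
      ‖outwardNormal Ω y - outwardNormal Ω y'‖ ≤ 1 / 4 := fun y hy y' hy' h =>
    ((hmain Ω hΩ hE y hy y' hy' (h.trans_le h4R)).1).trans (h4R' _ (norm_nonneg _) h)
  have hflat : ∀ y ∈ frontier Ω, ∀ y' ∈ frontier Ω, ‖y - y'‖ < 4 * R →
      |inner ℝ (y - y') (outwardNormal Ω y)| ≤ 1 / 4 * ‖y - y'‖ := fun y hy y' hy' h =>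
    ((hmain Ω hΩ hE y hy y' hy' (h.trans_le h4R)).2).trans
      (mul_le_mul_of_nonneg_right (h4R' _ (norm_nonneg _) h) (norm_nonneg _))
  obtain ⟨f, hf, hfn⟩ := exists_isGraphPatch hΩ hx₀ hL hR0 hn hflat
  refine ⟨P, hP, L, hPL, f, hf, fun u hu v hv => ?_⟩
  have hfr : ∀ u ∈ Metric.ball (0 : Euc d) R, frameMap x₀ L (u, f u) ∈ frontier Ω := fun u hu =>
    (hf.mem_iff u hu _ (hf.abs_lt hu)).2 rfl
  set N : Euc d → Euc (d + 1) := fun u => outwardNormal Ω (frameMap x₀ L (u, f u)) with hN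
  have hdistuv : ‖frameMap x₀ L (u, f u) - frameMap x₀ L (v, f v)‖ ≤ 2 * ‖u - v‖ := by
    rw [norm_frameMap_sub]
    refine (norm_graphPoint_le _ _).trans ?_
    have := hf.lipschitz u hu v hv
    simp only
    linarith
  have hlt : ‖frameMap x₀ L (u, f u) - frameMap x₀ L (v, f v)‖ < R₀ := by
    have h1 := norm_sub_le u v
    rw [mem_ball_zero_iff] at hu hv
    linarith
  have hNuv : ‖N u - N v‖ ≤ C * 2 ^ γ * ‖u - v‖ ^ γ := by
    refine ((hmain Ω hΩ hE _ (hfr u hu) _ (hfr v hv) hlt).1).trans ?_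
    rw [mul_assoc, ← Real.mul_rpow (by norm_num) (norm_nonneg _)]
    have := Real.rpow_le_rpow (norm_nonneg _) hdistuv hγ.le
    gcongr
  have hfv : ‖fderiv ℝ f v‖ ≤ 1 := by
    have hl : LipschitzOnWith 1 f (Metric.ball (0 : Euc d) R) :=
      LipschitzOnWith.of_dist_le_mul fun a ha b hb => by
        simpa [Real.dist_eq, dist_eq_norm] using hf.lipschitz a ha b hb
    simpa using norm_fderiv_le_of_lipschitzOn ℝ (Metric.isOpen_ball.mem_nhds hv) hl
  have hgrad : ‖gradient f u - gradient f v‖ = ‖fderiv ℝ f u - fderiv ℝ f v‖ := by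
    rw [gradient, gradient, ← map_sub, LinearIsometryEquiv.norm_map]
  rw [hgrad]
  refine (ContinuousLinearMap.opNorm_le_bound _ (M := 3 * ‖N u - N v‖) (by positivity)
    fun w => ?_).trans (by linarith)
  obtain ⟨hu1, hu2⟩ := hfn u hu
  obtain ⟨hv1, hv2⟩ := hfn v hv
  have hLn : ‖L (lastVec d)‖ = 1 := by rw [LinearIsometryEquiv.norm_map, norm_lastVec]
  have hsplit : ∀ t : ℝ, L (graphPoint w t) = L (graphPoint w 0) + t • L (lastVec d) := by
    intro t
    rw [lastVec, ← map_smul, ← graphPoint_smul, ← map_add, ← graphPoint_add]; simp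
  have ku := hu2 w
  have kv := hv2 w
  rw [hsplit, inner_add_right, real_inner_smul_right] at ku kv
  rw [_root_.sub_apply, Real.norm_eq_abs]
  set a := fderiv ℝ f u w
  set b := fderiv ℝ f v w with hb
  have hb1 : |b| ≤ ‖w‖ := by
    have := (fderiv ℝ f v).le_opNorm w
    rw [Real.norm_eq_abs] at this
    exact this.trans (mul_le_of_le_one_left (norm_nonneg _) hfv)
  -- Difference of the tangency relations at u and v. The vertical component of N u is at least 3/4
  -- and |b| ≤ ‖w‖, so |a − b| ≤ (8/3) ‖N u − N v‖ ‖w‖.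
  have e : (a - b) * inner ℝ (N u) (L (lastVec d)) =
      -(inner ℝ (N u - N v) (L (graphPoint w 0))) -
        b * inner ℝ (N u - N v) (L (lastVec d)) := by
    simp only [inner_sub_left]
    linear_combination ku - kv
  have h1 : |inner ℝ (N u - N v) (L (graphPoint w 0))| ≤ ‖N u - N v‖ * ‖w‖ := by
    refine (abs_real_inner_le_norm _ _).trans ?_
    rw [LinearIsometryEquiv.norm_map]
    have := norm_graphPoint_le w 0
    rw [abs_zero, add_zero] at this
    gcongr
  have h2 : |b * inner ℝ (N u - N v) (L (lastVec d))| ≤ ‖N u - N v‖ * ‖w‖ := by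
    rw [abs_mul, mul_comm]
    have := abs_real_inner_le_norm (N u - N v) (L (lastVec d))
    rw [hLn, mul_one] at this
    gcongr
  have h3 : |a - b| * (3 / 4) ≤ |(a - b) * inner ℝ (N u) (L (lastVec d))| := by
    rw [abs_mul]
    exact mul_le_mul_of_nonneg_left (hu1.trans (le_abs_self _)) (abs_nonneg _)
  rw [e] at h3
  have h4 := abs_sub (-(inner ℝ (N u - N v) (L (graphPoint w 0))))
    (b * inner ℝ (N u - N v) (L (lastVec d)))
  rw [abs_neg] at h4
  have h5 : 0 ≤ ‖N u - N v‖ * ‖w‖ := by positivity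
  nlinarith

end Patch
end

/-! ### Fractional Sobolev inequality on lower regular sets. -/

noncomputable section

lemma IsSmoothBoundedDomain.nonempty_frontier {d : ℕ} {Ω : Set (Euc (d + 1))}
    (hΩ : IsSmoothBoundedDomain Ω) : (frontier Ω).Nonempty := by
  obtain ⟨x, hx⟩ := hΩ.nonempty
  have hne : Ω ≠ univ := fun h => NormedSpace.unbounded_univ ℝ (Euc (d + 1)) (h ▸ hΩ.bounded)
  obtain ⟨y, hy⟩ := (ne_univ_iff_exists_notMem Ω).1 hne
  obtain ⟨z, -, hz⟩ := isPreconnected_univ.inter_frontier_nonempty_of_mem (s := Ω)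
    ⟨x, mem_univ x, hx⟩ ⟨y, mem_univ y, hy⟩
  exact ⟨z, hz⟩

section Fractional
variable {m : ℕ} {σ : Measure (Euc m)} {S : Set (Euc m)}

/-- `σ` is concentrated on `S` and satisfies a lower `d`-dimensional density bound at the points of
`S`. -/
structure IsLowerRegular (σ : Measure (Euc m)) (S : Set (Euc m)) (d : ℕ) (c R : ℝ) : Prop where
  ae_mem : ∀ᵐ x ∂σ, x ∈ S
  le_measure_ball : ∀ x ∈ S, ∀ r, 0 < r → r < R → ENNReal.ofReal (c * r ^ d) ≤ σ (Metric.ball x r)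

/-- The inner integral of the Gagliardo seminorm with exponents `q` and `t`. -/
def gagliardoDensity (σ : Measure (Euc m)) (t q : ℝ) (f : Euc m → ℝ) (x : Euc m) : ℝ≥0∞ :=
  ∫⁻ y, ENNReal.ofReal (|f x - f y| ^ q / ‖x - y‖ ^ t) ∂σ

lemma aemeasurable_gagliardo {f : Euc m → ℝ} (hf : AEMeasurable f σ) (t q : ℝ) (x : Euc m) :
    AEMeasurable (fun y => ENNReal.ofReal (|f x - f y| ^ q / ‖x - y‖ ^ t)) σ := by
  have h1 : AEMeasurable (fun y => |f x - f y|) σ :=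
    (hf.const_sub (f x)).norm
  have h2 : Measurable (fun y : Euc m => ‖x - y‖ ^ t) := by fun_prop
  exact ((h1.pow_const q).div h2.aemeasurable).ennreal_ofReal

lemma aemeasurable_gagliardoDensity [SFinite σ] {f : Euc m → ℝ} (hf : AEMeasurable f σ) (t q : ℝ) :
    AEMeasurable (gagliardoDensity σ t q f) σ := by
  have h1 : AEMeasurable (fun z : Euc m × Euc m => f z.1) (σ.prod σ) :=
    hf.comp_quasiMeasurePreserving Measure.quasiMeasurePreserving_fst
  have h2 : AEMeasurable (fun z : Euc m × Euc m => f z.2) (σ.prod σ) :=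
    hf.comp_quasiMeasurePreserving Measure.quasiMeasurePreserving_snd
  have h3 : Measurable (fun z : Euc m × Euc m => ‖z.1 - z.2‖ ^ t) := by fun_prop
  have h4 : AEMeasurable (fun z : Euc m × Euc m =>
      ENNReal.ofReal (|f z.1 - f z.2| ^ q / ‖z.1 - z.2‖ ^ t)) (σ.prod σ) :=
    (((h1.sub h2).norm.pow_const q).div h3.aemeasurable).ennreal_ofReal
  exact h4.lintegral_prod_right'

/-- A form of Markov's inequality. -/
lemma measure_mul_lintegral_lt_le {X : Type*} [MeasurableSpace X] {μ : Measure X} {h : X → ℝ≥0∞}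
    (hm : AEMeasurable h μ) (hfin : ∫⁻ x, h x ∂μ ≠ ⊤) {k : ℝ≥0∞} (hk : k ≠ 0) (hk' : k ≠ ⊤) :
    μ {x | k * ∫⁻ x, h x ∂μ < h x} ≤ k⁻¹ := by
  -- If the integral vanishes, the set is {h > 0}, which is null; the strict inequality in the set
  -- is what keeps this case true.
  rcases eq_or_ne (∫⁻ x, h x ∂μ) 0 with h0 | h0
  · have h1 := (lintegral_eq_zero_iff' hm).1 h0
    have : μ {x | k * ∫⁻ x, h x ∂μ < h x} = 0 := by
      rw [h0]
      refine measure_mono_null (fun x hx => ?_) (ae_iff.1 h1)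
      simp only [mul_zero, mem_ofPred_eq] at hx ⊢
      exact hx.ne'
    rw [this]; exact zero_le
  · calc μ {x | k * ∫⁻ x, h x ∂μ < h x} ≤ μ {x | k * ∫⁻ x, h x ∂μ ≤ h x} :=
          measure_mono fun x hx => by
            rw [mem_ofPred_eq] at hx ⊢; exact hx.le
      _ ≤ (∫⁻ x, h x ∂μ) / (k * ∫⁻ x, h x ∂μ) :=
          meas_ge_le_lintegral_div hm (mul_ne_zero hk h0) (ENNReal.mul_ne_top hk' hfin)
      _ = k⁻¹ := by
          rw [ENNReal.div_eq_inv_mul, ENNReal.mul_inv (Or.inl hk) (Or.inl hk'), mul_assoc,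
            ENNReal.inv_mul_cancel h0 hfin, mul_one]

/-- In a ball there is a point at which finitely many functions are simultaneously controlled by
their integrals. -/
lemma IsLowerRegular.exists_forall_le {d : ℕ} {c R : ℝ} (hσ : IsLowerRegular σ S d c R) (hc : 0 < c)
    {n : ℕ} (h : Fin n → Euc m → ℝ≥0∞) (hm : ∀ i, AEMeasurable (h i) σ)
    (hfin : ∀ i, ∫⁻ x, h i x ∂σ ≠ ⊤) {x : Euc m} (hx : x ∈ S) {r : ℝ} (hr : 0 < r) (hrR : r < R) :
    ∃ y ∈ S, y ∈ Metric.ball x r ∧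
      ∀ i, h i y ≤ ENNReal.ofReal (2 * n / (c * r ^ d)) * ∫⁻ x, h i x ∂σ := by
  have hcr : 0 < c * r ^ d := by positivity
  by_contra hcon
  push Not at hcon
  rcases Nat.eq_zero_or_pos n with rfl | hn
  · obtain ⟨i, -⟩ := hcon x hx (Metric.mem_ball_self hr)
    exact i.elim0
  have hn' : (0 : ℝ) < n := by exact_mod_cast hn
  -- Each of the n exceptional sets has measure at most 1/k = c r^d/(2n), so together they cannot
  -- fill the ball.
  set k := ENNReal.ofReal (2 * n / (c * r ^ d)) with hk
  have hk0 : k ≠ 0 := by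
    rw [hk, Ne, ENNReal.ofReal_eq_zero, not_le]; positivity
  have hsub : ∀ᵐ y ∂σ, y ∈ Metric.ball x r → y ∈ ⋃ i, {y | k * ∫⁻ x, h i x ∂σ < h i y} := by
    filter_upwards [hσ.ae_mem] with y hy hyb
    obtain ⟨i, hi⟩ := hcon y hy hyb
    exact mem_iUnion.2 ⟨i, hi⟩
  have h1 : σ (Metric.ball x r) ≤ ENNReal.ofReal (c * r ^ d / 2) := by
    calc σ (Metric.ball x r) ≤ σ (⋃ i, {y | k * ∫⁻ x, h i x ∂σ < h i y}) := measure_mono_ae hsub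
      _ ≤ ∑ i, σ {y | k * ∫⁻ x, h i x ∂σ < h i y} := measure_iUnion_fintype_le _ _
      _ ≤ ∑ _i : Fin n, k⁻¹ := Finset.sum_le_sum fun i _ =>
          measure_mul_lintegral_lt_le (hm i) (hfin i) hk0 ENNReal.ofReal_ne_top
      _ = ENNReal.ofReal (c * r ^ d / 2) := by
          rw [hk, ← ENNReal.ofReal_inv_of_pos (by positivity), Finset.sum_const, Finset.card_univ,
            Fintype.card_fin, nsmul_eq_mul, ← ENNReal.ofReal_natCast,
            ← ENNReal.ofReal_mul hn'.le]
          congr 1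
          field_simp
  have h2 := (hσ.le_measure_ball x hx r hr hrR).trans h1
  rw [ENNReal.ofReal_le_ofReal_iff (by positivity)] at h2
  linarith

/-- The optimization over the radius in the proof of the Sobolev inequality. -/
lemma rpow_le_of_forall_radius {d : ℕ} (hd : 1 ≤ d) {c R q θ lam M G : ℝ} (hc : 0 < c) (hR : 0 < R)
    (hθ0 : 0 < θ) (hθ1 : θ < 1) (hl : 0 < lam) (hM : 0 < M) (hG : 0 ≤ G)
    (h : ∀ r, 0 < r → r < R → c * r ^ d ≤
      r ^ ((d : ℝ) + θ * d) / lam ^ q * G + M / lam ^ (q / (1 - θ))) :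
    lam ^ (q / (1 - θ)) ≤
      ((2 / c) ^ (1 + θ) + (2 / (c * R ^ d)) ^ θ) * M ^ θ * (G + lam ^ q) := by
  have hd0 : (0 : ℝ) < d := by exact_mod_cast hd
  have h1θ : 0 < 1 - θ := by linarith
  set k := q / (1 - θ) with hk
  have hkq : k = k * θ + q := by rw [hk]; field_simp; ring
  have hsplit : lam ^ k = (lam ^ k) ^ θ * lam ^ q := by
    rw [← Real.rpow_mul hl.le, ← Real.rpow_add hl, ← hkq]
  have hlk : 0 < lam ^ k := by positivity
  have hlq : 0 < lam ^ q := by positivity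
  have hMθ : 0 < M ^ θ := by positivity
  -- The radius with ρ^d = B makes M / lam ^ k equal to half of c ρ^d, which absorbs that term. If ρ
  -- ≥ R, this radius is not admissible, but then lam ^ k ≤ 2M/(c R^d) already suffices.
  set B := 2 * M / (c * lam ^ k) with hB
  have hB0 : 0 < B := by positivity
  set ρ := B ^ (1 / (d : ℝ)) with hρ
  have hρ0 : 0 < ρ := by positivity
  have hρd : ρ ^ d = B := by
    rw [hρ, ← Real.rpow_natCast, ← Real.rpow_mul hB0.le, one_div_mul_cancel hd0.ne', Real.rpow_one]
  rcases lt_or_ge ρ R with hlt | hge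
  · have h1 := h ρ hρ0 hlt
    have e1 : ρ ^ ((d : ℝ) + θ * d) = B * B ^ θ := by
      rw [Real.rpow_add hρ0, Real.rpow_natCast, hρd, mul_comm θ, Real.rpow_mul hρ0.le,
        Real.rpow_natCast, hρd]
    rw [e1, hρd] at h1
    have e2 : M / lam ^ k = c * B / 2 := by rw [hB]; field_simp
    rw [e2] at h1
    have h2 : c / 2 * lam ^ q ≤ B ^ θ * G := by
      have h3 : B * (c / 2 * lam ^ q) ≤ B * (B ^ θ * G) := by
        have h4 : c * B / 2 ≤ B * B ^ θ / lam ^ q * G := by linarith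
        calc B * (c / 2 * lam ^ q) = c * B / 2 * lam ^ q := by ring
          _ ≤ B * B ^ θ / lam ^ q * G * lam ^ q := by gcongr
          _ = B * (B ^ θ * G) := by field_simp
      exact le_of_mul_le_mul_left h3 hB0
    have e3 : B ^ θ * (lam ^ k) ^ θ = (2 / c) ^ θ * M ^ θ := by
      rw [← Real.mul_rpow hB0.le hlk.le, ← Real.mul_rpow (by positivity) hM.le, hB]
      congr 1; field_simp
    have h3 : lam ^ k ≤ (2 / c) ^ (1 + θ) * M ^ θ * G := by
      calc lam ^ k = (2 / c) * ((lam ^ k) ^ θ * (c / 2 * lam ^ q)) := by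
            nth_rewrite 1 [hsplit]; field_simp
        _ ≤ (2 / c) * ((lam ^ k) ^ θ * (B ^ θ * G)) := by gcongr
        _ = (2 / c) * ((B ^ θ * (lam ^ k) ^ θ) * G) := by ring
        _ = (2 / c) ^ (1 + θ) * M ^ θ * G := by
            rw [e3, Real.rpow_add (by positivity), Real.rpow_one]; ring
    refine h3.trans ?_
    gcongr
    · exact le_add_of_nonneg_right (by positivity)
    · linarith
  · have h1 : R ^ d ≤ B := by rw [← hρd]; gcongr
    have h2 : lam ^ k ≤ 2 / (c * R ^ d) * M := by
      rw [hB, le_div_iff₀ (by positivity)] at h1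
      rw [div_mul_eq_mul_div, le_div_iff₀ (by positivity)]
      linarith
    rw [hsplit]
    calc (lam ^ k) ^ θ * lam ^ q ≤ (2 / (c * R ^ d) * M) ^ θ * lam ^ q := by gcongr
      _ = (2 / (c * R ^ d)) ^ θ * M ^ θ * lam ^ q := by
          rw [Real.mul_rpow (by positivity) hM.le]
      _ ≤ _ := by
          gcongr
          · exact le_add_of_nonneg_left (by positivity)
          · linarith

/-- Pointwise form of the fractional Sobolev inequality. -/
lemma IsLowerRegular.enorm_rpow_le {d : ℕ} (hd : 1 ≤ d) {c R : ℝ} (hσ : IsLowerRegular σ S d c R)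
    (hc : 0 < c) (hR : 0 < R) {q θ : ℝ} (hq : 0 < q) (hθ0 : 0 < θ) (hθ1 : θ < 1) {f : Euc m → ℝ}
    (hf : AEMeasurable f σ) (h0 : ∫⁻ x, ‖f x‖ₑ ^ (q / (1 - θ)) ∂σ ≠ 0)
    (hfin : ∫⁻ x, ‖f x‖ₑ ^ (q / (1 - θ)) ∂σ ≠ ⊤) {x : Euc m} (hx : x ∈ S) :
    ‖f x‖ₑ ^ (q / (1 - θ)) ≤
      ENNReal.ofReal (2 ^ (q / (1 - θ)) * ((2 / c) ^ (1 + θ) + (2 / (c * R ^ d)) ^ θ)) *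
        (∫⁻ x, ‖f x‖ₑ ^ (q / (1 - θ)) ∂σ) ^ θ *
        (gagliardoDensity σ ((d : ℝ) + θ * d) q f x + ‖f x‖ₑ ^ q) := by
  set k := q / (1 - θ) with hk
  have hk0 : 0 < k := div_pos hq (by linarith)
  set M := ∫⁻ x, ‖f x‖ₑ ^ k ∂σ with hM
  set t := (d : ℝ) + θ * d with ht
  have ht0 : 0 < t := by positivity
  set C := (2 / c) ^ (1 + θ) + (2 / (c * R ^ d)) ^ θ with hC
  have hC0 : 0 < C := by positivity
  rcases eq_or_ne (f x) 0 with hfx | hfx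
  · rw [hfx, enorm_zero, ENNReal.zero_rpow_of_pos hk0]; exact zero_le
  rcases eq_or_ne (gagliardoDensity σ t q f x) ⊤ with hG | hG
  · rw [hG, top_add, ENNReal.mul_top]
    · exact le_top
    · refine mul_ne_zero ?_ ?_
      · rw [Ne, ENNReal.ofReal_eq_zero, not_le]; positivity
      · exact fun h => h0 ((ENNReal.rpow_eq_zero_iff_of_pos hθ0).1 h)
  -- Each y in the ball has |f y| ≥ lam or |f x − f y| ≥ lam. Chebyshev's inequality for the two
  -- alternatives, against the lower density bound, gives the inequality to be optimized in r.
  set lam := |f x| / 2 with hlam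
  have hl : 0 < lam := by positivity
  have key : ∀ r, 0 < r → r < R → c * r ^ d ≤
      r ^ t / lam ^ q * (gagliardoDensity σ t q f x).toReal + M.toReal / lam ^ k := by
    intro r hr hrR
    set A₁ := {y | ENNReal.ofReal (lam ^ q / r ^ t) ≤
      ENNReal.ofReal (|f x - f y| ^ q / ‖x - y‖ ^ t)} with hA₁
    set A₂ := {y | ENNReal.ofReal (lam ^ k) ≤ ‖f y‖ₑ ^ k} with hA₂
    have hsub : Metric.ball x r ⊆ A₁ ∪ A₂ := by
      intro y hy
      rw [Metric.mem_ball, dist_comm, dist_eq_norm] at hy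
      rcases le_or_gt lam |f y| with h | h
      · right
        rw [hA₂, mem_ofPred_eq, ← ofReal_norm, ENNReal.ofReal_rpow_of_nonneg (norm_nonneg _) hk0.le]
        exact ENNReal.ofReal_le_ofReal (Real.rpow_le_rpow hl.le h hk0.le)
      · left
        have h1 : lam ≤ |f x - f y| := by
          have := abs_sub_abs_le_abs_sub (f x) (f y)
          have : |f x| = 2 * lam := by rw [hlam]; ring
          linarith
        have hxy : x ≠ y := by
          rintro rfl
          rw [sub_self, abs_zero] at h1; linarith
        have h2 : 0 < ‖x - y‖ := norm_pos_iff.2 (sub_ne_zero.2 hxy)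
        refine ENNReal.ofReal_le_ofReal ?_
        exact div_le_div₀ (by positivity) (Real.rpow_le_rpow hl.le h1 hq.le) (by positivity)
          (Real.rpow_le_rpow h2.le hy.le ht0.le)
    have m1 := meas_ge_le_lintegral_div (aemeasurable_gagliardo hf t q x)
      (ε := ENNReal.ofReal (lam ^ q / r ^ t))
      (by rw [Ne, ENNReal.ofReal_eq_zero, not_le]; positivity) ENNReal.ofReal_ne_top
    have m2 := meas_ge_le_lintegral_div (μ := σ) (hf.enorm.pow_const k)
      (ε := ENNReal.ofReal (lam ^ k))
      (by rw [Ne, ENNReal.ofReal_eq_zero, not_le]; positivity) ENNReal.ofReal_ne_top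
    have h3 := (hσ.le_measure_ball x hx r hr hrR).trans
      ((measure_mono hsub).trans ((measure_union_le A₁ A₂).trans (add_le_add m1 m2)))
    change _ ≤ gagliardoDensity σ t q f x / _ + M / _ at h3
    rw [← ENNReal.ofReal_toReal hG, ← ENNReal.ofReal_toReal hfin,
      ← ENNReal.ofReal_div_of_pos (by positivity), ← ENNReal.ofReal_div_of_pos (by positivity),
      ← ENNReal.ofReal_add (by positivity) (by positivity),
      ENNReal.ofReal_le_ofReal_iff (by positivity)] at h3
    refine h3.trans_eq ?_
    congr 1
    rw [div_div_eq_mul_div]; ring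
  have hfinal := rpow_le_of_forall_radius hd hc hR hθ0 hθ1 hl (ENNReal.toReal_pos h0 hfin)
    ENNReal.toReal_nonneg key
  rw [← hk, ← hC] at hfinal
  have hfx2 : |f x| = 2 * lam := by rw [hlam]; ring
  rw [← ofReal_norm, Real.norm_eq_abs, ENNReal.ofReal_rpow_of_nonneg (abs_nonneg _) hk0.le,
    ENNReal.ofReal_rpow_of_nonneg (abs_nonneg _) hq.le, ← ENNReal.ofReal_toReal hfin,
    ← ENNReal.ofReal_toReal hG, ENNReal.ofReal_rpow_of_nonneg ENNReal.toReal_nonneg hθ0.le,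
    ← ENNReal.ofReal_add ENNReal.toReal_nonneg (by positivity), ← ENNReal.ofReal_mul (by positivity),
    ← ENNReal.ofReal_mul (by positivity)]
  refine ENNReal.ofReal_le_ofReal ?_
  calc |f x| ^ k = 2 ^ k * lam ^ k := by rw [hfx2, Real.mul_rpow (by norm_num) hl.le]
    _ ≤ 2 ^ k * (C * M.toReal ^ θ * ((gagliardoDensity σ t q f x).toReal + lam ^ q)) := by gcongr
    _ ≤ 2 ^ k * (C * M.toReal ^ θ * ((gagliardoDensity σ t q f x).toReal + |f x| ^ q)) := by
        gcongr; linarith [abs_nonneg (f x)]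
    _ = _ := by ring

end Fractional
end

noncomputable section

section FractionalSobolev
variable {m : ℕ} {σ : Measure (Euc m)} {S : Set (Euc m)}

/-- Truncation of a real number at height `k`. -/
def truncate (k t : ℝ) : ℝ := max (min t k) (-k)

lemma continuous_truncate (k : ℝ) : Continuous (truncate k) := by unfold truncate; fun_prop

lemma abs_truncate {k : ℝ} (hk : 0 ≤ k) (t : ℝ) : |truncate k t| = min |t| k := by
  unfold truncate
  rcases le_total 0 t with h | h
  · rw [abs_of_nonneg h, max_eq_left (by rw [le_min_iff]; constructor <;> linarith), abs_of_nonneg]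
    exact le_min h hk
  · rw [abs_of_nonpos h, min_eq_left (h.trans hk), abs_of_nonpos (max_le h (by linarith)),
      ← min_neg_neg, neg_neg]

lemma abs_truncate_sub_le (k t s : ℝ) : |truncate k t - truncate k s| ≤ |t - s| := by
  unfold truncate
  refine (abs_max_sub_max_le_abs _ _ _).trans ((abs_min_sub_min_le_max _ _ _ _).trans ?_)
  simp

lemma gagliardoDensity_truncate_le {q : ℝ} (hq : 0 < q) (t k : ℝ) (f : Euc m → ℝ) (x : Euc m) :
    gagliardoDensity σ t q (fun y => truncate k (f y)) x ≤ gagliardoDensity σ t q f x := by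
  refine lintegral_mono fun y => ENNReal.ofReal_le_ofReal ?_
  have := Real.rpow_le_rpow (abs_nonneg _) (abs_truncate_sub_le k (f x) (f y)) hq.le
  gcongr

/-- The constant of the fractional Sobolev inequality. -/
def fractionalConst (d : ℕ) (c R q θ : ℝ) : ℝ≥0∞ :=
  ENNReal.ofReal (2 ^ (q / (1 - θ)) * ((2 / c) ^ (1 + θ) + (2 / (c * R ^ d)) ^ θ))

/-- Integrating the pointwise bound gives M ≤ C M^θ (…), from which M^θ is cancelled; finiteness of
M is essential for that. -/
lemma IsLowerRegular.lintegral_rpow_le_of_ne_top {d : ℕ} (hd : 1 ≤ d) {c R : ℝ}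
    (hσ : IsLowerRegular σ S d c R) (hc : 0 < c) (hR : 0 < R) {q θ : ℝ} (hq : 0 < q) (hθ0 : 0 < θ)
    (hθ1 : θ < 1) {f : Euc m → ℝ} (hf : AEMeasurable f σ)
    (hfin : ∫⁻ x, ‖f x‖ₑ ^ (q / (1 - θ)) ∂σ ≠ ⊤) :
    (∫⁻ x, ‖f x‖ₑ ^ (q / (1 - θ)) ∂σ) ^ (1 - θ) ≤ fractionalConst d c R q θ *
      (∫⁻ x, gagliardoDensity σ ((d : ℝ) + θ * d) q f x ∂σ + ∫⁻ x, ‖f x‖ₑ ^ q ∂σ) := by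
  set M := ∫⁻ x, ‖f x‖ₑ ^ (q / (1 - θ)) ∂σ with hM
  rcases eq_or_ne M 0 with h0 | h0
  · rw [h0, ENNReal.zero_rpow_of_pos (by linarith)]; exact zero_le
  have hMθ0 : M ^ θ ≠ 0 := fun h => h0 ((ENNReal.rpow_eq_zero_iff_of_pos hθ0).1 h)
  have hMθ : M ^ θ ≠ ⊤ := ENNReal.rpow_ne_top_of_nonneg hθ0.le hfin
  have h1 : M ≤ fractionalConst d c R q θ * M ^ θ *
      (∫⁻ x, gagliardoDensity σ ((d : ℝ) + θ * d) q f x ∂σ + ∫⁻ x, ‖f x‖ₑ ^ q ∂σ) := by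
    rw [← lintegral_add_right' _ (hf.enorm.pow_const q),
      ← lintegral_const_mul' _ _ (ENNReal.mul_ne_top (a := fractionalConst d c R q θ) ENNReal.ofReal_ne_top hMθ)]
    refine lintegral_mono_ae ?_
    filter_upwards [hσ.ae_mem] with x hx
    exact hσ.enorm_rpow_le hd hc hR hq hθ0 hθ1 hf h0 hfin hx
  have h2 : M = M ^ θ * M ^ (1 - θ) := by
    rw [← ENNReal.rpow_add _ _ h0 hfin]; simp
  nth_rewrite 1 [h2] at h1
  rw [mul_comm (fractionalConst d c R q θ), mul_assoc] at h1
  exact (ENNReal.mul_le_mul_iff_right hMθ0 hMθ).1 h1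

/-- The a priori finiteness is removed by truncation: |u n|^k ≤ n^(k−q) |f|^q is integrable,
truncation does not increase the Gagliardo density, and monotone convergence passes to the limit. -/
lemma IsLowerRegular.lintegral_rpow_le {d : ℕ} (hd : 1 ≤ d) {c R : ℝ}
    (hσ : IsLowerRegular σ S d c R) (hc : 0 < c) (hR : 0 < R) {q θ : ℝ} (hq : 0 < q) (hθ0 : 0 < θ)
    (hθ1 : θ < 1) {f : Euc m → ℝ} (hf : AEMeasurable f σ) (hfin : ∫⁻ x, ‖f x‖ₑ ^ q ∂σ ≠ ⊤) :
    (∫⁻ x, ‖f x‖ₑ ^ (q / (1 - θ)) ∂σ) ^ (1 - θ) ≤ fractionalConst d c R q θ *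
      (∫⁻ x, gagliardoDensity σ ((d : ℝ) + θ * d) q f x ∂σ + ∫⁻ x, ‖f x‖ₑ ^ q ∂σ) := by
  have h1θ : 0 < 1 - θ := by linarith
  set k := q / (1 - θ) with hk
  have hk0 : 0 < k := div_pos hq h1θ
  have hkq : q ≤ k := by rw [hk, le_div_iff₀ h1θ]; nlinarith
  set u : ℕ → Euc m → ℝ := fun n x => truncate n (f x) with hu
  have hum : ∀ n, AEMeasurable (u n) σ := fun n =>
    (continuous_truncate n).measurable.comp_aemeasurable hf
  have hue : ∀ n x, ‖u n x‖ₑ = min ‖f x‖ₑ (ENNReal.ofReal n) := fun n x => by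
    rw [← ofReal_norm, Real.norm_eq_abs, abs_truncate (Nat.cast_nonneg n),
      ← ofReal_norm, Real.norm_eq_abs, ENNReal.ofReal_min]
  have hbd : ∀ n, (∫⁻ x, ‖u n x‖ₑ ^ k ∂σ) ^ (1 - θ) ≤ fractionalConst d c R q θ *
      (∫⁻ x, gagliardoDensity σ ((d : ℝ) + θ * d) q f x ∂σ + ∫⁻ x, ‖f x‖ₑ ^ q ∂σ) := by
    intro n
    refine (hσ.lintegral_rpow_le_of_ne_top hd hc hR hq hθ0 hθ1 (hum n) ?_).trans ?_
    · refine ne_top_of_le_ne_top (b := ENNReal.ofReal n ^ (k - q) * ∫⁻ x, ‖f x‖ₑ ^ q ∂σ)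
        (ENNReal.mul_ne_top (ENNReal.rpow_ne_top_of_nonneg (by linarith) ENNReal.ofReal_ne_top)
          hfin) ?_
      rw [← lintegral_const_mul' _ _
        (ENNReal.rpow_ne_top_of_nonneg (by linarith) ENNReal.ofReal_ne_top)]
      refine lintegral_mono fun x => ?_
      rw [hue, ← hk]
      calc min ‖f x‖ₑ (ENNReal.ofReal n) ^ k
          = min ‖f x‖ₑ (ENNReal.ofReal n) ^ (k - q) * min ‖f x‖ₑ (ENNReal.ofReal n) ^ q := by
            rw [← ENNReal.rpow_add_of_nonneg _ _ (by linarith) hq.le, sub_add_cancel]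
        _ ≤ _ := mul_le_mul' (ENNReal.rpow_le_rpow (min_le_right _ _) (by linarith))
            (ENNReal.rpow_le_rpow (min_le_left _ _) hq.le)
    · gcongr with x x
      · exact gagliardoDensity_truncate_le hq _ _ _ _
      · rw [hue]; exact min_le_left _ _
  have htend : Filter.Tendsto (fun n => ∫⁻ x, ‖u n x‖ₑ ^ k ∂σ) Filter.atTop
      (nhds (∫⁻ x, ‖f x‖ₑ ^ k ∂σ)) := by
    refine lintegral_tendsto_of_tendsto_of_monotone (fun n => (hum n).enorm.pow_const k)
      (Filter.Eventually.of_forall fun x a b hab => ?_) (Filter.Eventually.of_forall fun x => ?_)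
    · simp only [hue]
      gcongr
    · refine tendsto_const_nhds.congr' ?_
      filter_upwards [Filter.eventually_ge_atTop ⌈|f x|⌉₊] with n hn
      rw [hue, min_eq_left]
      rw [← ofReal_norm]
      exact ENNReal.ofReal_le_ofReal ((Nat.le_ceil _).trans (by exact_mod_cast hn))
  refine le_of_tendsto (((ENNReal.continuous_rpow_const (y := 1 - θ)).tendsto _).comp htend) ?_
  exact Filter.Eventually.of_forall hbd

/-- Fractional Sobolev inequality on lower regular sets. -/
lemma IsLowerRegular.eLpNorm_le {d : ℕ} (hd : 1 ≤ d) {c R : ℝ}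
    (hσ : IsLowerRegular σ S d c R) (hc : 0 < c) (hR : 0 < R) {q α : ℝ} (hq : 1 < q) (hα : 0 < α)
    (hqd : q < d / α) {f : Euc m → ℝ} (hf : MemLp f (ENNReal.ofReal q) σ) :
    eLpNorm f (ENNReal.ofReal (d * q / (d - α * q))) σ ≤
      fractionalConst d c R q (α * q / d) ^ (1 / q) *
        ((∫⁻ x, gagliardoDensity σ ((d : ℝ) + α * q) q f x ∂σ) ^ (1 / q) +
          eLpNorm f (ENNReal.ofReal q) σ) := by
  have hd0 : (0 : ℝ) < d := by exact_mod_cast hd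
  have hq0 : 0 < q := by linarith
  rw [lt_div_iff₀ hα] at hqd
  -- With this θ, q/(1 − θ) is the Sobolev exponent and d + θd = d + αq.
  set θ := α * q / d with hθ
  have hθ0 : 0 < θ := by positivity
  have hθ1 : θ < 1 := by rw [hθ, div_lt_one hd0]; linarith
  have h1θ : 0 < 1 - θ := by linarith
  have e1 : d * q / (d - α * q) = q / (1 - θ) := by
    rw [hθ]; field_simp
  have e2 : (d : ℝ) + α * q = d + θ * d := by rw [hθ]; field_simp
  have hfin : ∫⁻ x, ‖f x‖ₑ ^ q ∂σ ≠ ⊤ := by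
    have := lintegral_rpow_enorm_lt_top_of_eLpNorm_lt_top (by simpa using hq0)
      ENNReal.ofReal_ne_top hf.2
    rw [ENNReal.toReal_ofReal hq0.le] at this
    exact this.ne
  have h := hσ.lintegral_rpow_le hd hc hR hq0 hθ0 hθ1 hf.1.aemeasurable hfin
  have hk0 : 0 < q / (1 - θ) := by positivity
  rw [e1, e2, eLpNorm_eq_lintegral_rpow_enorm_toReal (by simpa using hk0) ENNReal.ofReal_ne_top,
    eLpNorm_eq_lintegral_rpow_enorm_toReal (by simpa using hq0) ENNReal.ofReal_ne_top,
    ENNReal.toReal_ofReal hq0.le, ENNReal.toReal_ofReal hk0.le]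
  have e3 : 1 / (q / (1 - θ)) = (1 - θ) * (1 / q) := by field_simp
  rw [e3, ENNReal.rpow_mul]
  refine (ENNReal.rpow_le_rpow h (by positivity)).trans ?_
  rw [ENNReal.mul_rpow_of_nonneg _ _ (by positivity)]
  gcongr
  exact ENNReal.rpow_add_le_add_rpow _ _ (by positivity) (by rw [div_le_one hq0]; linarith)

end FractionalSobolev

/-! ### Hölder extension and modification. -/

section HolderExtension
variable {m : ℕ}

/-- McShane extension of a bounded Hölder function. -/
lemma exists_holder_extension {D : Set (Euc m)} {f : Euc m → ℝ} {β H M : ℝ} (hβ : 0 < β)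
    (hβ1 : β ≤ 1) (hH : 0 ≤ H) (hM : ∀ x ∈ D, |f x| ≤ M)
    (hf : ∀ x ∈ D, ∀ y ∈ D, |f x - f y| ≤ H * ‖x - y‖ ^ β) :
    ∃ g : Euc m → ℝ, EqOn g f D ∧ ∀ x y, |g x - g y| ≤ H * ‖x - y‖ ^ β := by
  rcases D.eq_empty_or_nonempty with rfl | ⟨x₀, hx₀⟩
  · exact ⟨0, fun x hx => hx.elim, fun x y => by simp; positivity⟩
  have : Nonempty D := ⟨⟨x₀, hx₀⟩⟩
  -- Lower envelope of the Hölder cones over D. The bound M only makes the infimum finite; β ≤ 1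
  -- gives the subadditivity that makes the cones Hölder.
  set g : Euc m → ℝ := fun z => ⨅ x : D, (f x + H * ‖(x : Euc m) - z‖ ^ β) with hg
  have hbdd : ∀ z, BddBelow (range fun x : D => f x + H * ‖(x : Euc m) - z‖ ^ β) := by
    intro z
    refine ⟨-M, ?_⟩
    rintro _ ⟨x, rfl⟩
    have h1 := (abs_le.1 (hM x x.2)).1
    have h2 : 0 ≤ H * ‖(x : Euc m) - z‖ ^ β := by positivity
    simp only
    linarith
  have hle : ∀ x y, g x ≤ g y + H * ‖x - y‖ ^ β := by
    intro x y
    rw [← sub_le_iff_le_add]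
    refine le_ciInf fun z => ?_
    rw [sub_le_iff_le_add]
    refine (ciInf_le (hbdd x) z).trans ?_
    have h1 : ‖(z : Euc m) - x‖ ^ β ≤ ‖(z : Euc m) - y‖ ^ β + ‖x - y‖ ^ β := by
      refine le_trans (Real.rpow_le_rpow (norm_nonneg _) ?_ hβ.le)
        (Real.rpow_add_le_add_rpow (norm_nonneg _) (norm_nonneg _) hβ.le hβ1)
      rw [norm_sub_rev x y]
      exact norm_sub_le_norm_sub_add_norm_sub _ _ _
    have h2 := mul_le_mul_of_nonneg_left h1 hH
    linarith
  refine ⟨g, fun x hx => le_antisymm ?_ ?_, fun x y => ?_⟩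
  · refine (ciInf_le (hbdd x) ⟨x, hx⟩).trans ?_
    simp [Real.zero_rpow hβ.ne']
  · refine le_ciInf fun z => ?_
    have := (abs_le.1 (hf x hx z z.2)).2
    rw [norm_sub_rev] at this
    linarith
  · rw [abs_le]
    have h1 := hle x y
    have h2 := hle y x
    rw [norm_sub_rev] at h2
    constructor <;> linarith

lemma holderSeminorm_le {S : Set (Euc m)} {f : Euc m → ℝ} {β H : ℝ}
    (hf : ∀ x y, |f x - f y| ≤ H * ‖x - y‖ ^ β) : holderSeminorm β S f ≤ ENNReal.ofReal H := by
  refine iSup₂_le fun x _ => iSup₂_le fun y _ => iSup_le fun hxy => ?_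
  refine ENNReal.ofReal_le_ofReal ?_
  have : 0 < ‖x - y‖ := norm_pos_iff.2 (sub_ne_zero.2 hxy)
  rw [div_le_iff₀ (by positivity)]
  exact hf x y

/-- A function that is bounded and locally uniformly Hölder continuous on a set of full measure has a
Hölder continuous modification. -/
lemma exists_holder_modification {σ : Measure (Euc m)} {D S : Set (Euc m)} (hD : ∀ᵐ x ∂σ, x ∈ D)
    {f : Euc m → ℝ} {β δ H M : ℝ} (hβ : 0 < β) (hβ1 : β ≤ 1) (hδ : 0 < δ) (hH : 0 ≤ H) (hM0 : 0 ≤ M)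
    (hM : ∀ x ∈ D, |f x| ≤ M)
    (hf : ∀ x ∈ D, ∀ y ∈ D, ‖x - y‖ < δ → |f x - f y| ≤ H * ‖x - y‖ ^ β) :
    ∃ g : Euc m → ℝ, g =ᵐ[σ] f ∧
      eLpNorm g ⊤ σ + holderSeminorm β S g ≤ ENNReal.ofReal (H + (1 + 2 / δ ^ β) * M) := by
  -- Pairs at distance at least δ are covered by the sup bound: 2M ≤ (2M/δ^β) ‖x − y‖^β.
  have hf' : ∀ x ∈ D, ∀ y ∈ D, |f x - f y| ≤ (H + 2 / δ ^ β * M) * ‖x - y‖ ^ β := by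
    intro x hx y hy
    have hδβ : 0 < δ ^ β := by positivity
    rcases lt_or_ge ‖x - y‖ δ with h | h
    · refine (hf x hx y hy h).trans ?_
      gcongr
      exact le_add_of_nonneg_right (by positivity)
    · have h1 : |f x - f y| ≤ 2 * M := by
        have := abs_sub (f x) (f y)
        linarith [hM x hx, hM y hy]
      have h2 : δ ^ β ≤ ‖x - y‖ ^ β := Real.rpow_le_rpow hδ.le h hβ.le
      calc |f x - f y| ≤ 2 * M := h1
        _ = 2 / δ ^ β * M * δ ^ β := by field_simp
        _ ≤ (H + 2 / δ ^ β * M) * ‖x - y‖ ^ β := by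
          gcongr
          exact le_add_of_nonneg_left hH
  obtain ⟨g, hg, hgH⟩ := exists_holder_extension (H := H + 2 / δ ^ β * M) hβ hβ1 (by positivity) hM hf'
  refine ⟨g, ?_, ?_⟩
  · filter_upwards [hD] with x hx using hg hx
  · have h1 : eLpNorm g ⊤ σ ≤ ENNReal.ofReal M := by
      rw [eLpNorm_exponent_top]
      refine eLpNormEssSup_le_of_ae_bound ?_
      filter_upwards [hD] with x hx
      rw [hg hx]; exact hM x hx
    refine (add_le_add h1 (holderSeminorm_le hgH)).trans ?_
    rw [← ENNReal.ofReal_add hM0 (by positivity)]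
    refine ENNReal.ofReal_le_ofReal ?_
    linarith

end HolderExtension
end

/-! ### Fractional Morrey inequality on lower regular sets. -/

noncomputable section

section FractionalMorrey
variable {m : ℕ} {σ : Measure (Euc m)} {S : Set (Euc m)}

lemma abs_sub_le_of_gagliardo_le {f : Euc m → ℝ} {z y : Euc m} {t q κ D : ℝ} {G : ℝ≥0∞} (hq : 0 < q)
    (ht : 0 < t) (hκ : 0 ≤ κ) (hG : G ≠ ⊤) (hD : ‖z - y‖ ≤ D)
    (h : ENNReal.ofReal (|f z - f y| ^ q / ‖z - y‖ ^ t) ≤ ENNReal.ofReal κ * G) :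
    |f z - f y| ≤ (D ^ t * κ) ^ (1 / q) * G.toReal ^ (1 / q) := by
  have hD0 : 0 ≤ D := (norm_nonneg _).trans hD
  have hG0 : 0 ≤ G.toReal := ENNReal.toReal_nonneg
  rcases eq_or_ne z y with rfl | hzy
  · rw [sub_self, abs_zero]; positivity
  have hpos : 0 < ‖z - y‖ := norm_pos_iff.2 (sub_ne_zero.2 hzy)
  rw [← ENNReal.ofReal_toReal hG, ← ENNReal.ofReal_mul hκ,
    ENNReal.ofReal_le_ofReal_iff (by positivity), div_le_iff₀ (by positivity)] at h
  have h1 : |f z - f y| ^ q ≤ D ^ t * κ * G.toReal := by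
    refine h.trans ?_
    have := Real.rpow_le_rpow hpos.le hD ht.le
    calc κ * G.toReal * ‖z - y‖ ^ t ≤ κ * G.toReal * D ^ t := by gcongr
      _ = _ := by ring
  calc |f z - f y| = (|f z - f y| ^ q) ^ (1 / q) := by
        rw [← Real.rpow_mul (abs_nonneg _), mul_one_div_cancel hq.ne', Real.rpow_one]
    _ ≤ (D ^ t * κ * G.toReal) ^ (1 / q) := by gcongr
    _ = _ := Real.mul_rpow (by positivity) hG0

/-- The d in t = d + sq compensates the density ρ^d and leaves exactly ρ^s. Here 8ρ bounds the
distances, and 4 counts the functions controlled in `IsLowerRegular.exists_good_point`. -/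
lemma rpow_scale_eq {c ρ q d t s : ℝ} (hc : 0 < c) (hρ : 0 < ρ) (hq : 0 < q) (hts : t = d + s * q) :
    ((8 * ρ) ^ t * (2 * 4 / (c * ρ ^ d))) ^ (1 / q) = (8 ^ t * (8 / c)) ^ (1 / q) * ρ ^ s := by
  have e : (8 * ρ) ^ t * (2 * 4 / (c * ρ ^ d)) = (8 ^ t * (8 / c)) * (ρ ^ s) ^ q := by
    rw [Real.mul_rpow (by norm_num) hρ.le, hts, Real.rpow_add hρ d, ← Real.rpow_mul hρ.le]
    field_simp
    norm_num
  rw [e, Real.mul_rpow (by positivity) (by positivity), ← Real.rpow_mul (by positivity),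
    mul_one_div_cancel hq.ne', Real.rpow_one]

/-- Selection of a point with good properties near a given point. -/
lemma IsLowerRegular.exists_good_point [SFinite σ] {d : ℕ} {c R : ℝ}
    (hσ : IsLowerRegular σ S d c R) (hc : 0 < c) {q α : ℝ} (hq : 0 < q) (hα : 0 < α)
    {f : Euc m → ℝ} (hf : AEMeasurable f σ) (hfin : ∫⁻ x, ‖f x‖ₑ ^ q ∂σ ≠ ⊤)
    (hGfin : ∫⁻ x, gagliardoDensity σ ((d : ℝ) + α * q) q f x ∂σ ≠ ⊤)
    {x : Euc m} (hx : x ∈ S) {ρ : ℝ} (hρ : 0 < ρ) (hρR : ρ < R) {z₁ z₂ : Euc m}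
    (hz₁ : ‖z₁ - x‖ ≤ 7 * ρ) (hz₂ : ‖z₂ - x‖ ≤ 7 * ρ)
    (hG₁ : gagliardoDensity σ ((d : ℝ) + α * q) q f z₁ ≠ ⊤)
    (hG₂ : gagliardoDensity σ ((d : ℝ) + α * q) q f z₂ ≠ ⊤) :
    ∃ y ∈ S, ‖y - x‖ < ρ ∧ gagliardoDensity σ ((d : ℝ) + α * q) q f y ≠ ⊤ ∧
      |f z₁ - f y| ≤ (8 ^ ((d : ℝ) + α * q) * (8 / c)) ^ (1 / q) * ρ ^ α *
        (gagliardoDensity σ ((d : ℝ) + α * q) q f z₁).toReal ^ (1 / q) ∧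
      |f z₂ - f y| ≤ (8 ^ ((d : ℝ) + α * q) * (8 / c)) ^ (1 / q) * ρ ^ α *
        (gagliardoDensity σ ((d : ℝ) + α * q) q f z₂).toReal ^ (1 / q) ∧
      (gagliardoDensity σ ((d : ℝ) + α * q) q f y).toReal ^ (1 / q) ≤
        (8 / c) ^ (1 / q) * ρ ^ (-((d : ℝ) / q)) *
          (∫⁻ x, gagliardoDensity σ ((d : ℝ) + α * q) q f x ∂σ).toReal ^ (1 / q) ∧
      |f y| ≤ (8 / c) ^ (1 / q) * ρ ^ (-((d : ℝ) / q)) *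
        (∫⁻ x, ‖f x‖ₑ ^ q ∂σ).toReal ^ (1 / q) := by
  set t := (d : ℝ) + α * q with ht
  have ht0 : 0 < t := by positivity
  set A := ∫⁻ x, gagliardoDensity σ t q f x ∂σ with hA
  set B := ∫⁻ x, ‖f x‖ₑ ^ q ∂σ with hB
  -- The difference quotients against z₁ and z₂ integrate to the densities at z₁ and z₂, so a single
  -- selection controls both differences together with the density and the size of f at y.
  obtain ⟨y, hyS, hyb, hy⟩ := hσ.exists_forall_le hc
    ![fun y => ENNReal.ofReal (|f z₁ - f y| ^ q / ‖z₁ - y‖ ^ t),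
      fun y => ENNReal.ofReal (|f z₂ - f y| ^ q / ‖z₂ - y‖ ^ t),
      gagliardoDensity σ t q f, fun y => ‖f y‖ₑ ^ q]
    (by
      simp only [Fin.forall_fin_succ]
      exact ⟨aemeasurable_gagliardo hf t q z₁, aemeasurable_gagliardo hf t q z₂,
        aemeasurable_gagliardoDensity hf t q, hf.enorm.pow_const q, fun i => i.elim0⟩)
    (by
      simp only [Fin.forall_fin_succ]
      exact ⟨hG₁, hG₂, hGfin, hfin, fun i => i.elim0⟩) hx hρ hρR
  simp only [Fin.forall_fin_succ] at hy
  obtain ⟨h1, h2, h3, h4, -⟩ := hy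
  set κ := (2 * ((4 : ℕ) : ℝ) / (c * ρ ^ d)) with hκ
  have hκ0 : 0 ≤ κ := by positivity
  change _ ≤ ENNReal.ofReal κ * gagliardoDensity σ t q f z₁ at h1
  change _ ≤ ENNReal.ofReal κ * gagliardoDensity σ t q f z₂ at h2
  change gagliardoDensity σ t q f y ≤ ENNReal.ofReal κ * A at h3
  change ‖f y‖ₑ ^ q ≤ ENNReal.ofReal κ * B at h4
  have hyx : ‖y - x‖ < ρ := by rwa [mem_ball_iff_norm] at hyb
  have hD : ∀ z, ‖z - x‖ ≤ 7 * ρ → ‖z - y‖ ≤ 8 * ρ := by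
    intro z hz
    have := norm_sub_le_norm_sub_add_norm_sub z x y
    rw [norm_sub_rev x y] at this
    linarith
  have hscale : ((8 * ρ) ^ t * κ) ^ (1 / q) = (8 ^ t * (8 / c)) ^ (1 / q) * ρ ^ α := by
    rw [hκ, ← Real.rpow_natCast ρ d]
    exact_mod_cast rpow_scale_eq (d := d) hc hρ hq ht
  have hκq : κ ^ (1 / q) = (8 / c) ^ (1 / q) * ρ ^ (-((d : ℝ) / q)) := by
    have e : κ = (8 / c) * ρ ^ (-(d : ℝ)) := by
      rw [hκ, Real.rpow_neg hρ.le, Real.rpow_natCast]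
      push_cast
      field_simp
      norm_num
    rw [e, Real.mul_rpow (by positivity) (by positivity), ← Real.rpow_mul hρ.le]
    congr 2
    ring
  refine ⟨y, hyS, hyx, ne_top_of_le_ne_top (ENNReal.mul_ne_top ENNReal.ofReal_ne_top hGfin) h3,
    ?_, ?_, ?_, ?_⟩
  · rw [← hscale]; exact abs_sub_le_of_gagliardo_le hq ht0 hκ0 hG₁ (hD _ hz₁) h1
  · rw [← hscale]; exact abs_sub_le_of_gagliardo_le hq ht0 hκ0 hG₂ (hD _ hz₂) h2
  · rw [← hκq, ← Real.mul_rpow hκ0 ENNReal.toReal_nonneg]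
    refine Real.rpow_le_rpow ENNReal.toReal_nonneg ?_ (by positivity)
    have := ENNReal.toReal_mono (ENNReal.mul_ne_top ENNReal.ofReal_ne_top hGfin) h3
    rwa [ENNReal.toReal_mul, ENNReal.toReal_ofReal hκ0] at this
  · rw [← hκq, ← Real.mul_rpow hκ0 ENNReal.toReal_nonneg]
    have := ENNReal.toReal_mono (ENNReal.mul_ne_top ENNReal.ofReal_ne_top hfin) h4
    rw [ENNReal.toReal_mul, ENNReal.toReal_ofReal hκ0, ← ENNReal.toReal_rpow, toReal_enorm,
      Real.norm_eq_abs] at this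
    have h5 := Real.rpow_le_rpow (by positivity) this (by positivity : 0 ≤ 1 / q)
    rwa [← Real.rpow_mul (abs_nonneg _), mul_one_div_cancel hq.ne', Real.rpow_one] at h5

/-- Fractional Morrey inequality on lower regular sets. -/
lemma IsLowerRegular.exists_holder_modification {d : ℕ} {c R q α β : ℝ} (hc : 0 < c) (hR : 0 < R)
    (hq : 0 < q) (hα : 0 < α) (hβ : 0 < β) (hβ1 : β ≤ 1) (hβα : α - d / q = β) :
    ∃ C : ℝ≥0, ∀ (σ : Measure (Euc m)) (S : Set (Euc m)), SFinite σ → IsLowerRegular σ S d c R →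
      ∀ f : Euc m → ℝ, AEMeasurable f σ → ∫⁻ x, ‖f x‖ₑ ^ q ∂σ ≠ ⊤ →
      ∫⁻ x, gagliardoDensity σ ((d : ℝ) + α * q) q f x ∂σ ≠ ⊤ →
      ∃ g : Euc m → ℝ, g =ᵐ[σ] f ∧ eLpNorm g ⊤ σ + holderSeminorm β S g ≤
        C * ((∫⁻ x, gagliardoDensity σ ((d : ℝ) + α * q) q f x ∂σ) ^ (1 / q) +
          (∫⁻ x, ‖f x‖ₑ ^ q ∂σ) ^ (1 / q)) := by
  set t := (d : ℝ) + α * q with ht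
  set C₁ := (8 ^ t * (8 / c)) ^ (1 / q) with hC₁
  set C₂ := (8 / c) ^ (1 / q) with hC₂
  have hC₁0 : 0 < C₁ := by positivity
  have hC₂0 : 0 < C₂ := by positivity
  set η := ((1 : ℝ) / 2) ^ β with hη
  have hη1 : η < 1 := Real.rpow_lt_one (by norm_num) (by norm_num) hβ
  have hη1' : 0 < 1 - η := by linarith
  -- Fixed point of the recursion C₃ = C₁ C₂ + C₃ η that occurs in `hchain`.
  set C₃ := C₁ * C₂ / (1 - η) with hC₃
  have hC₃0 : 0 < C₃ := by positivity
  have hC₃e : C₁ * C₂ + C₃ * η = C₃ := by rw [hC₃]; field_simp; ring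
  set C₅ := C₃ * (R / 2) ^ β + C₂ * (R / 2) ^ (-((d : ℝ) / q)) with hC₅
  have hC₅0 : 0 < C₅ := by positivity
  have hR' : 0 < 2 / R ^ β := by positivity
  set C₄ := 2 * C₃ + (1 + 2 / R ^ β) * C₅ with hC₄
  have hC₄0 : 0 < C₄ := by positivity
  refine ⟨C₄.toNNReal, fun σ S hsf hσ f hf hfin hGfin => ?_⟩
  set G := gagliardoDensity σ t q f with hG
  set a := (∫⁻ x, G x ∂σ).toReal ^ (1 / q) with ha
  set b := (∫⁻ x, ‖f x‖ₑ ^ q ∂σ).toReal ^ (1 / q) with hb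
  have ha0 : 0 ≤ a := Real.rpow_nonneg ENNReal.toReal_nonneg _
  have hb0 : 0 ≤ b := Real.rpow_nonneg ENNReal.toReal_nonneg _
  have hg0 : ∀ x, 0 ≤ (G x).toReal ^ (1 / q) := fun x => Real.rpow_nonneg ENNReal.toReal_nonneg _
  -- Chain from y towards x through points selected at scales ρ/2, ρ/4, …. The density at x has no
  -- uniform bound, but it survives only in a remainder with factor 2^(−αn), which disappears in
  -- `hlim`.
  have hchain : ∀ x ∈ S, G x ≠ ⊤ → ∀ n : ℕ, ∀ ρ : ℝ, 0 < ρ → ρ < R → ∀ y, ‖y - x‖ ≤ 2 * ρ →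
      G y ≠ ⊤ → |f x - f y| ≤ C₁ * ρ ^ α * (G x).toReal ^ (1 / q) →
      (G y).toReal ^ (1 / q) ≤ C₂ * ρ ^ (-((d : ℝ) / q)) * a →
      |f x - f y| ≤ C₃ * ρ ^ β * a +
        C₁ * (((1 : ℝ) / 2) ^ α) ^ n * ρ ^ α * (G x).toReal ^ (1 / q) := by
    intro x hx hGx n
    induction n with
    | zero =>
      intro ρ hρ _ y _ _ h _
      rw [pow_zero, mul_one]
      have : 0 ≤ C₃ * ρ ^ β * a := by positivity
      linarith
    | succ n ih =>
      intro ρ hρ hρR y hyx hGy h1 h2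
      obtain ⟨y', hy'S, hy'x, hGy', hxy', hyy', hgy', -⟩ := hσ.exists_good_point hc hq hα hf hfin
        hGfin hx (half_pos hρ) (by linarith) (z₁ := x) (z₂ := y)
        (by rw [sub_self, norm_zero]; positivity) (by linarith) hGx hGy
      have h3 := ih (ρ / 2) (half_pos hρ) (by linarith) y' (by linarith) hGy' hxy' hgy'
      have h4 : |f x - f y| ≤ |f x - f y'| + |f y - f y'| := by
        rw [abs_sub_comm (f y)]
        exact abs_sub_le _ _ _
      have e1 : (ρ / 2) ^ β = η * ρ ^ β := by
        rw [hη, ← Real.mul_rpow (by norm_num) hρ.le]; congr 1; ring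
      have e2 : (ρ / 2) ^ α = ((1 : ℝ) / 2) ^ α * ρ ^ α := by
        rw [← Real.mul_rpow (by norm_num) hρ.le]; congr 1; ring
      have e3 : ρ ^ β = ρ ^ α * ρ ^ (-((d : ℝ) / q)) := by
        rw [← Real.rpow_add hρ, ← hβα]; congr 1
      have h5 : |f y - f y'| ≤ C₁ * C₂ * ρ ^ β * a := by
        calc |f y - f y'| ≤ C₁ * (ρ / 2) ^ α * (G y).toReal ^ (1 / q) := hyy'
          _ ≤ C₁ * ρ ^ α * (C₂ * ρ ^ (-((d : ℝ) / q)) * a) := by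
              have := Real.rpow_le_rpow (half_pos hρ).le (half_le_self hρ.le) hα.le
              have := hg0 y
              gcongr
          _ = _ := by rw [e3]; ring
      rw [e1, e2] at h3
      calc |f x - f y| ≤ _ := h4.trans (add_le_add h3 h5)
        _ = (C₁ * C₂ + C₃ * η) * ρ ^ β * a +
            C₁ * (((1 : ℝ) / 2) ^ α) ^ (n + 1) * ρ ^ α * (G x).toReal ^ (1 / q) := by ring
        _ = _ := by rw [hC₃e]
  have hlim : ∀ x ∈ S, G x ≠ ⊤ → ∀ ρ : ℝ, 0 < ρ → ρ < R → ∀ y, ‖y - x‖ ≤ 2 * ρ →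
      G y ≠ ⊤ → |f x - f y| ≤ C₁ * ρ ^ α * (G x).toReal ^ (1 / q) →
      (G y).toReal ^ (1 / q) ≤ C₂ * ρ ^ (-((d : ℝ) / q)) * a →
      |f x - f y| ≤ C₃ * ρ ^ β * a := by
    intro x hx hGx ρ hρ hρR y h1 h2 h3 h4
    have hz : Filter.Tendsto (fun n : ℕ => C₃ * ρ ^ β * a +
        C₁ * (((1 : ℝ) / 2) ^ α) ^ n * ρ ^ α * (G x).toReal ^ (1 / q)) Filter.atTop
        (nhds (C₃ * ρ ^ β * a + C₁ * 0 * ρ ^ α * (G x).toReal ^ (1 / q))) := by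
      have hp : Filter.Tendsto (fun n : ℕ => (((1 : ℝ) / 2) ^ α) ^ n) Filter.atTop (nhds 0) :=
        tendsto_pow_atTop_nhds_zero_of_lt_one (by positivity)
          (Real.rpow_lt_one (by norm_num) (by norm_num) hα)
      exact tendsto_const_nhds.add (((hp.const_mul C₁).mul_const _).mul_const _)
    rw [mul_zero, zero_mul, zero_mul, add_zero] at hz
    exact ge_of_tendsto' hz fun n => hchain x hx hGx n ρ hρ hρR y h1 h2 h3 h4
  have hD : ∀ᵐ x ∂σ, x ∈ {x | x ∈ S ∧ G x ≠ ⊤} := by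
    filter_upwards [hσ.ae_mem, ae_lt_top' (aemeasurable_gagliardoDensity hf t q) hGfin] with x h1 h2
    exact ⟨h1, h2.ne⟩
  have hsup : ∀ x ∈ {x | x ∈ S ∧ G x ≠ ⊤}, |f x| ≤ C₅ * (a + b) := by
    rintro x ⟨hx, hGx⟩
    obtain ⟨y, hyS, hyx, hGy, hxy, -, hgy, hfy⟩ := hσ.exists_good_point hc hq hα hf hfin hGfin hx
      (half_pos hR) (half_lt_self hR) (z₁ := x) (z₂ := x)
      (by rw [sub_self, norm_zero]; positivity) (by rw [sub_self, norm_zero]; positivity) hGx hGx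
    have h1 := hlim x hx hGx (R / 2) (half_pos hR) (half_lt_self hR) y (by linarith) hGy hxy hgy
    have h2 : |f x| ≤ |f x - f y| + |f y| := by
      have := abs_sub_abs_le_abs_sub (f x) (f y); linarith
    refine (h2.trans (add_le_add h1 hfy)).trans ?_
    have h3 : 0 ≤ C₃ * (R / 2) ^ β * b := by positivity
    have h4 : 0 ≤ C₂ * (R / 2) ^ (-((d : ℝ) / q)) * a := by positivity
    calc _ ≤ C₃ * (R / 2) ^ β * a + C₂ * (R / 2) ^ (-((d : ℝ) / q)) * b +
          (C₃ * (R / 2) ^ β * b + C₂ * (R / 2) ^ (-((d : ℝ) / q)) * a) := by linarith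
      _ = _ := by rw [hC₅]; ring
  have hhol : ∀ x ∈ {x | x ∈ S ∧ G x ≠ ⊤}, ∀ y ∈ {x | x ∈ S ∧ G x ≠ ⊤}, ‖x - y‖ < R →
      |f x - f y| ≤ 2 * C₃ * a * ‖x - y‖ ^ β := by
    rintro x ⟨hx, hGx⟩ y ⟨hy, hGy⟩ hxyR
    rcases eq_or_ne x y with rfl | hne
    · rw [sub_self, abs_zero]; positivity
    have hρ : 0 < ‖x - y‖ := norm_pos_iff.2 (sub_ne_zero.2 hne)
    -- One point w, controlled against both x and y, reduces the estimate to two uses of `hlim`.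
    obtain ⟨w, hwS, hwx, hGw, hxw, hyw, hgw, -⟩ := hσ.exists_good_point hc hq hα hf hfin hGfin hx
      hρ hxyR (z₁ := x) (z₂ := y)
      (by rw [sub_self, norm_zero]; positivity) (by rw [norm_sub_rev]; linarith) hGx hGy
    have h1 := hlim x hx hGx _ hρ hxyR w (by linarith) hGw hxw hgw
    have h2 := hlim y hy hGy _ hρ hxyR w
      (by linarith [norm_sub_le_norm_sub_add_norm_sub w x y]) hGw hyw hgw
    have h3 : |f x - f y| ≤ |f x - f w| + |f y - f w| := by
      rw [abs_sub_comm (f y)]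
      exact abs_sub_le _ _ _
    linarith
  obtain ⟨g, hg, hgb⟩ := _root_.exists_holder_modification (S := S) hD hβ hβ1 hR (by positivity)
    (by positivity) hsup hhol
  refine ⟨g, hg, hgb.trans ?_⟩
  have hae : (∫⁻ x, G x ∂σ) ^ (1 / q) = ENNReal.ofReal a := by
    rw [ha, ← ENNReal.ofReal_rpow_of_nonneg ENNReal.toReal_nonneg (by positivity),
      ENNReal.ofReal_toReal hGfin]
  have hbe : (∫⁻ x, ‖f x‖ₑ ^ q ∂σ) ^ (1 / q) = ENNReal.ofReal b := by
    rw [hb, ← ENNReal.ofReal_rpow_of_nonneg ENNReal.toReal_nonneg (by positivity),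
      ENNReal.ofReal_toReal hfin]
  rw [hae, hbe, ← ENNReal.ofReal_add ha0 hb0]
  change _ ≤ ENNReal.ofReal C₄ * _
  rw [← ENNReal.ofReal_mul hC₄0.le]
  refine ENNReal.ofReal_le_ofReal ?_
  have h1 : 2 * C₃ * a ≤ 2 * C₃ * (a + b) := by
    have : 0 ≤ 2 * C₃ * b := by positivity
    linarith
  calc _ ≤ 2 * C₃ * (a + b) + (1 + 2 / R ^ β) * (C₅ * (a + b)) := by linarith
    _ = _ := by rw [hC₄]; ring

end FractionalMorrey
end

/-! ### Surface measure in graph patches. -/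

noncomputable section

section PatchMeasure
variable {d : ℕ} {Ω : Set (Euc (d + 1))} {x₀ : Euc (d + 1)} {L : Euc (d + 1) ≃ₗᵢ[ℝ] Euc (d + 1)}
  {R : ℝ} {f : Euc d → ℝ}

lemma IsGraphPatch.continuousOn (h : IsGraphPatch Ω x₀ L R f) :
    ContinuousOn (fun u => frameMap x₀ L (u, f u)) (Metric.ball 0 R) :=
  (continuous_frameMap x₀ L).comp_continuousOn (continuousOn_id.prodMk h.smooth.continuousOn)

lemma IsGraphPatch.aemeasurable (h : IsGraphPatch Ω x₀ L R f) {r : ℝ} (hr : r ≤ R) :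
    AEMeasurable (fun u => frameMap x₀ L (u, f u)) (volume.restrict (Metric.ball 0 r)) :=
  (h.continuousOn.mono (Metric.ball_subset_ball hr)).aemeasurable measurableSet_ball

lemma IsGraphPatch.norm_sub_le (h : IsGraphPatch Ω x₀ L R f) {u v : Euc d}
    (hu : u ∈ Metric.ball (0 : Euc d) R) (hv : v ∈ Metric.ball (0 : Euc d) R) :
    ‖frameMap x₀ L (u, f u) - frameMap x₀ L (v, f v)‖ ≤ 2 * ‖u - v‖ := by
  rw [norm_frameMap_sub]
  refine (norm_graphPoint_le _ _).trans ?_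
  have := h.lipschitz u hu v hv
  simp only
  linarith

lemma IsGraphPatch.mem_frontier (h : IsGraphPatch Ω x₀ L R f) {u : Euc d}
    (hu : u ∈ Metric.ball (0 : Euc d) R) : frameMap x₀ L (u, f u) ∈ frontier Ω :=
  (h.mem_iff u hu _ (h.abs_lt hu)).2 rfl

lemma norm_frameCoord_fst_le (z : Euc (d + 1)) : ‖(frameCoord x₀ L z).1‖ ≤ ‖z - x₀‖ := by
  have := (lipschitzWith_frameCoord_fst x₀ L).dist_le_mul z x₀
  simpa [dist_eq_norm, frameCoord_self] using this

lemma abs_frameCoord_snd_le (z : Euc (d + 1)) : |(frameCoord x₀ L z).2| ≤ ‖z - x₀‖ := by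
  rw [frameCoord_snd]
  have := abs_real_inner_le_norm (z - x₀) (L (lastVec d))
  rwa [LinearIsometryEquiv.norm_map, norm_lastVec, mul_one] at this

lemma IsGraphPatch.eq_of_mem (h : IsGraphPatch Ω x₀ L R f) {z : Euc (d + 1)}
    (hz : z ∈ frontier Ω) (hzR : ‖z - x₀‖ < R) :
    frameMap x₀ L ((frameCoord x₀ L z).1, f (frameCoord x₀ L z).1) = z := by
  have h1 : (frameCoord x₀ L z).1 ∈ Metric.ball (0 : Euc d) R := by
    rw [mem_ball_zero_iff]; exact (norm_frameCoord_fst_le z).trans_lt hzR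
  have h2 := h.mem_iff _ h1 (frameCoord x₀ L z).2 ((abs_frameCoord_snd_le z).trans_lt hzR)
  rw [Prod.mk.eta, frameMap_frameCoord] at h2
  rw [← h2.1 hz, Prod.mk.eta, frameMap_frameCoord]

/-- The image of Lebesgue measure under a graph parametrization is at most the surface measure. -/
lemma IsGraphPatch.map_le (h : IsGraphPatch Ω x₀ L R f) :
    (volume.restrict (Metric.ball 0 R)).map (fun u => frameMap x₀ L (u, f u)) ≤
      surfaceMeasure Ω := by
  have hpc := continuous_frameCoord x₀ L
  set V := {z | (frameCoord x₀ L z).1 ∈ Metric.ball (0 : Euc d) R ∧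
    |(frameCoord x₀ L z).2| < R} with hV
  have hVo : IsOpen V := (Metric.isOpen_ball.preimage (continuous_fst.comp hpc)).inter
    (isOpen_lt (continuous_abs.comp (continuous_snd.comp hpc)) continuous_const)
  refine Measure.le_iff.2 fun s hs => ?_
  rw [Measure.map_apply_of_aemeasurable (h.aemeasurable le_rfl) hs]
  have hB : MeasurableSet (V ∩ frontier Ω) := hVo.measurableSet.inter isClosed_frontier.measurableSet
  have key := lintegral_comp_le_lintegral_surface x₀ L (A := Metric.ball (0 : Euc d) R)
    (B := V ∩ frontier Ω) (Φ := fun u => frameMap x₀ L (u, f u))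
    (fun u hu => ⟨by simpa [hV] using ⟨by simpa using hu, h.abs_lt hu⟩, h.mem_frontier hu⟩)
    (fun u _ => by simp) (fun z hz => by
      have h2 := h.mem_iff _ hz.1.1 _ hz.1.2
      rw [Prod.mk.eta, frameMap_frameCoord] at h2
      change frameMap x₀ L _ = z
      rw [← h2.1 hz.2, Prod.mk.eta, frameMap_frameCoord]) hB (s.indicator 1)
  rw [surfaceMeasure]
  calc volume.restrict (Metric.ball 0 R) ((fun u => frameMap x₀ L (u, f u)) ⁻¹' s)
      = ∫⁻ u in Metric.ball (0 : Euc d) R, s.indicator 1 (frameMap x₀ L (u, f u)) := by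
        rw [← lintegral_indicator_one₀
          ((h.aemeasurable le_rfl).nullMeasurable hs)]
        rfl
    _ ≤ _ := key
    _ ≤ ∫⁻ z in frontier Ω, s.indicator 1 z ∂μHE[d] :=
        lintegral_mono' (Measure.restrict_mono inter_subset_right le_rfl) le_rfl
    _ = _ := lintegral_indicator_one hs

/-- Near the center of a graph patch, the surface measure is at most a multiple of the image of
Lebesgue measure. -/
lemma IsGraphPatch.restrict_le (h : IsGraphPatch Ω x₀ L R f) {r : ℝ} (hr : r ≤ R) :
    (surfaceMeasure Ω).restrict (Metric.ball x₀ r) ≤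
      (2 ^ d : ℝ≥0∞) • (volume.restrict (Metric.ball 0 r)).map (fun u => frameMap x₀ L (u, f u)) := by
  refine Measure.le_iff.2 fun s hs => ?_
  rw [Measure.smul_apply, Measure.map_apply_of_aemeasurable (h.aemeasurable hr) hs,
    Measure.restrict_apply hs, surfaceMeasure, Measure.restrict_apply (hs.inter measurableSet_ball)]
  set Φ := fun u => frameMap x₀ L (u, f u) with hΦ
  set T := Φ ⁻¹' s ∩ Metric.ball 0 r with hT
  -- The parametrization is 2-Lipschitz, whence 2^d; every surface point within distance r of x₀
  -- lies on the graph over B(0, r).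
  have hl : LipschitzOnWith 2 Φ T := LipschitzOnWith.of_dist_le_mul fun u hu v hv => by
    rw [dist_eq_norm, dist_eq_norm]
    exact h.norm_sub_le (Metric.ball_subset_ball hr hu.2) (Metric.ball_subset_ball hr hv.2)
  have h1 := euclideanHausdorffMeasure_image_le hl d
  rw [EuclideanSpace.euclideanHausdorffMeasure_eq_volume] at h1
  refine (measure_mono ?_).trans (h1.trans ?_)
  · rintro z ⟨⟨hzs, hzb⟩, hzS⟩
    rw [mem_ball_iff_norm] at hzb
    have h2 := h.eq_of_mem hzS (hzb.trans_le hr)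
    refine ⟨(frameCoord x₀ L z).1, ⟨?_, ?_⟩, h2⟩
    · change frameMap x₀ L _ ∈ s
      rw [h2]; exact hzs
    · rw [mem_ball_zero_iff]; exact (norm_frameCoord_fst_le z).trans_lt hzb
  · rw [smul_eq_mul]
    exact mul_le_mul' (by norm_num) (Measure.le_restrict_apply _ _)

/-- An upper density bound independent of Ω. It gives finiteness of the surface measure and limits
the overlap when averaging over centres in `exists_sobolev_of_graphPatch`. -/
lemma IsGraphPatch.surfaceMeasure_ball_le (h : IsGraphPatch Ω x₀ L R f) :
    surfaceMeasure Ω (Metric.ball x₀ R) ≤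
      2 ^ d * volume (Metric.ball (0 : Euc d) R) := by
  have h1 := Measure.le_iff'.1 (h.restrict_le le_rfl) univ
  rw [Measure.restrict_apply_univ, Measure.smul_apply,
    Measure.map_apply_of_aemeasurable (h.aemeasurable le_rfl) MeasurableSet.univ, preimage_univ,
    Measure.restrict_apply_univ, smul_eq_mul] at h1
  exact h1

/-- A surface that is covered by graph patches of a fixed size has finite measure. -/
lemma IsSmoothBoundedDomain.isFiniteMeasure_of_graphPatch (hΩ : IsSmoothBoundedDomain Ω)
    (hpatch : ∀ x ∈ frontier Ω, ∃ L f, IsGraphPatch Ω x L R f) :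
    IsFiniteMeasure (surfaceMeasure Ω) := by
  have h1 : surfaceMeasure Ω (frontier Ω) < ⊤ := by
    refine hΩ.isCompact_frontier.measure_lt_top_of_nhdsWithin fun x hx => ?_
    obtain ⟨L, f, h⟩ := hpatch x hx
    refine ⟨Metric.ball x R, mem_nhdsWithin_of_mem_nhds (Metric.ball_mem_nhds x h.pos), ?_⟩
    exact h.surfaceMeasure_ball_le.trans_lt
      (ENNReal.mul_lt_top (ENNReal.pow_lt_top (by norm_num)) measure_ball_lt_top)
  refine ⟨?_⟩
  rwa [surfaceMeasure, Measure.restrict_apply_univ, ← Measure.restrict_apply_self]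

end PatchMeasure
end

/-! ### Mollification of weakly differentiable functions. -/

noncomputable section

section Mollification
variable {d : ℕ}

/-- Jensen's inequality, obtained from Hölder's inequality against the constant 1. -/
lemma lintegral_rpow_le_lintegral_rpow {X : Type*} [MeasurableSpace X] (ν : Measure X)
    [IsProbabilityMeasure ν] {q : ℝ} (hq : 1 < q) {g : X → ℝ≥0∞} (hg : AEMeasurable g ν) :
    (∫⁻ x, g x ∂ν) ^ q ≤ ∫⁻ x, g x ^ q ∂ν := by
  have h := ENNReal.lintegral_mul_le_Lp_mul_Lq ν (Real.HolderConjugate.conjExponent hq) hg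
    (aemeasurable_const (b := (1 : ℝ≥0∞)))
  simp only [Pi.mul_apply, mul_one, ENNReal.one_rpow, lintegral_const, measure_univ] at h
  have h2 := ENNReal.rpow_le_rpow h (by linarith : 0 ≤ q)
  rwa [← ENNReal.rpow_mul, one_div_mul_cancel (by linarith), ENNReal.rpow_one] at h2

/-- Convolution with a normalized bump function does not increase `L^q` norms. -/
lemma lintegral_convolution_rpow_le {F : Type*} [NormedAddCommGroup F] [NormedSpace ℝ F]
    (φ : ContDiffBump (0 : Euc d)) {q : ℝ} (hq : 1 < q) {h : Euc d → F}
    (hh : AEStronglyMeasurable h volume) :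
    ∫⁻ x, ‖convolution (φ.normed volume) h (ContinuousLinearMap.lsmul ℝ ℝ) volume x‖ₑ ^ q ≤
      ∫⁻ x, ‖h x‖ₑ ^ q := by
  set w : Euc d → ℝ≥0∞ := fun t => ‖φ.normed volume t‖ₑ with hw
  have hwm : Measurable w := φ.continuous_normed.measurable.enorm
  -- The bump as a probability measure: Jensen bounds the convolution pointwise, then Tonelli and
  -- translation invariance remove the shift.
  set ν := volume.withDensity w with hν
  have hν1 : ν univ = 1 := by
    rw [hν, withDensity_apply _ MeasurableSet.univ, Measure.restrict_univ]
    have h1 := ofReal_integral_norm_eq_lintegral_enorm φ.integrable_normed (μ := volume)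
    rw [hw, ← h1]
    have h2 : ∫ x, ‖φ.normed volume x‖ = ∫ x, φ.normed volume x :=
      integral_congr_ae (Filter.Eventually.of_forall fun x => by
        simp only [Real.norm_of_nonneg (φ.nonneg_normed x)])
    rw [h2, φ.integral_normed, ENNReal.ofReal_one]
  have : IsProbabilityMeasure ν := ⟨hν1⟩
  have hqm := quasiMeasurePreserving_sub_of_right_invariant (volume : Measure (Euc d)) ν
  have hm : AEMeasurable (fun p : Euc d × Euc d => ‖h (p.1 - p.2)‖ₑ ^ q) (volume.prod ν) :=
    ((hh.comp_quasiMeasurePreserving hqm).enorm).pow_const q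
  have hmx : ∀ x, AEMeasurable (fun t => ‖h (x - t)‖ₑ) volume := fun x =>
    (hh.comp_quasiMeasurePreserving
      (Measure.measurePreserving_sub_left volume x).quasiMeasurePreserving).enorm
  have hpt : ∀ x, ‖convolution (φ.normed volume) h (ContinuousLinearMap.lsmul ℝ ℝ) volume x‖ₑ ^ q ≤
      ∫⁻ t, ‖h (x - t)‖ₑ ^ q ∂ν := by
    intro x
    refine le_trans ?_ (lintegral_rpow_le_lintegral_rpow ν hq
      ((hmx x).mono_ac (withDensity_absolutelyContinuous _ _)))
    refine ENNReal.rpow_le_rpow ?_ (by linarith)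
    rw [hν, lintegral_withDensity_eq_lintegral_mul₀ hwm.aemeasurable (hmx x)]
    refine (enorm_integral_le_lintegral_enorm _).trans_eq (lintegral_congr fun t => ?_)
    simp only [ContinuousLinearMap.lsmul_apply, enorm_smul, Pi.mul_apply, hw]
  calc _ ≤ ∫⁻ x, ∫⁻ t, ‖h (x - t)‖ₑ ^ q ∂ν := lintegral_mono hpt
    _ = ∫⁻ t, (∫⁻ x, ‖h (x - t)‖ₑ ^ q) ∂ν := lintegral_lintegral_swap hm
    _ = ∫⁻ _t, (∫⁻ x, ‖h x‖ₑ ^ q) ∂ν :=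
        lintegral_congr fun t => lintegral_sub_right_eq_self (fun x => ‖h x‖ₑ ^ q) t
    _ = _ := by rw [lintegral_const, hν1, mul_one]

/-- The derivative of a mollification is the mollification of the weak derivative. -/
lemma fderiv_convolution_eq {R : ℝ} {v : Euc d → ℝ} {W : Euc d → Euc d →L[ℝ] ℝ}
    (hv : IntegrableOn v (Metric.ball 0 R)) (hW : IntegrableOn W (Metric.ball 0 R))
    (hweak : ∀ φ : Euc d → ℝ, ContDiff ℝ ∞ φ → HasCompactSupport φ →
      tsupport φ ⊆ Metric.ball 0 R → ∀ i : Fin d,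
        ∫ u in Metric.ball 0 R, v u * fderiv ℝ φ u (EuclideanSpace.single i 1) =
          - ∫ u in Metric.ball 0 R, W u (EuclideanSpace.single i 1) * φ u)
    (φ : ContDiffBump (0 : Euc d)) {x : Euc d} (hx : ‖x‖ + φ.rOut < R) :
    fderiv ℝ (convolution (φ.normed volume) ((Metric.ball 0 R).indicator v)
      (ContinuousLinearMap.lsmul ℝ ℝ) volume) x =
    convolution (φ.normed volume) ((Metric.ball 0 R).indicator W)
      (ContinuousLinearMap.lsmul ℝ ℝ) volume x := by
  set B := Metric.ball (0 : Euc d) R with hB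
  have hBm : MeasurableSet B := measurableSet_ball
  set ψ := φ.normed volume with hψ
  have hvi : LocallyIntegrable (B.indicator v) volume :=
    ((integrable_indicator_iff hBm).2 hv).locallyIntegrable
  have hWi : LocallyIntegrable (B.indicator W) volume :=
    ((integrable_indicator_iff (f := W) hBm).2 hW).locallyIntegrable
  have hψc : HasCompactSupport ψ := φ.hasCompactSupport_normed
  have hψs : ∀ n : ℕ∞, ContDiff ℝ n ψ := fun n => φ.contDiff_normed
  have hψ1 : ContDiff ℝ 1 ψ := hψs 1
  have hD := hψc.hasFDerivAt_convolution_left (μ := volume) (ContinuousLinearMap.lsmul ℝ ℝ) hψ1 hvi x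
  rw [hD.fderiv]
  have hi1 := ((hψc.fderiv ℝ).convolutionExists_left
    (ContinuousLinearMap.precompL (Euc d) (ContinuousLinearMap.lsmul ℝ ℝ : ℝ →L[ℝ] ℝ →L[ℝ] ℝ))
    (hψ1.continuous_fderiv (by norm_num)) hvi x).integrable_swap
  have hi2 := (hψc.convolutionExists_left
    (ContinuousLinearMap.lsmul ℝ ℝ : ℝ →L[ℝ] (Euc d →L[ℝ] ℝ) →L[ℝ] (Euc d →L[ℝ] ℝ))
    hψ1.continuous hWi x).integrable_swap
  rw [convolution_eq_swap, convolution_eq_swap]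
  refine ContinuousLinearMap.coe_injective ((EuclideanSpace.basisFun (Fin d) ℝ).toBasis.ext
    fun i => ?_)
  simp only [OrthonormalBasis.coe_toBasis, EuclideanSpace.basisFun_apply,
    ContinuousLinearMap.coe_coe]
  rw [ContinuousLinearMap.integral_apply hi1, ContinuousLinearMap.integral_apply hi2]
  -- The reflected and translated bump is an admissible test function: its support lies within rOut
  -- of x, hence inside B(0, R).
  set η : Euc d → ℝ := fun t => ψ (x - t) with hη
  have hηs : ContDiff ℝ ∞ η := (hψs ⊤).comp (contDiff_const.sub contDiff_id)
  have hηc : HasCompactSupport η := hψc.comp_homeomorph (Homeomorph.subLeft x)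
  have hηt : tsupport η ⊆ B := by
    have h1 : tsupport η ⊆ Metric.closedBall x φ.rOut := by
      refine closure_minimal (fun t ht => ?_) Metric.isClosed_closedBall
      have h2 : x - t ∈ Function.support ψ := ht
      rw [hψ, φ.support_normed_eq, mem_ball_zero_iff] at h2
      rw [mem_closedBall_iff_norm, norm_sub_rev]
      exact h2.le
    refine h1.trans fun t ht => ?_
    rw [mem_closedBall_iff_norm] at ht
    rw [hB, mem_ball_zero_iff]
    have := norm_sub_norm_le t x
    linarith
  have hηd : ∀ t, fderiv ℝ η t = -fderiv ℝ ψ (x - t) := by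
    intro t
    have h1 : HasFDerivAt ψ (fderiv ℝ ψ (x - t)) (x - t) :=
      (hψ1.differentiable (by norm_num) _).hasFDerivAt
    have h2 : HasFDerivAt (fun t => x - t) (-ContinuousLinearMap.id ℝ (Euc d)) t :=
      (hasFDerivAt_id t).const_sub x
    have h3 := h1.comp t h2
    rw [ContinuousLinearMap.comp_neg, ContinuousLinearMap.comp_id] at h3
    exact h3.fderiv
  have key := hweak η hηs hηc hηt i
  rw [← integral_indicator hBm, ← integral_indicator hBm] at key
  have e1 : ∫ t, ((ContinuousLinearMap.precompL (Euc d)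
      (ContinuousLinearMap.lsmul ℝ ℝ : ℝ →L[ℝ] ℝ →L[ℝ] ℝ)) (fderiv ℝ ψ (x - t)) (B.indicator v t))
        (EuclideanSpace.single i 1) =
      - ∫ t, B.indicator (fun u => v u * fderiv ℝ η u (EuclideanSpace.single i 1)) t := by
    rw [← integral_neg]
    refine integral_congr_ae (Filter.Eventually.of_forall fun t => ?_)
    simp only [ContinuousLinearMap.precompL_apply, ContinuousLinearMap.lsmul_apply, smul_eq_mul]
    by_cases ht : t ∈ B
    · simp only [indicator_of_mem ht, hηd, _root_.neg_apply]; ring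
    · simp only [indicator_of_notMem ht]; simp
  have e2 : ∫ t, ((ContinuousLinearMap.lsmul ℝ ℝ :
      ℝ →L[ℝ] (Euc d →L[ℝ] ℝ) →L[ℝ] (Euc d →L[ℝ] ℝ)) (ψ (x - t)) (B.indicator W t))
        (EuclideanSpace.single i 1) =
      ∫ t, B.indicator (fun u => W u (EuclideanSpace.single i 1) * η u) t := by
    refine integral_congr_ae (Filter.Eventually.of_forall fun t => ?_)
    simp only [ContinuousLinearMap.lsmul_apply]
    by_cases ht : t ∈ B
    · simp only [indicator_of_mem ht, _root_.smul_apply, smul_eq_mul, hη]; ring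
    · simp only [indicator_of_notMem ht]; simp
  rw [e1, e2, key, neg_neg]

/-- `W` is the weak derivative of `v` in the ball of radius `R`, and both are in `L^q`. -/
structure IsWeakDeriv (R q : ℝ) (v : Euc d → ℝ) (W : Euc d → Euc d →L[ℝ] ℝ) : Prop where
  memLp : MemLp v (ENNReal.ofReal q) (volume.restrict (Metric.ball 0 R))
  memLp_deriv : MemLp W (ENNReal.ofReal q) (volume.restrict (Metric.ball 0 R))
  weak : ∀ φ : Euc d → ℝ, ContDiff ℝ ∞ φ → HasCompactSupport φ →
    tsupport φ ⊆ Metric.ball 0 R → ∀ i : Fin d,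
      ∫ u in Metric.ball 0 R, v u * fderiv ℝ φ u (EuclideanSpace.single i 1) =
        - ∫ u in Metric.ball 0 R, W u (EuclideanSpace.single i 1) * φ u

/-- Approximation of weakly differentiable functions by smooth functions. -/
lemma IsWeakDeriv.exists_approximation {R q : ℝ} (hR : 0 < R) (hq : 1 < q) {v : Euc d → ℝ}
    {W : Euc d → Euc d →L[ℝ] ℝ} (h : IsWeakDeriv R q v W) :
    ∃ u : ℕ → Euc d → ℝ, (∀ n, ContDiff ℝ 1 (u n)) ∧
      (∀ᵐ x ∂(volume.restrict (Metric.ball (0 : Euc d) R)),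
        Filter.Tendsto (fun n => u n x) Filter.atTop (nhds (v x))) ∧
      ∀ n, ∫⁻ x in Metric.ball 0 (R / 2), ‖u n x‖ₑ ^ q ≤ ∫⁻ x in Metric.ball 0 R, ‖v x‖ₑ ^ q ∧
        ∫⁻ x in Metric.ball 0 (R / 2), ‖fderiv ℝ (u n) x‖ₑ ^ q ≤
          ∫⁻ x in Metric.ball 0 R, ‖W x‖ₑ ^ q := by
  have hq0 : 0 < q := by linarith
  set B := Metric.ball (0 : Euc d) R with hB
  have hBm : MeasurableSet B := measurableSet_ball
  have : IsFiniteMeasure (volume.restrict B) := ⟨by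
    rw [Measure.restrict_apply_univ]; exact measure_ball_lt_top⟩
  have hq1 : (1 : ℝ≥0∞) ≤ ENNReal.ofReal q := by
    rw [← ENNReal.ofReal_one]; exact ENNReal.ofReal_le_ofReal hq.le
  have hvi : IntegrableOn v B := h.memLp.integrable hq1
  have hWi : IntegrableOn W B := h.memLp_deriv.integrable hq1
  have hvI : Integrable (B.indicator v) volume := (integrable_indicator_iff hBm).2 hvi
  have hWI : Integrable (B.indicator W) volume := (integrable_indicator_iff (f := W) hBm).2 hWi
  have hrpos : ∀ n : ℕ, 0 < R / (4 * (n + 1)) := fun n => by positivity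
  -- Outer radii at most R/4 make the derivative formula valid on B(0, R/2); the bounded ratio of
  -- outer to inner radius is what almost everywhere convergence requires.
  set φ : ℕ → ContDiffBump (0 : Euc d) := fun n =>
    ⟨R / (4 * (n + 1)) / 2, R / (4 * (n + 1)), half_pos (hrpos n), half_lt_self (hrpos n)⟩ with hφ
  have hrle : ∀ n : ℕ, R / (4 * (n + 1)) ≤ R / 4 := fun n => by
    apply div_le_div_of_nonneg_left hR.le (by norm_num)
    have : (0 : ℝ) ≤ n := Nat.cast_nonneg n
    linarith
  have hrlim : Filter.Tendsto (fun n => (φ n).rOut) Filter.atTop (nhds 0) := by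
    have h1 := (tendsto_one_div_add_atTop_nhds_zero_nat (𝕜 := ℝ)).const_mul (R / 4)
    rw [mul_zero] at h1
    refine h1.congr fun n => ?_
    simp only [hφ]
    field_simp
  have hind : ∀ {F : Type} [NormedAddCommGroup F] (w : Euc d → F),
      ∫⁻ x, ‖B.indicator w x‖ₑ ^ q = ∫⁻ x in B, ‖w x‖ₑ ^ q := by
    intro F _ w
    rw [← lintegral_indicator hBm]
    refine lintegral_congr fun x => ?_
    by_cases hx : x ∈ B
    · simp [hx]
    · simp [hx, hq0]
  refine ⟨fun n => convolution ((φ n).normed volume) (B.indicator v)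
    (ContinuousLinearMap.lsmul ℝ ℝ) volume, fun n => ?_, ?_, fun n => ⟨?_, ?_⟩⟩
  · exact (φ n).hasCompactSupport_normed.contDiff_convolution_left (n := 1) _
      (φ n).contDiff_normed hvI.locallyIntegrable
  · have h1 := ContDiffBump.ae_convolution_tendsto_right_of_locallyIntegrable (K := 2) hrlim
      (Filter.Eventually.of_forall fun n => by simp only [hφ]; linarith [hrpos n])
      hvI.locallyIntegrable
    filter_upwards [ae_restrict_of_ae h1, ae_restrict_mem hBm] with x hx hxB
    rwa [indicator_of_mem hxB] at hx
  · rw [← hind v]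
    exact (lintegral_mono' Measure.restrict_le_self le_rfl).trans
      (lintegral_convolution_rpow_le (φ n) hq hvI.1)
  · rw [← hind W]
    refine le_trans ?_ (lintegral_convolution_rpow_le (φ n) hq hWI.1)
    refine le_trans (le_of_eq (setLIntegral_congr_fun measurableSet_ball fun x hx => ?_))
      (lintegral_mono' Measure.restrict_le_self le_rfl)
    rw [mem_ball_zero_iff] at hx
    simp only
    rw [fderiv_convolution_eq hvi hWi h.weak (φ n)]
    have : (φ n).rOut ≤ R / 4 := hrle n
    linarith

end Mollification
end

/-! ### Sobolev inequality on balls of ℝᵈ. -/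

noncomputable section

section LocalSobolev
variable {d : ℕ}

/-- Local Gagliardo–Nirenberg–Sobolev inequality. -/
lemma exists_local_sobolev_of_contDiff (hd : 1 ≤ d) {q R : ℝ} (hq : 1 < q) (hqd : q < d)
    (hR : 0 < R) :
    ∃ C : ℝ≥0, ∀ u : Euc d → ℝ, ContDiff ℝ 1 u →
      eLpNorm u (ENNReal.ofReal (d * q / (d - q))) (volume.restrict (Metric.ball 0 (R / 4))) ≤
        C * (eLpNorm u (ENNReal.ofReal q) (volume.restrict (Metric.ball 0 (R / 2))) +
          eLpNorm (fderiv ℝ u) (ENNReal.ofReal q) (volume.restrict (Metric.ball 0 (R / 2)))) := by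
  have hq0 : 0 < q := by linarith
  have hd0 : (0 : ℝ) < d := by exact_mod_cast hd
  -- A cut-off equal to 1 on B(0, R/4) and supported in B(0, R/2), so that the inequality for
  -- compactly supported functions applies to η u.
  set η : ContDiffBump (0 : Euc d) := ⟨R / 4, 3 * R / 8, by positivity, by linarith⟩ with hη
  have hηs : ContDiff ℝ 1 η := η.contDiff
  have hηt : tsupport η ⊆ Metric.ball 0 (R / 2) := by
    rw [η.tsupport_eq]
    exact Metric.closedBall_subset_ball (by simp only [hη]; linarith)
  obtain ⟨K, hK⟩ := (hηs.continuous_fderiv (by norm_num)).bounded_above_of_compact_support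
    (η.hasCompactSupport.fderiv ℝ)
  have hK0 : 0 ≤ K := (norm_nonneg _).trans (hK 0)
  set C₀ := SNormLESNormFDerivOfEqConst ℝ (volume : Measure (Euc d)) q.toNNReal with hC₀
  refine ⟨C₀ * max 1 K.toNNReal, fun u hu => ?_⟩
  set w : Euc d → ℝ := fun x => η x * u x with hw
  have hws : ContDiff ℝ 1 w := hηs.mul hu
  have hwc : HasCompactSupport w := η.hasCompactSupport.mul_right
  have hwt : tsupport w ⊆ Metric.ball 0 (R / 2) := (tsupport_mul_subset_left).trans hηt
  have h1 : eLpNorm u (ENNReal.ofReal (d * q / (d - q))) (volume.restrict (Metric.ball 0 (R / 4))) ≤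
      eLpNorm w (ENNReal.ofReal (d * q / (d - q))) volume := by
    refine le_trans (le_of_eq ?_) 
      (eLpNorm_mono_measure w (Measure.restrict_le_self (s := Metric.ball 0 (R / 4))))
    refine eLpNorm_congr_ae ?_
    filter_upwards [ae_restrict_mem measurableSet_ball] with x hx
    rw [hw]
    simp only
    rw [η.one_of_mem_closedBall (Metric.ball_subset_closedBall hx), one_mul]
  have h2 := eLpNorm_le_eLpNorm_fderiv_of_eq (volume : Measure (Euc d)) hws hwc (p := q.toNNReal)
    (p' := (d * q / (d - q)).toNNReal) (by rw [← Real.toNNReal_one]; exact Real.toNNReal_mono hq.le)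
    (by rw [finrank_euclideanSpace_fin]; omega)
    (by
      have : (0 : ℝ) < d - q := by linarith
      rw [NNReal.coe_inv, Real.coe_toNNReal _ (by positivity), Real.coe_toNNReal _ hq0.le,
        finrank_euclideanSpace_fin]
      field_simp)
  have h3 : eLpNorm (fderiv ℝ w) (ENNReal.ofReal q) volume ≤ max 1 K.toNNReal *
      (eLpNorm u (ENNReal.ofReal q) (volume.restrict (Metric.ball 0 (R / 2))) +
          eLpNorm (fderiv ℝ u) (ENNReal.ofReal q) (volume.restrict (Metric.ball 0 (R / 2)))) := by
    rw [← eLpNorm_restrict_eq_of_support_subset (f := fderiv ℝ w)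
      ((support_fderiv_subset ℝ).trans hwt)]
    have e : fderiv ℝ w = (fun x => u x • fderiv ℝ η x) + fun x => η x • fderiv ℝ u x := by
      funext x
      rw [hw, fderiv_fun_mul (hηs.differentiable (by norm_num) x) (hu.differentiable (by norm_num) x),
        add_comm]
      rfl
    have hcu := hu.continuous_fderiv (by norm_num)
    have hcη := hηs.continuous_fderiv (by norm_num)
    rw [e]
    refine (eLpNorm_add_le (hu.continuous.smul hcη).aestronglyMeasurable
      (hηs.continuous.smul hcu).aestronglyMeasurable ?_).trans ?_
    · rw [← ENNReal.ofReal_one]; exact ENNReal.ofReal_le_ofReal hq.le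
    rw [mul_add]
    refine add_le_add ?_ ?_
    · refine (eLpNorm_le_mul_eLpNorm_of_ae_le_mul (c := K) (g := u)
        (Filter.Eventually.of_forall fun x => ?_) _).trans ?_
      · rw [Pi.smul_apply', norm_smul, mul_comm]
        gcongr
        exact hK x
      · gcongr
        exact ENNReal.coe_le_coe.2 (le_max_right _ _)
    · refine (eLpNorm_mono (g := fderiv ℝ u) fun x => ?_).trans ?_
      · rw [Pi.smul_apply', norm_smul, Real.norm_of_nonneg η.nonneg]
        exact mul_le_of_le_one_left (norm_nonneg _) η.le_one
      · refine le_mul_of_one_le_left zero_le ?_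
        exact_mod_cast le_max_left _ _
  calc _ ≤ _ := h1
    _ ≤ C₀ * eLpNorm (fderiv ℝ w) (ENNReal.ofReal q) volume := by
        have := h2
        rw [Real.coe_toNNReal _ hq0.le] at this
        rw [hC₀, Real.coe_toNNReal _ hq0.le]
        exact this
    _ ≤ C₀ * (max 1 K.toNNReal * _) := by gcongr
    _ = _ := by rw [← mul_assoc]; push_cast; rfl

lemma eLpNorm_ofReal_eq {X F : Type*} [MeasurableSpace X] [NormedAddCommGroup F] {μ : Measure X}
    {q : ℝ} (hq : 0 < q) (f : X → F) :
    eLpNorm f (ENNReal.ofReal q) μ = (∫⁻ x, ‖f x‖ₑ ^ q ∂μ) ^ (1 / q) := by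
  rw [eLpNorm_eq_lintegral_rpow_enorm_toReal (by simpa using hq) ENNReal.ofReal_ne_top,
    ENNReal.toReal_ofReal hq.le]

/-- Local Sobolev inequality for weakly differentiable functions. -/
lemma exists_local_sobolev (hd : 1 ≤ d) {q R : ℝ} (hq : 1 < q) (hqd : q < d) (hR : 0 < R) :
    ∃ C : ℝ≥0, ∀ (v : Euc d → ℝ) (W : Euc d → Euc d →L[ℝ] ℝ), IsWeakDeriv R q v W →
      eLpNorm v (ENNReal.ofReal (d * q / (d - q))) (volume.restrict (Metric.ball 0 (R / 4))) ≤
        C * (eLpNorm v (ENNReal.ofReal q) (volume.restrict (Metric.ball 0 R)) +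
          eLpNorm W (ENNReal.ofReal q) (volume.restrict (Metric.ball 0 R))) := by
  have hq0 : 0 < q := by linarith
  obtain ⟨C, hC⟩ := exists_local_sobolev_of_contDiff hd hq hqd hR
  refine ⟨C, fun v W h => ?_⟩
  obtain ⟨u, hu, hlim, hbd⟩ := h.exists_approximation hR hq
  have hlim' := ae_mono (Measure.restrict_mono
    (Metric.ball_subset_ball (by linarith : R / 4 ≤ R)) le_rfl) hlim
  -- Fatou's lemma: almost everywhere convergence of the mollifications and bounds on their norms
  -- suffice, without convergence of gradients.
  refine (Lp.eLpNorm_lim_le_liminf_eLpNorm (fun n => (hu n).continuous.aestronglyMeasurable) v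
    hlim').trans ?_
  refine Filter.liminf_le_of_frequently_le' (Filter.Frequently.of_forall fun n => ?_)
  refine (hC _ (hu n)).trans ?_
  simp only [eLpNorm_ofReal_eq hq0]
  have h1 := ENNReal.rpow_le_rpow (hbd n).1 (by positivity : 0 ≤ 1 / q)
  have h2 := ENNReal.rpow_le_rpow (hbd n).2 (by positivity : 0 ≤ 1 / q)
  gcongr

end LocalSobolev

/-! ### Morrey inequality on balls of ℝᵈ. -/

section LocalMorrey
variable {d : ℕ}

lemma lintegral_le_rpow_mul_measure {X : Type*} [MeasurableSpace X] {μ : Measure X} {q : ℝ}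
    (hq : 1 < q) {g : X → ℝ≥0∞} (hg : AEMeasurable g μ) :
    ∫⁻ x, g x ∂μ ≤ (∫⁻ x, g x ^ q ∂μ) ^ (1 / q) * μ univ ^ (1 - 1 / q) := by
  have hc := Real.HolderConjugate.conjExponent hq
  have h := ENNReal.lintegral_mul_le_Lp_mul_Lq μ hc hg (aemeasurable_const (b := (1 : ℝ≥0∞)))
  simp only [Pi.mul_apply, mul_one, ENNReal.one_rpow, lintegral_const, one_mul] at h
  rwa [show 1 / q.conjExponent = 1 - 1 / q by
    rw [one_div, one_div, ← hc.inv_add_inv_eq_one]; ring] at h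

lemma lintegral_comp_homothety (x : Euc d) {t : ℝ} (ht : 0 < t) {B : Set (Euc d)}
    (hB : MeasurableSet B) (h : Euc d → ℝ≥0∞) :
    ENNReal.ofReal (t ^ d) * ∫⁻ z in B, h (x + t • (z - x)) =
      ∫⁻ z in (fun z => x + t • (z - x)) '' B, h z := by
  have hD : ∀ z ∈ B, HasFDerivWithinAt (fun z => x + t • (z - x))
      (t • ContinuousLinearMap.id ℝ (Euc d)) B z := fun z _ =>
    ((((hasFDerivAt_id z).sub_const x).const_smul t).const_add x).hasFDerivWithinAt
  have hinj : InjOn (fun z => x + t • (z - x)) B := by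
    intro a _ b _ hab
    simpa [ht.ne'] using hab
  rw [lintegral_image_eq_lintegral_abs_det_fderiv_mul volume hB hD hinj,
    lintegral_const_mul' _ _ ENNReal.ofReal_ne_top |>.symm]
  have hdet : |(t • ContinuousLinearMap.id ℝ (Euc d)).det| = t ^ d := by
    rw [ContinuousLinearMap.det, ContinuousLinearMap.toLinearMap_smul, LinearMap.det_smul,
      finrank_euclideanSpace_fin, ContinuousLinearMap.coe_id, LinearMap.det_id, mul_one,
      abs_of_pos (by positivity)]
  simp only [hdet]

lemma enorm_sub_le_lintegral_segment {u : Euc d → ℝ} (hu : ContDiff ℝ 1 u) (x z : Euc d) :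
    ‖u z - u x‖ₑ ≤ ∫⁻ t in Ioc (0 : ℝ) 1, ‖fderiv ℝ u (x + t • (z - x))‖ₑ * ‖z - x‖ₑ := by
  have hc : Continuous fun t : ℝ => fderiv ℝ u (x + t • (z - x)) (z - x) :=
    ((hu.continuous_fderiv (by norm_num)).comp (by fun_prop)).clm_apply continuous_const
  have hderiv : ∀ t ∈ uIcc (0 : ℝ) 1, HasDerivAt (fun t : ℝ => u (x + t • (z - x)))
      (fderiv ℝ u (x + t • (z - x)) (z - x)) t := by
    intro t _
    have h1 : HasFDerivAt u (fderiv ℝ u (x + t • (z - x))) (x + t • (z - x)) :=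
      (hu.differentiable (by norm_num) _).hasFDerivAt
    have h2 : HasDerivAt (fun t : ℝ => x + t • (z - x)) (z - x) t := by
      simpa using ((hasDerivAt_id t).smul_const (z - x)).const_add x
    exact h1.comp_hasDerivAt t h2
  have h := intervalIntegral.integral_eq_sub_of_hasDerivAt hderiv (hc.intervalIntegrable _ _)
  simp only [one_smul, zero_smul, add_zero, add_sub_cancel] at h
  rw [← h, intervalIntegral.integral_of_le zero_le_one]
  refine (enorm_integral_le_lintegral_enorm _).trans (lintegral_mono fun t => ?_)
  exact ContinuousLinearMap.le_opENorm _ _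

lemma lintegral_rpow_Ioc {a : ℝ} (ha : a < 1) :
    ∫⁻ t in Ioc (0 : ℝ) 1, ENNReal.ofReal (t ^ (-a)) = ENNReal.ofReal (1 / (1 - a)) := by
  have hi : IntervalIntegrable (fun t : ℝ => t ^ (-a)) volume 0 1 :=
    intervalIntegral.intervalIntegrable_rpow' (by linarith)
  rw [intervalIntegrable_iff_integrableOn_Ioc_of_le zero_le_one] at hi
  rw [← ofReal_integral_eq_lintegral_ofReal hi]
  · rw [← intervalIntegral.integral_of_le zero_le_one, integral_rpow (Or.inl (by linarith))]
    congr 1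
    rw [Real.one_rpow, Real.zero_rpow (by linarith), sub_zero]
    congr 1; ring
  · filter_upwards [ae_restrict_mem measurableSet_Ioc] with t ht
    exact Real.rpow_nonneg ht.1.le _

/-- The integral form of the Morrey inequality. -/
lemma lintegral_ball_sub_le {q : ℝ} (hq : 1 < q) (hqd : (d : ℝ) < q) {u : Euc d → ℝ}
    (hu : ContDiff ℝ 1 u) {a x : Euc d} {r : ℝ} (hx : x ∈ Metric.ball a r) :
    ∫⁻ z in Metric.ball a r, ‖u z - u x‖ₑ ≤
      ENNReal.ofReal (2 * r * (unitBallVolume d * (2 * r) ^ d) ^ (1 - 1 / q) * (1 / (1 - d / q))) *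
        (∫⁻ z in Metric.ball a r, ‖fderiv ℝ u z‖ₑ ^ q) ^ (1 / q) := by
  have hq0 : 0 < q := by linarith
  have hr : 0 < r := Metric.pos_of_mem_ball hx
  have hκ := unitBallVolume_pos d
  set κ := unitBallVolume d with hκd
  set B := Metric.ball a r with hB
  have hBm : MeasurableSet B := measurableSet_ball
  set h : Euc d → ℝ≥0∞ := fun z => ‖fderiv ℝ u z‖ₑ with hh
  have hhc : Continuous (fderiv ℝ u) := hu.continuous_fderiv (by norm_num)
  have hhm : Measurable h := hhc.measurable.enorm
  set N := (∫⁻ z in B, h z ^ q) ^ (1 / q) with hN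
  set A := (κ * (2 * r) ^ d) ^ (1 - 1 / q) with hA
  have hA0 : 0 ≤ A := by positivity
  have h1q : 0 ≤ 1 - 1 / q := by
    rw [sub_nonneg, div_le_one hq0]; exact hq.le
  have hdist : ∀ z ∈ B, ‖z - x‖ < 2 * r := by
    intro z hz
    have h1 : dist z a < r := hz
    have h2 : dist x a < r := hx
    rw [← dist_eq_norm]
    linarith [dist_triangle_right z x a]
  -- Contraction towards x by t maps the ball into B(x, 2rt). Hölder's inequality there gives
  -- (t^d)^(1 − 1/q), and division by the Jacobian t^d leaves t^(−d/q), integrable on (0, 1) because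
  -- q > d.
  have hinner : ∀ t ∈ Ioc (0 : ℝ) 1, ∫⁻ z in B, h (x + t • (z - x)) ≤
      N * ENNReal.ofReal A * ENNReal.ofReal (t ^ (-(d / q : ℝ))) := by
    intro t ht
    have ht0 := ht.1
    have h1 := lintegral_comp_homothety x ht0 hBm h
    have hsub : (fun z => x + t • (z - x)) '' B ⊆ B ∩ Metric.ball x (2 * r * t) := by
      rintro _ ⟨z, hz, rfl⟩
      refine ⟨(convex_ball a r).add_smul_sub_mem hx hz ⟨ht0.le, ht.2⟩, ?_⟩
      rw [mem_ball_iff_norm, add_sub_cancel_left, norm_smul, Real.norm_of_nonneg ht0.le, mul_comm]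
      exact mul_lt_mul_of_pos_right (hdist z hz) ht0
    have h2 : ENNReal.ofReal (t ^ d) * ∫⁻ z in B, h (x + t • (z - x)) ≤
        N * ENNReal.ofReal (A * (t ^ d) ^ (1 - 1 / q)) := by
      rw [h1]
      calc _ ≤ ∫⁻ z in B ∩ Metric.ball x (2 * r * t), h z := lintegral_mono_set hsub
        _ ≤ (∫⁻ z in B ∩ Metric.ball x (2 * r * t), h z ^ q) ^ (1 / q) *
            volume.restrict (B ∩ Metric.ball x (2 * r * t)) univ ^ (1 - 1 / q) :=
          lintegral_le_rpow_mul_measure hq hhm.aemeasurable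
        _ ≤ N * volume (Metric.ball x (2 * r * t)) ^ (1 - 1 / q) := by
          rw [Measure.restrict_apply_univ]
          rw [hN]
          gcongr
          · exact inter_subset_left
          · exact inter_subset_right
        _ = _ := by
          rw [volume_ball_euc _ (by positivity), ENNReal.ofReal_rpow_of_nonneg (by positivity) h1q,
            mul_pow, ← mul_assoc, Real.mul_rpow (by positivity) (by positivity)]
    have htd : 0 < t ^ d := by positivity
    have e : A * (t ^ d) ^ (1 - 1 / q) = t ^ d * (A * t ^ (-(d / q : ℝ))) := by
      rw [sub_eq_add_neg, Real.rpow_add htd, Real.rpow_one, ← Real.rpow_natCast t d,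
        ← Real.rpow_mul ht0.le, mul_neg, mul_one_div]
      ring
    rw [e, ENNReal.ofReal_mul htd.le, mul_left_comm,
      ENNReal.mul_le_mul_iff_right (by simpa using htd) ENNReal.ofReal_ne_top,
      ENNReal.ofReal_mul hA0, ← mul_assoc] at h2
    exact h2
  have hmeas : Measurable (fun p : Euc d × ℝ => h (x + p.2 • (p.1 - x)) * ENNReal.ofReal (2 * r)) :=
    (hhm.comp (by fun_prop)).mul_const _
  calc ∫⁻ z in B, ‖u z - u x‖ₑ
      ≤ ∫⁻ z in B, ∫⁻ t in Ioc (0 : ℝ) 1, h (x + t • (z - x)) * ENNReal.ofReal (2 * r) := by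
        refine setLIntegral_mono' hBm fun z hz => ?_
        refine (enorm_sub_le_lintegral_segment hu x z).trans (lintegral_mono fun t => ?_)
        gcongr
        rw [← ofReal_norm]
        exact ENNReal.ofReal_le_ofReal (hdist z hz).le
    _ = ∫⁻ t in Ioc (0 : ℝ) 1, ∫⁻ z in B, h (x + t • (z - x)) * ENNReal.ofReal (2 * r) :=
        lintegral_lintegral_swap hmeas.aemeasurable
    _ ≤ ∫⁻ t in Ioc (0 : ℝ) 1, N * ENNReal.ofReal A * ENNReal.ofReal (2 * r) *
          ENNReal.ofReal (t ^ (-(d / q : ℝ))) := by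
        refine setLIntegral_mono' measurableSet_Ioc fun t ht => ?_
        rw [lintegral_mul_const' _ _ ENNReal.ofReal_ne_top]
        calc _ ≤ N * ENNReal.ofReal A * ENNReal.ofReal (t ^ (-(d / q : ℝ))) *
              ENNReal.ofReal (2 * r) := by gcongr; exact hinner t ht
          _ = _ := by ring
    _ = N * ENNReal.ofReal A * ENNReal.ofReal (2 * r) * ENNReal.ofReal (1 / (1 - d / q)) := by
        have hm : Measurable fun t : ℝ => ENNReal.ofReal (t ^ (-(d / q : ℝ))) := by fun_prop
        rw [lintegral_const_mul _ hm, lintegral_rpow_Ioc ((div_lt_one hq0).2 hqd)]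
    _ = _ := by
        rw [ENNReal.ofReal_mul (p := 2 * r * A) (by positivity),
          ENNReal.ofReal_mul (p := 2 * r) (by positivity)]
        ring

/-- The constant of the Morrey inequality on balls. -/
def morreyConst (d : ℕ) (q : ℝ) : ℝ :=
  2 * (unitBallVolume d * 2 ^ d) ^ (1 - 1 / q) * (1 / (1 - d / q)) / unitBallVolume d

lemma morreyConst_nonneg {q : ℝ} (hq : 0 < q) (hqd : (d : ℝ) < q) : 0 ≤ morreyConst d q := by
  have hκ := unitBallVolume_pos d
  have : (d : ℝ) / q < 1 := (div_lt_one hq).2 hqd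
  have : 0 < 1 - (d : ℝ) / q := by linarith
  unfold morreyConst
  positivity

/-- Splits off the volume of the ball of radius r, which is then cancelled after averaging. -/
lemma morreyConst_scale {q r : ℝ} (hr : 0 < r) :
    2 * r * (unitBallVolume d * (2 * r) ^ d) ^ (1 - 1 / q) * (1 / (1 - d / q)) =
      unitBallVolume d * r ^ d * (morreyConst d q * r ^ (1 - d / q)) := by
  have hκ := unitBallVolume_pos d
  have e1 : (unitBallVolume d * (2 * r) ^ d) ^ (1 - 1 / q) =
      (unitBallVolume d * 2 ^ d) ^ (1 - 1 / q) * (r ^ d) ^ (1 - 1 / q) := by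
    rw [mul_pow, ← mul_assoc, Real.mul_rpow (by positivity) (by positivity)]
  have e2 : r * (r ^ d) ^ (1 - 1 / q) = r ^ d * r ^ (1 - d / q) := by
    rw [← Real.rpow_natCast r d, ← Real.rpow_mul hr.le, ← Real.rpow_add hr]
    nth_rewrite 1 [← Real.rpow_one r]
    rw [← Real.rpow_add hr]
    congr 1; ring
  rw [e1, morreyConst]
  calc _ = 2 * (unitBallVolume d * 2 ^ d) ^ (1 - 1 / q) * (1 / (1 - d / q)) *
        (r * (r ^ d) ^ (1 - 1 / q)) := by ring
    _ = _ := by rw [e2]; field_simp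

/-- Morrey's inequality on balls. -/
lemma enorm_sub_le_of_mem_ball {q : ℝ} (hq : 1 < q) (hqd : (d : ℝ) < q) {u : Euc d → ℝ}
    (hu : ContDiff ℝ 1 u) {a x y : Euc d} {r : ℝ} (hx : x ∈ Metric.ball a r)
    (hy : y ∈ Metric.ball a r) :
    ‖u x - u y‖ₑ ≤ ENNReal.ofReal (2 * morreyConst d q * r ^ (1 - d / q)) *
        (∫⁻ z in Metric.ball a r, ‖fderiv ℝ u z‖ₑ ^ q) ^ (1 / q) := by
  have hr : 0 < r := Metric.pos_of_mem_ball hx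
  have hκ := unitBallVolume_pos d
  have hM := morreyConst_nonneg (by linarith) hqd
  set N := (∫⁻ z in Metric.ball a r, ‖fderiv ℝ u z‖ₑ ^ q) ^ (1 / q) with hN
  set V := ENNReal.ofReal (unitBallVolume d * r ^ d) with hV
  have hVv : volume (Metric.ball a r) = V := volume_ball_euc a hr
  -- Average u x − u y = (u z − u y) − (u z − u x) over z in the ball.
  have h1 : V * ‖u x - u y‖ₑ ≤ V * (ENNReal.ofReal (2 * morreyConst d q * r ^ (1 - d / q)) * N) := by
    calc V * ‖u x - u y‖ₑ = ∫⁻ _z in Metric.ball a r, ‖u x - u y‖ₑ := by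
          rw [setLIntegral_const, hVv, mul_comm]
      _ ≤ ∫⁻ z in Metric.ball a r, (‖u z - u x‖ₑ + ‖u z - u y‖ₑ) := by
          refine lintegral_mono fun z => ?_
          have e : u x - u y = (u z - u y) - (u z - u x) := by ring
          rw [e, add_comm]
          exact enorm_sub_le
      _ = (∫⁻ z in Metric.ball a r, ‖u z - u x‖ₑ) + ∫⁻ z in Metric.ball a r, ‖u z - u y‖ₑ :=
          lintegral_add_left (hu.continuous.sub continuous_const).measurable.enorm _
      _ ≤ _ := add_le_add (lintegral_ball_sub_le hq hqd hu hx) (lintegral_ball_sub_le hq hqd hu hy)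
      _ = _ := by
          rw [morreyConst_scale hr, ← two_mul, ← hN, mul_assoc 2 (morreyConst d q),
            ENNReal.ofReal_mul (p := 2) (by norm_num), ENNReal.ofReal_mul (by positivity), hV]
          rw [ENNReal.ofReal_ofNat]
          ring
  exact (ENNReal.mul_le_mul_iff_right (by
    rw [Ne, ENNReal.ofReal_eq_zero, not_le]; positivity) ENNReal.ofReal_ne_top).1 h1

/-- The sup bound accompanying Morrey's inequality. -/
lemma enorm_le_of_mem_ball {q : ℝ} (hq : 1 < q) (hqd : (d : ℝ) < q) {u : Euc d → ℝ}
    (hu : ContDiff ℝ 1 u) {a x : Euc d} {r : ℝ} (hx : x ∈ Metric.ball a r) :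
    ‖u x‖ₑ ≤ ENNReal.ofReal (morreyConst d q * r ^ (1 - d / q)) *
        (∫⁻ z in Metric.ball a r, ‖fderiv ℝ u z‖ₑ ^ q) ^ (1 / q) +
      ENNReal.ofReal ((unitBallVolume d * r ^ d) ^ (-(1 / q))) *
        (∫⁻ z in Metric.ball a r, ‖u z‖ₑ ^ q) ^ (1 / q) := by
  have hr : 0 < r := Metric.pos_of_mem_ball hx
  have hκ := unitBallVolume_pos d
  have hM := morreyConst_nonneg (by linarith) hqd
  have hVpos : 0 < unitBallVolume d * r ^ d := by positivity
  set N := (∫⁻ z in Metric.ball a r, ‖fderiv ℝ u z‖ₑ ^ q) ^ (1 / q) with hN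
  set U := (∫⁻ z in Metric.ball a r, ‖u z‖ₑ ^ q) ^ (1 / q) with hU
  set V := ENNReal.ofReal (unitBallVolume d * r ^ d) with hV
  have hVv : volume (Metric.ball a r) = V := volume_ball_euc a hr
  have h1 : V * ‖u x‖ₑ ≤ V * (ENNReal.ofReal (morreyConst d q * r ^ (1 - d / q)) * N +
      ENNReal.ofReal ((unitBallVolume d * r ^ d) ^ (-(1 / q))) * U) := by
    calc V * ‖u x‖ₑ = ∫⁻ _z in Metric.ball a r, ‖u x‖ₑ := by
          rw [setLIntegral_const, hVv, mul_comm]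
      _ ≤ ∫⁻ z in Metric.ball a r, (‖u z - u x‖ₑ + ‖u z‖ₑ) := by
          refine lintegral_mono fun z => ?_
          have e : u x = u z - (u z - u x) := by ring
          nth_rewrite 1 [e]
          rw [add_comm]
          exact enorm_sub_le
      _ = (∫⁻ z in Metric.ball a r, ‖u z - u x‖ₑ) + ∫⁻ z in Metric.ball a r, ‖u z‖ₑ :=
          lintegral_add_left (hu.continuous.sub continuous_const).measurable.enorm _
      _ ≤ _ := add_le_add (lintegral_ball_sub_le hq hqd hu hx)
          (lintegral_le_rpow_mul_measure hq hu.continuous.measurable.enorm.aemeasurable)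
      _ = _ := by
          have h1q : 0 ≤ 1 - 1 / q := by
            rw [sub_nonneg, div_le_one (by linarith)]; exact hq.le
          rw [morreyConst_scale hr, Measure.restrict_apply_univ, hVv, mul_add, hV,
            ENNReal.ofReal_mul hVpos.le, mul_assoc,
            ENNReal.ofReal_rpow_of_nonneg hVpos.le h1q, sub_eq_add_neg 1 (1 / q),
            Real.rpow_add hVpos,
            Real.rpow_one, ENNReal.ofReal_mul (p := unitBallVolume d * r ^ d) hVpos.le]
          ring
  exact (ENNReal.mul_le_mul_iff_right (by
    rw [Ne, ENNReal.ofReal_eq_zero, not_le]; positivity) ENNReal.ofReal_ne_top).1 h1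

/-- Local Morrey inequality for weakly differentiable functions. -/
lemma exists_local_morrey {q R : ℝ} (hq : 1 < q) (hqd : (d : ℝ) < q) (hR : 0 < R) :
    ∃ C : ℝ≥0, ∀ (v : Euc d → ℝ) (W : Euc d → Euc d →L[ℝ] ℝ), IsWeakDeriv R q v W →
      ∃ D : Set (Euc d), (∀ᵐ x ∂(volume.restrict (Metric.ball 0 (R / 8))), x ∈ D) ∧
        (∀ x ∈ D, ‖v x‖ₑ ≤
          C * (eLpNorm v (ENNReal.ofReal q) (volume.restrict (Metric.ball 0 R)) +
            eLpNorm W (ENNReal.ofReal q) (volume.restrict (Metric.ball 0 R)))) ∧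
        ∀ x ∈ D, ∀ y ∈ D, ‖v x - v y‖ₑ ≤
          C * ENNReal.ofReal (‖x - y‖ ^ (1 - d / q)) *
            eLpNorm W (ENNReal.ofReal q) (volume.restrict (Metric.ball 0 R)) := by
  have hq0 : 0 < q := by linarith
  have hM := morreyConst_nonneg hq0 hqd
  set M := morreyConst d q with hMd
  set C₁ := M * (R / 2) ^ (1 - d / q) with hC₁
  set C₂ := (unitBallVolume d * (R / 2) ^ d) ^ (-(1 / q)) with hC₂
  set C₃ := 2 * M * (3 / 2) ^ (1 - d / q) with hC₃
  refine ⟨max (max C₁.toNNReal C₂.toNNReal) C₃.toNNReal, fun v W h => ?_⟩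
  set C := max (max C₁.toNNReal C₂.toNNReal) C₃.toNNReal with hC
  have hCC₁ : ENNReal.ofReal C₁ ≤ C := ENNReal.coe_le_coe.2
    ((le_max_left _ _).trans (le_max_left _ _))
  have hCC₂ : ENNReal.ofReal C₂ ≤ C := ENNReal.coe_le_coe.2
    ((le_max_right _ _).trans (le_max_left _ _))
  have hCC₃ : ENNReal.ofReal C₃ ≤ C := ENNReal.coe_le_coe.2 (le_max_right _ _)
  obtain ⟨u, hu, hlim, hbd⟩ := h.exists_approximation hR hq
  rw [eLpNorm_ofReal_eq hq0, eLpNorm_ofReal_eq hq0]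
  have hbd1 := fun n => ENNReal.rpow_le_rpow (hbd n).1 (by positivity : 0 ≤ 1 / q)
  have hbd2 := fun n => ENNReal.rpow_le_rpow (hbd n).2 (by positivity : 0 ≤ 1 / q)
  set V := (∫⁻ x in Metric.ball 0 R, ‖v x‖ₑ ^ q) ^ (1 / q) with hV
  set N := (∫⁻ x in Metric.ball 0 R, ‖W x‖ₑ ^ q) ^ (1 / q) with hN
  -- At the points where the mollifications converge, their uniform bounds pass to v at every such
  -- point and every such pair.
  refine ⟨{x | x ∈ Metric.ball (0 : Euc d) (R / 8) ∧
    Filter.Tendsto (fun n => u n x) Filter.atTop (nhds (v x))}, ?_, ?_, ?_⟩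
  · filter_upwards [ae_mono (Measure.restrict_mono
      (Metric.ball_subset_ball (by linarith : R / 8 ≤ R)) le_rfl) hlim,
      ae_restrict_mem measurableSet_ball] with x h1 h2 using ⟨h2, h1⟩
  · rintro x ⟨hx, hxl⟩
    refine le_of_tendsto' ((continuous_enorm.tendsto _).comp hxl) fun n => ?_
    refine (enorm_le_of_mem_ball hq hqd (hu n)
      (Metric.ball_subset_ball (by linarith : R / 8 ≤ R / 2) hx)).trans ?_
    rw [mul_add, add_comm]
    exact add_le_add (mul_le_mul' hCC₂ (hbd1 n)) (mul_le_mul' hCC₁ (hbd2 n))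
  · rintro x ⟨hx, hxl⟩ y ⟨hy, hyl⟩
    rcases eq_or_ne x y with rfl | hne
    · simp
    have hρ : 0 < ‖x - y‖ := norm_pos_iff.2 (sub_ne_zero.2 hne)
    rw [mem_ball_zero_iff] at hx hy
    have hlt : ‖x - y‖ < R / 4 := by linarith [norm_sub_le x y]
    refine le_of_tendsto' ((continuous_enorm.tendsto _).comp (hxl.sub hyl)) fun n => ?_
    -- This ball contains y and stays inside B(0, R/2), since R/8 + (3/2)(R/4) = R/2.
    refine (enorm_sub_le_of_mem_ball hq hqd (hu n) (a := x) (r := 3 / 2 * ‖x - y‖)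
      (Metric.mem_ball_self (by positivity))
      (by rw [mem_ball_iff_norm, norm_sub_rev]; linarith)).trans ?_
    have e : 2 * M * (3 / 2 * ‖x - y‖) ^ (1 - d / q) = C₃ * ‖x - y‖ ^ (1 - d / q) := by
      rw [hC₃, Real.mul_rpow (by norm_num) hρ.le]; ring
    rw [← hMd, e, ENNReal.ofReal_mul (by positivity)]
    refine mul_le_mul' (mul_le_mul' hCC₃ le_rfl) (le_trans ?_ (hbd2 n))
    refine ENNReal.rpow_le_rpow (lintegral_mono_set ?_) (by positivity)
    refine Metric.ball_subset_ball' ?_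
    rw [dist_zero_right]
    linarith

end LocalMorrey
end

/-! ### Transfer to the surface and the global Sobolev inequality. -/

noncomputable section

section LocalData
variable {d : ℕ} {Ω : Set (Euc (d + 1))} {x₀ : Euc (d + 1)} {L : Euc (d + 1) ≃ₗᵢ[ℝ] Euc (d + 1)}
  {R : ℝ} {f : Euc d → ℝ}

lemma IsGraphPatch.mono (h : IsGraphPatch Ω x₀ L R f) {r : ℝ} (hr : 0 < r) (hrR : r ≤ R) :
    IsGraphPatch Ω x₀ L r f where
  pos := hr
  smooth := h.smooth.mono (Metric.ball_subset_ball hrR)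
  map_zero := h.map_zero
  lipschitz u hu v hv := h.lipschitz u (Metric.ball_subset_ball hrR hu) v
    (Metric.ball_subset_ball hrR hv)
  mem_iff u hu t ht := h.mem_iff u (Metric.ball_subset_ball hrR hu) t (ht.trans_le hrR)

/-- The graph over B(0, R) stays in B(x₀, 2R), so the comparison of measures can be localized; the
averaging argument needs this. -/
lemma IsGraphPatch.map_le_restrict (h : IsGraphPatch Ω x₀ L R f) :
    (volume.restrict (Metric.ball 0 R)).map (fun u => frameMap x₀ L (u, f u)) ≤
      (surfaceMeasure Ω).restrict (Metric.ball x₀ (2 * R)) := by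
  rw [← Measure.restrict_eq_self_of_ae_mem (s := Metric.ball x₀ (2 * R))
    (μ := (volume.restrict (Metric.ball 0 R)).map (fun u => frameMap x₀ L (u, f u)))]
  · exact Measure.restrict_mono_measure h.map_le _
  · refine (ae_map_iff (p := fun x => x ∈ Metric.ball x₀ (2 * R)) (h.aemeasurable le_rfl)
      measurableSet_ball).2 ?_
    filter_upwards [ae_restrict_mem measurableSet_ball] with u hu
    have h1 := h.norm_sub_le hu (Metric.mem_ball_self h.pos)
    rw [h.map_zero, frameMap_zero, sub_zero] at h1
    rw [mem_ball_zero_iff] at hu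
    rw [mem_ball_iff_norm]
    linarith

/-- The function and the gradient in a graph parametrization. -/
lemma IsGraphPatch.isWeakDeriv (h : IsGraphPatch Ω x₀ L R f) {q : ℝ} {F : Euc (d + 1) → ℝ}
    {g : Euc (d + 1) → Euc (d + 1)} (hF : MemLp F (ENNReal.ofReal q) (surfaceMeasure Ω))
    (hg : MemLp g (ENNReal.ofReal q) (surfaceMeasure Ω)) (hFg : IsWeakTangentialGradient Ω F g) :
    ∃ W : Euc d → Euc d →L[ℝ] ℝ, IsWeakDeriv R q (fun u => F (frameMap x₀ L (u, f u))) W ∧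
      eLpNorm (fun u => F (frameMap x₀ L (u, f u))) (ENNReal.ofReal q)
          (volume.restrict (Metric.ball 0 R)) ≤
        eLpNorm F (ENNReal.ofReal q) ((surfaceMeasure Ω).restrict (Metric.ball x₀ (2 * R))) ∧
      eLpNorm W (ENNReal.ofReal q) (volume.restrict (Metric.ball 0 R)) ≤
        2 * eLpNorm g (ENNReal.ofReal q) ((surfaceMeasure Ω).restrict (Metric.ball x₀ (2 * R))) := by
  set Φ := fun u => frameMap x₀ L (u, f u) with hΦ
  set ν := volume.restrict (Metric.ball (0 : Euc d) R) with hν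
  have hΦm : AEMeasurable Φ ν := h.aemeasurable le_rfl
  have hle := h.map_le_restrict
  have hFm : AEStronglyMeasurable F (ν.map Φ) := hF.1.mono_measure h.map_le
  have hgm : AEStronglyMeasurable g (ν.map Φ) := hg.1.mono_measure h.map_le
  have hF1 : eLpNorm (fun u => F (Φ u)) (ENNReal.ofReal q) ν ≤
      eLpNorm F (ENNReal.ofReal q) ((surfaceMeasure Ω).restrict (Metric.ball x₀ (2 * R))) := by
    have := eLpNorm_map_measure (p := ENNReal.ofReal q) hFm hΦm
    rw [Function.comp_def] at this
    rw [← this]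
    exact eLpNorm_mono_measure _ hle
  have hg1 : eLpNorm (fun u => g (Φ u)) (ENNReal.ofReal q) ν ≤
      eLpNorm g (ENNReal.ofReal q) ((surfaceMeasure Ω).restrict (Metric.ball x₀ (2 * R))) := by
    have := eLpNorm_map_measure (p := ENNReal.ofReal q) hgm hΦm
    rw [Function.comp_def] at this
    rw [← this]
    exact eLpNorm_mono_measure _ hle
  -- The derivative dictated by the definition of the weak tangential gradient; its norm picks up
  -- the Lipschitz constant 2 of the parametrization.
  set W : Euc d → Euc d →L[ℝ] ℝ := fun u => (innerSL ℝ (g (Φ u))).comp (fderiv ℝ Φ u) with hW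
  have hWm : AEStronglyMeasurable W ν := by
    have h1 : AEStronglyMeasurable (fun u => innerSL ℝ (g (Φ u))) ν :=
      (innerSL ℝ).continuous.comp_aestronglyMeasurable (hgm.comp_aemeasurable hΦm)
    have h2 : AEStronglyMeasurable (fderiv ℝ Φ) ν :=
      (measurable_fderiv ℝ Φ).aestronglyMeasurable
    exact (ContinuousLinearMap.compL ℝ (Euc d) (Euc (d + 1)) ℝ).aestronglyMeasurable_comp₂ h1 h2
  have hWn : ∀ᵐ u ∂ν, ‖W u‖ ≤ 2 * ‖g (Φ u)‖ := by
    filter_upwards [ae_restrict_mem measurableSet_ball] with u hu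
    have hl : LipschitzOnWith 2 Φ (Metric.ball 0 R) :=
      LipschitzOnWith.of_dist_le_mul fun a ha b hb => by
        rw [dist_eq_norm, dist_eq_norm]; exact h.norm_sub_le ha hb
    have h1 : ‖fderiv ℝ Φ u‖ ≤ 2 := by
      simpa using norm_fderiv_le_of_lipschitzOn ℝ (Metric.isOpen_ball.mem_nhds hu) hl
    calc ‖W u‖ ≤ ‖innerSL ℝ (g (Φ u))‖ * ‖fderiv ℝ Φ u‖ := ContinuousLinearMap.opNorm_comp_le _ _
      _ ≤ ‖g (Φ u)‖ * 2 := by rw [innerSL_apply_norm]; gcongr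
      _ = _ := mul_comm _ _
  have hW1 : eLpNorm W (ENNReal.ofReal q) ν ≤
      2 * eLpNorm g (ENNReal.ofReal q) ((surfaceMeasure Ω).restrict (Metric.ball x₀ (2 * R))) := by
    refine (eLpNorm_le_mul_eLpNorm_of_ae_le_mul hWn _).trans ?_
    rw [ENNReal.ofReal_ofNat]
    gcongr
  refine ⟨W, ⟨⟨hFm.comp_aemeasurable hΦm, hF1.trans_lt ?_⟩, ⟨hWm, hW1.trans_lt ?_⟩, ?_⟩, hF1, hW1⟩
  · exact (eLpNorm_mono_measure _ Measure.restrict_le_self).trans_lt hF.2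
  · exact ENNReal.mul_lt_top (by norm_num)
      ((eLpNorm_mono_measure _ Measure.restrict_le_self).trans_lt hg.2)
  · intro φ h1 h2 h3 i
    exact hFg.2 _ Φ h.isLocalParametrization φ h1 h2 h3 i

end LocalData

section Globalization
variable {d : ℕ}

/-- Integration over balls with variable centers. -/
lemma lintegral_setLIntegral_ball {m : ℕ} {σ : Measure (Euc m)} [SFinite σ] {h : Euc m → ℝ≥0∞}
    (hh : AEMeasurable h σ) (r : ℝ) :
    ∫⁻ x, ∫⁻ y in Metric.ball x r, h y ∂σ ∂σ = ∫⁻ y, h y * σ (Metric.ball y r) ∂σ := by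
  have hS : MeasurableSet {p : Euc m × Euc m | dist p.2 p.1 < r} :=
    measurableSet_lt (by fun_prop) measurable_const
  have hm : AEMeasurable (Function.uncurry fun x y : Euc m => (Metric.ball x r).indicator h y)
      (σ.prod σ) := by
    have h1 : AEMeasurable (fun p : Euc m × Euc m => h p.2) (σ.prod σ) :=
      hh.comp_quasiMeasurePreserving Measure.quasiMeasurePreserving_snd
    refine (h1.indicator hS).congr (Filter.Eventually.of_forall fun p => ?_)
    simp only [indicator, Function.uncurry, Metric.mem_ball, mem_ofPred_eq]
  simp_rw [← lintegral_indicator measurableSet_ball]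
  rw [lintegral_lintegral_swap hm]
  refine lintegral_congr fun y => ?_
  have e : ∀ x, (Metric.ball x r).indicator h y = (Metric.ball y r).indicator (fun _ => h y) x := by
    intro x
    simp only [indicator, Metric.mem_ball, dist_comm]
  simp_rw [e]
  rw [lintegral_indicator measurableSet_ball, setLIntegral_const]

/-- Sobolev inequality on surfaces covered by uniform graph patches. -/
lemma exists_sobolev_of_graphPatch (hd : 1 ≤ d) {q R c : ℝ} (hq : 1 < q) (hqd : q < d) (hR : 0 < R)
    (hc : 0 < c) :
    ∃ C : ℝ≥0, ∀ Ω : Set (Euc (d + 1)), IsSmoothBoundedDomain Ω →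
      IsLowerRegular (surfaceMeasure Ω) (frontier Ω) d c R →
      (∀ x ∈ frontier Ω, ∃ L f, IsGraphPatch Ω x L R f) →
      ∀ F g, MemLp F (ENNReal.ofReal q) (surfaceMeasure Ω) →
        MemLp g (ENNReal.ofReal q) (surfaceMeasure Ω) → IsWeakTangentialGradient Ω F g →
        eLpNorm F (ENNReal.ofReal (d * q / (d - q))) (surfaceMeasure Ω) ≤
          C * (eLpNorm g (ENNReal.ofReal q) (surfaceMeasure Ω) +
            eLpNorm F (ENNReal.ofReal q) (surfaceMeasure Ω)) := by
  have hq0 : 0 < q := by linarith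
  have hd0 : (0 : ℝ) < d := by exact_mod_cast hd
  have hdq : 0 < (d : ℝ) - q := by linarith
  set k := d * q / (d - q) with hk
  have hk0 : 0 < k := by positivity
  have hkq : 0 < k / q - 1 := by
    rw [hk, sub_pos, one_lt_div hq0, lt_div_iff₀ hdq]; nlinarith
  set r := R / 2 with hr
  have hr0 : 0 < r := half_pos hR
  obtain ⟨C₀, hC₀⟩ := exists_local_sobolev hd hq hqd hr0
  set K : ℝ≥0∞ := 2 ^ d * ((C₀ : ℝ≥0∞) * 3) ^ k with hK
  have hKtop : K ≠ ⊤ := ENNReal.mul_ne_top (by simp)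
    (ENNReal.rpow_ne_top_of_nonneg hk0.le (ENNReal.mul_ne_top ENNReal.coe_ne_top (by norm_num)))
  set A : ℝ≥0∞ := 2 ^ d * volume (Metric.ball (0 : Euc d) R) with hA
  have hAtop : A ≠ ⊤ := ENNReal.mul_ne_top (by simp) measure_ball_lt_top.ne
  set a : ℝ≥0∞ := ENNReal.ofReal (c * (r / 4) ^ d) with ha
  have ha0 : a ≠ 0 := by
    rw [ha, Ne, ENNReal.ofReal_eq_zero, not_le]; positivity
  set K' : ℝ≥0∞ := (K * A / a) ^ (1 / k) with hK'
  have hK'top : K' ≠ ⊤ := ENNReal.rpow_ne_top_of_nonneg (by positivity)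
    (ENNReal.div_ne_top (ENNReal.mul_ne_top hKtop hAtop) ha0)
  refine ⟨K'.toNNReal, fun Ω hΩ hσ hpatch F g hF hg hFg => ?_⟩
  rw [ENNReal.coe_toNNReal hK'top]
  set σ := surfaceMeasure Ω with hσd
  have hfin : IsFiniteMeasure σ := hΩ.isFiniteMeasure_of_graphPatch hpatch
  set H : Euc (d + 1) → ℝ≥0∞ := fun y => ‖g y‖ₑ ^ q + ‖F y‖ₑ ^ q with hH
  have hHm : AEMeasurable H σ :=
    (hg.1.enorm.pow_const q).add (hF.1.enorm.pow_const q)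
  set T := ∫⁻ y, H y ∂σ with hT
  have hlocal : ∀ x ∈ frontier Ω, ∫⁻ y in Metric.ball x (r / 4), ‖F y‖ₑ ^ k ∂σ ≤
      K * (T ^ (k / q - 1) * ∫⁻ y in Metric.ball x R, H y ∂σ) := by
    intro x hx
    obtain ⟨L, f, hp⟩ := hpatch x hx
    have hpr := hp.mono hr0 (by linarith : r ≤ R)
    obtain ⟨W, hW, hv1, hW1⟩ := hpr.isWeakDeriv hF hg hFg
    rw [show 2 * r = R by rw [hr]; ring] at hv1 hW1
    have hs := hC₀ _ W hW
    set Φ := fun u => frameMap x L (u, f u) with hΦ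
    set I := ∫⁻ y in Metric.ball x R, H y ∂σ with hI
    have h1 : eLpNorm F (ENNReal.ofReal q) (σ.restrict (Metric.ball x R)) ≤ I ^ (1 / q) := by
      rw [eLpNorm_ofReal_eq hq0]
      exact ENNReal.rpow_le_rpow (lintegral_mono fun y => le_add_self) (by positivity)
    have h2 : eLpNorm g (ENNReal.ofReal q) (σ.restrict (Metric.ball x R)) ≤ I ^ (1 / q) := by
      rw [eLpNorm_ofReal_eq hq0]
      exact ENNReal.rpow_le_rpow (lintegral_mono fun y => le_self_add) (by positivity)
    have h3 : (∫⁻ u in Metric.ball 0 (r / 4), ‖F (Φ u)‖ₑ ^ k) ^ (1 / k) ≤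
        C₀ * 3 * I ^ (1 / q) := by
      rw [← eLpNorm_ofReal_eq hk0]
      refine hs.trans ?_
      calc _ ≤ C₀ * (I ^ (1 / q) + 2 * I ^ (1 / q)) := by
            gcongr
            · exact hv1.trans h1
            · exact hW1.trans (by gcongr)
        _ = _ := by ring
    have h4 : ∫⁻ u in Metric.ball 0 (r / 4), ‖F (Φ u)‖ₑ ^ k ≤
        ((C₀ : ℝ≥0∞) * 3) ^ k * I ^ (k / q) := by
      have := ENNReal.rpow_le_rpow h3 hk0.le
      rwa [← ENNReal.rpow_mul, one_div_mul_cancel hk0.ne', ENNReal.rpow_one,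
        ENNReal.mul_rpow_of_nonneg _ _ hk0.le, ← ENNReal.rpow_mul, one_div_mul_eq_div] at this
    -- Since k > q, bounding all but one power of the local mass by the total mass makes the local
    -- estimate linear in I, so it can be integrated over the centres.
    have h5 : I ^ (k / q) ≤ T ^ (k / q - 1) * I := by
      have e : I ^ (k / q) = I ^ (k / q - 1) * I := by
        nth_rewrite 3 [← ENNReal.rpow_one I]
        rw [← ENNReal.rpow_add_of_nonneg _ _ hkq.le zero_le_one, sub_add_cancel]
      rw [e]
      gcongr
      exact setLIntegral_le_lintegral _ _
    have hFm : AEStronglyMeasurable F ((volume.restrict (Metric.ball 0 (r / 4))).map Φ) :=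
      hF.1.mono_measure ((hpr.mono (r := r / 4) (by positivity) (by linarith)).map_le)
    calc ∫⁻ y in Metric.ball x (r / 4), ‖F y‖ₑ ^ k ∂σ
        ≤ ∫⁻ y, ‖F y‖ₑ ^ k ∂((2 ^ d : ℝ≥0∞) • (volume.restrict (Metric.ball 0 (r / 4))).map Φ) :=
          lintegral_mono' (hpr.restrict_le (by linarith)) le_rfl
      _ = 2 ^ d * ∫⁻ u in Metric.ball 0 (r / 4), ‖F (Φ u)‖ₑ ^ k := by
          rw [lintegral_smul_measure, lintegral_map' (hFm.enorm.pow_const k)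
            (hpr.aemeasurable (by linarith)), smul_eq_mul]
      _ ≤ 2 ^ d * (((C₀ : ℝ≥0∞) * 3) ^ k * (T ^ (k / q - 1) * I)) := by
          gcongr
          exact h4.trans (by gcongr)
      _ = _ := by rw [hK]; ring
  -- Averaging over all centres replaces a covering with bounded overlap: Tonelli turns each side
  -- into a weighted integral, with the lower density bound a on the left and the upper bound A on
  -- the right.
  have hsum : a * ∫⁻ y, ‖F y‖ₑ ^ k ∂σ ≤ K * (T ^ (k / q - 1) * (A * T)) := by
    have hKT : K * T ^ (k / q - 1) ≠ ⊤ := by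
      refine ENNReal.mul_ne_top hKtop (ENNReal.rpow_ne_top_of_nonneg hkq.le ?_)
      rw [hT, lintegral_add_left' (hg.1.enorm.pow_const q)]
      have e1 := lintegral_rpow_enorm_lt_top_of_eLpNorm_lt_top (by simpa using hq0)
        ENNReal.ofReal_ne_top hF.2
      have e2 := lintegral_rpow_enorm_lt_top_of_eLpNorm_lt_top (by simpa using hq0)
        ENNReal.ofReal_ne_top hg.2
      rw [ENNReal.toReal_ofReal hq0.le] at e1 e2
      exact ENNReal.add_ne_top.2 ⟨e2.ne, e1.ne⟩
    calc a * ∫⁻ y, ‖F y‖ₑ ^ k ∂σ = ∫⁻ y, a * ‖F y‖ₑ ^ k ∂σ :=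
          (lintegral_const_mul' _ _ ENNReal.ofReal_ne_top).symm
      _ ≤ ∫⁻ y, ‖F y‖ₑ ^ k * σ (Metric.ball y (r / 4)) ∂σ := by
          refine lintegral_mono_ae ?_
          filter_upwards [hσ.ae_mem] with y hy
          rw [mul_comm]
          gcongr
          exact hσ.le_measure_ball y hy _ (by positivity) (by linarith)
      _ = ∫⁻ x, ∫⁻ y in Metric.ball x (r / 4), ‖F y‖ₑ ^ k ∂σ ∂σ :=
          (lintegral_setLIntegral_ball (hF.1.enorm.pow_const k) _).symm
      _ ≤ ∫⁻ x, K * T ^ (k / q - 1) * ∫⁻ y in Metric.ball x R, H y ∂σ ∂σ := by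
          refine lintegral_mono_ae ?_
          filter_upwards [hσ.ae_mem] with x hx
          rw [mul_assoc]
          exact hlocal x hx
      _ = K * T ^ (k / q - 1) * ∫⁻ y, H y * σ (Metric.ball y R) ∂σ := by
          rw [lintegral_const_mul' _ _ hKT, lintegral_setLIntegral_ball hHm]
      _ ≤ K * T ^ (k / q - 1) * ∫⁻ y, H y * A ∂σ := by
          gcongr K * T ^ (k / q - 1) * ?_
          refine lintegral_mono_ae ?_
          filter_upwards [hσ.ae_mem] with y hy
          obtain ⟨L, f, hp⟩ := hpatch y hy
          gcongr
          exact hp.surfaceMeasure_ball_le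
      _ = _ := by rw [lintegral_mul_const' _ _ hAtop]; ring
  have hfinal : ∫⁻ y, ‖F y‖ₑ ^ k ∂σ ≤ K * A / a * T ^ (k / q) := by
    have e : T ^ (k / q - 1) * T = T ^ (k / q) := by
      nth_rewrite 2 [← ENNReal.rpow_one T]
      rw [← ENNReal.rpow_add_of_nonneg _ _ hkq.le zero_le_one, sub_add_cancel]
    have h1 : ∫⁻ y, ‖F y‖ₑ ^ k ∂σ ≤ K * (T ^ (k / q - 1) * (A * T)) / a := by
      rw [ENNReal.le_div_iff_mul_le (Or.inl ha0) (Or.inl ENNReal.ofReal_ne_top), mul_comm]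
      exact hsum
    refine h1.trans_eq ?_
    rw [← e, ENNReal.div_eq_inv_mul, ENNReal.div_eq_inv_mul]
    ring
  rw [eLpNorm_ofReal_eq hk0, eLpNorm_ofReal_eq hq0, eLpNorm_ofReal_eq hq0]
  refine (ENNReal.rpow_le_rpow hfinal (by positivity)).trans ?_
  rw [ENNReal.mul_rpow_of_nonneg _ _ (by positivity), ← ENNReal.rpow_mul,
    show k / q * (1 / k) = 1 / q by field_simp]
  gcongr
  rw [hT, lintegral_add_left' (hg.1.enorm.pow_const q)]
  exact ENNReal.rpow_add_le_add_rpow _ _ (by positivity) (by rw [div_le_one hq0]; exact hq.le)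

end Globalization
end

/-! ### Global Morrey inequality on the surface. -/

noncomputable section

section GlobalMorrey
variable {d : ℕ}

/-- Local Morrey estimate on the surface near the center of a graph patch. -/
lemma exists_morrey_near_center {q r : ℝ} (hq : 1 < q) (hqd : (d : ℝ) < q) (hr : 0 < r) :
    ∃ C : ℝ≥0, ∀ (Ω : Set (Euc (d + 1))) (x₀ : Euc (d + 1)) (L : Euc (d + 1) ≃ₗᵢ[ℝ] Euc (d + 1))
      (f : Euc d → ℝ), IsGraphPatch Ω x₀ L r f →
      ∀ F g, MemLp F (ENNReal.ofReal q) (surfaceMeasure Ω) →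
        MemLp g (ENNReal.ofReal q) (surfaceMeasure Ω) → IsWeakTangentialGradient Ω F g →
        ∃ D : Set (Euc (d + 1)),
          (∀ᵐ x ∂(surfaceMeasure Ω).restrict (Metric.ball x₀ (r / 8)), x ∈ D) ∧
          (∀ x ∈ D, ‖F x‖ₑ ≤ C * (eLpNorm g (ENNReal.ofReal q) (surfaceMeasure Ω) +
            eLpNorm F (ENNReal.ofReal q) (surfaceMeasure Ω))) ∧
          ∀ x ∈ D, ∀ y ∈ D, ‖F x - F y‖ₑ ≤ C * ENNReal.ofReal (‖x - y‖ ^ (1 - d / q)) *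
            eLpNorm g (ENNReal.ofReal q) (surfaceMeasure Ω) := by
  have hq0 : 0 < q := by linarith
  have hβ : 0 ≤ 1 - d / q := by
    rw [sub_nonneg, div_le_one hq0]; exact hqd.le
  obtain ⟨C, hC⟩ := exists_local_morrey (d := d) hq hqd hr
  refine ⟨C * 2, fun Ω x₀ L f hp F g hF hg hFg => ?_⟩
  obtain ⟨W, hW, hv1, hW1⟩ := hp.isWeakDeriv hF hg hFg
  obtain ⟨D₀, hD₀, hsup, hhol⟩ := hC _ W hW
  have hv2 := hv1.trans (eLpNorm_mono_measure F Measure.restrict_le_self)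
  have hW2 := hW1.trans (mul_le_mul' le_rfl (eLpNorm_mono_measure g Measure.restrict_le_self))
  set Nf := eLpNorm F (ENNReal.ofReal q) (surfaceMeasure Ω)
  set Ng := eLpNorm g (ENNReal.ofReal q) (surfaceMeasure Ω)
  set Φ := fun u => frameMap x₀ L (u, f u) with hΦ
  set pr := fun z => (frameCoord x₀ L z).1 with hpr
  have hprm : Measurable pr := measurable_frameCoord_fst x₀ L
  refine ⟨{x | pr x ∈ D₀ ∧ Φ (pr x) = x}, ?_, ?_, ?_⟩
  -- D₀ need not be measurable, so its complement is enlarged to a measurable null set before null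
  -- sets are transported to the surface.
  · obtain ⟨N, hN1, hN2, hN3⟩ := exists_measurable_superset_of_null (ae_iff.1 hD₀)
    have h1 : ∀ᵐ x ∂((volume.restrict (Metric.ball 0 (r / 8))).map Φ), x ∈ pr ⁻¹' Nᶜ := by
      refine (ae_map_iff (p := fun x => x ∈ pr ⁻¹' Nᶜ) (hp.aemeasurable (by linarith))
        (hprm hN2.compl)).2 ?_
      have h2 : ∀ᵐ u ∂(volume.restrict (Metric.ball (0 : Euc d) (r / 8))), u ∈ Nᶜ :=
        measure_eq_zero_iff_ae_notMem.1 hN3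
      filter_upwards [h2] with u hu
      simpa [hpr, hΦ] using hu
    have h3 : ∀ᵐ x ∂(surfaceMeasure Ω).restrict (Metric.ball x₀ (r / 8)), x ∈ pr ⁻¹' Nᶜ := by
      refine ae_mono (hp.restrict_le (by linarith)) ?_
      exact Measure.ae_smul_measure h1 _
    have h4 : ∀ᵐ x ∂(surfaceMeasure Ω), x ∈ frontier Ω :=
      ae_restrict_mem isClosed_frontier.measurableSet
    filter_upwards [h3, ae_restrict_of_ae h4, ae_restrict_mem measurableSet_ball] with x hx1 hx2 hx3
    rw [mem_ball_iff_norm] at hx3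
    refine ⟨?_, hp.eq_of_mem hx2 (by linarith)⟩
    by_contra hcon
    exact hx1 (hN1 hcon)
  · rintro x ⟨hx, hxe⟩
    have h1 := hsup _ hx
    change ‖F (Φ (pr x))‖ₑ ≤ _ at h1
    rw [hxe] at h1
    calc ‖F x‖ₑ ≤ _ := h1
      _ ≤ C * (Nf + 2 * Ng) := by gcongr
      _ ≤ C * (2 * Nf + 2 * Ng) := by
          gcongr
          exact le_mul_of_one_le_left zero_le (by norm_num)
      _ = _ := by push_cast; ring
  · rintro x ⟨hx, hxe⟩ y ⟨hy, hye⟩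
    have h1 := hhol _ hx _ hy
    change ‖F (Φ (pr x)) - F (Φ (pr y))‖ₑ ≤ _ at h1
    rw [hxe, hye] at h1
    have h2 : ‖pr x - pr y‖ ≤ ‖x - y‖ := by
      have := (lipschitzWith_frameCoord_fst x₀ L).dist_le_mul x y
      simpa [dist_eq_norm] using this
    calc ‖F x - F y‖ₑ ≤ _ := h1
      _ ≤ C * ENNReal.ofReal (‖x - y‖ ^ (1 - d / q)) * (2 * Ng) := by
          gcongr
      _ = _ := by push_cast; ring

/-- Morrey inequality on surfaces covered by uniform graph patches. -/
lemma exists_morrey_of_graphPatch {q R : ℝ} (hq : 1 < q) (hqd : (d : ℝ) < q) (hR : 0 < R)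
    (hβ1 : 1 - d / q ≤ 1) :
    ∃ C : ℝ≥0, ∀ Ω : Set (Euc (d + 1)), IsSmoothBoundedDomain Ω →
      (∀ x ∈ frontier Ω, ∃ L f, IsGraphPatch Ω x L R f) →
      ∀ F g, MemLp F (ENNReal.ofReal q) (surfaceMeasure Ω) →
        MemLp g (ENNReal.ofReal q) (surfaceMeasure Ω) → IsWeakTangentialGradient Ω F g →
        ∃ F' : Euc (d + 1) → ℝ, F' =ᵐ[surfaceMeasure Ω] F ∧
          eLpNorm F' ⊤ (surfaceMeasure Ω) + holderSeminorm (1 - d / q) (frontier Ω) F' ≤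
            C * (eLpNorm g (ENNReal.ofReal q) (surfaceMeasure Ω) +
              eLpNorm F (ENNReal.ofReal q) (surfaceMeasure Ω)) := by
  have hq0 : 0 < q := by linarith
  have hβ : 0 < 1 - d / q := by
    rw [sub_pos, div_lt_one hq0]; exact hqd
  obtain ⟨C, hC⟩ := exists_morrey_near_center (d := d) hq hqd hR
  -- If x is within δ of a centre z and ‖x − y‖ < δ, then x and y both lie in B(z, R/8), where one
  -- local estimate applies.
  set δ := R / 16 with hδ
  have hδ0 : 0 < δ := by positivity
  have hδβ : 0 < 2 / δ ^ (1 - d / q) := by positivity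
  set C' : ℝ := C + (1 + 2 / δ ^ (1 - d / q)) * C with hC'
  have hC'0 : 0 ≤ C' := by positivity
  refine ⟨C'.toNNReal, fun Ω hΩ hpatch F g hF hg hFg => ?_⟩
  set σ := surfaceMeasure Ω with hσ
  set Nf := eLpNorm F (ENNReal.ofReal q) σ with hNf
  set Ng := eLpNorm g (ENNReal.ofReal q) σ with hNg
  have hNf' : Nf ≠ ⊤ := hF.2.ne
  have hNg' : Ng ≠ ⊤ := hg.2.ne
  have hloc : ∀ z ∈ frontier Ω, ∃ D : Set (Euc (d + 1)),
      (∀ᵐ x ∂σ.restrict (Metric.ball z (R / 8)), x ∈ D) ∧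
      (∀ x ∈ D, ‖F x‖ₑ ≤ C * (Ng + Nf)) ∧
      ∀ x ∈ D, ∀ y ∈ D, ‖F x - F y‖ₑ ≤ C * ENNReal.ofReal (‖x - y‖ ^ (1 - d / q)) * Ng := by
    intro z hz
    obtain ⟨L, f, hp⟩ := hpatch z hz
    exact hC Ω z L f hp F g hF hg hFg
  choose! D hD hDsup hDhol using hloc
  -- Finiteness only serves to discard finitely many null sets; the number of balls does not enter
  -- the constant.
  obtain ⟨t, htS, htc⟩ := hΩ.isCompact_frontier.elim_nhds_subcover (fun z => Metric.ball z δ)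
    fun z _ => Metric.ball_mem_nhds z hδ0
  set E : Set (Euc (d + 1)) := {x | x ∈ frontier Ω ∧ ∀ z ∈ t, x ∈ Metric.ball z (R / 8) → x ∈ D z}
    with hE
  have hEae : ∀ᵐ x ∂σ, x ∈ E := by
    have h1 : ∀ᵐ x ∂σ, x ∈ frontier Ω := ae_restrict_mem isClosed_frontier.measurableSet
    have h2 : ∀ᵐ x ∂σ, ∀ z ∈ t, x ∈ Metric.ball z (R / 8) → x ∈ D z := by
      rw [Filter.eventually_all_finset]
      intro z hz
      exact (ae_restrict_iff' measurableSet_ball).1 (hD z (htS z hz))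
    filter_upwards [h1, h2] with x hx1 hx2 using ⟨hx1, hx2⟩
  have hcov : ∀ x ∈ E, ∃ z ∈ t, dist x z < δ := by
    intro x hx
    obtain ⟨z, hz, hxz⟩ := mem_iUnion₂.1 (htc hx.1)
    exact ⟨z, hz, hxz⟩
  have hsup : ∀ x ∈ E, |F x| ≤ C * (Ng.toReal + Nf.toReal) := by
    intro x hx
    obtain ⟨z, hz, hxz⟩ := hcov x hx
    have h1 := hDsup z (htS z hz) x (hx.2 z hz (by rw [Metric.mem_ball]; linarith))
    have h2 := ENNReal.toReal_mono (ENNReal.mul_ne_top ENNReal.coe_ne_top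
      (ENNReal.add_ne_top.2 ⟨hNg', hNf'⟩)) h1
    rwa [toReal_enorm, ENNReal.toReal_mul, ENNReal.toReal_add hNg' hNf', ENNReal.coe_toReal,
      Real.norm_eq_abs] at h2
  have hhol : ∀ x ∈ E, ∀ y ∈ E, ‖x - y‖ < δ →
      |F x - F y| ≤ C * Ng.toReal * ‖x - y‖ ^ (1 - d / q) := by
    intro x hx y hy hxy
    obtain ⟨z, hz, hxz⟩ := hcov x hx
    have hyz : dist y z < R / 8 := by
      have h1 := dist_triangle_left y z x
      rw [dist_eq_norm x y] at h1
      linarith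
    have h1 := hDhol z (htS z hz) x (hx.2 z hz (by rw [Metric.mem_ball]; linarith)) y
      (hy.2 z hz hyz)
    have h2 := ENNReal.toReal_mono (ENNReal.mul_ne_top (ENNReal.mul_ne_top ENNReal.coe_ne_top
      ENNReal.ofReal_ne_top) hNg') h1
    rw [toReal_enorm, ENNReal.toReal_mul, ENNReal.toReal_mul, ENNReal.coe_toReal,
      ENNReal.toReal_ofReal (by positivity), Real.norm_eq_abs] at h2
    linarith
  obtain ⟨F', hF', hb⟩ := exists_holder_modification (S := frontier Ω) hEae hβ hβ1 hδ0
    (by positivity) (by positivity) hsup hhol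
  refine ⟨F', hF', hb.trans ?_⟩
  change _ ≤ ENNReal.ofReal C' * _
  rw [← ENNReal.ofReal_toReal (ENNReal.add_ne_top.2 ⟨hNg', hNf'⟩), ← ENNReal.ofReal_mul hC'0,
    ENNReal.toReal_add hNg' hNf']
  refine ENNReal.ofReal_le_ofReal ?_
  have h1 : (C : ℝ) * Ng.toReal ≤ C * (Ng.toReal + Nf.toReal) := by
    have : 0 ≤ Nf.toReal := ENNReal.toReal_nonneg
    gcongr
    linarith
  rw [hC', add_mul]
  linarith

end GlobalMorrey

section Seminorm
variable {d : ℕ} {Ω : Set (Euc (d + 1))}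

/-- A weak tangential gradient that is almost optimal in the definition of the seminorm. -/
lemma exists_gradient_eLpNorm_le {q : ℝ} {f : Euc (d + 1) → ℝ} {ε : ℝ≥0∞} (hε : ε ≠ 0)
    (h : sobolevSeminorm Ω 1 q f < ⊤) :
    ∃ g, MemLp g (ENNReal.ofReal q) (surfaceMeasure Ω) ∧ IsWeakTangentialGradient Ω f g ∧
      eLpNorm g (ENNReal.ofReal q) (surfaceMeasure Ω) ≤ sobolevSeminorm Ω 1 q f + ε := by
  have h1 : sobolevSeminorm Ω 1 q f < sobolevSeminorm Ω 1 q f + ε :=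
    ENNReal.lt_add_right h.ne hε
  nth_rewrite 1 [sobolevSeminorm] at h1
  rw [if_pos rfl] at h1
  obtain ⟨g, hg⟩ := iInf_lt_iff.1 h1
  obtain ⟨⟨hg1, hg2⟩, hg3⟩ := iInf_lt_iff.1 hg
  exact ⟨g, hg1, hg2, hg3.le⟩

lemma sobolevSeminorm_of_ne_one {α q : ℝ} (hα : α ≠ 1) (f : Euc (d + 1) → ℝ) :
    sobolevSeminorm Ω α q f =
      (∫⁻ x, gagliardoDensity (surfaceMeasure Ω) ((d : ℝ) + α * q) q f x ∂(surfaceMeasure Ω)) ^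
        (1 / q) := by
  rw [sobolevSeminorm, if_neg hα]
  rfl

end Seminorm
end

/-! ### Assembly of the Michael–Simon type inequality and the main theorem. -/

noncomputable section

section MichaelSimon
variable {d : ℕ}

/-- The Sobolev and Morrey inequalities for fractional exponents. -/
lemma exists_fractional_inequality (hd : 1 ≤ d) {c R α q : ℝ} (hc : 0 < c) (hR : 0 < R) (hα : 0 < α)
    (hα1 : α < 1) (hq : 1 < q) :
    ∃ C : ℝ≥0, ∀ Ω : Set (Euc (d + 1)), SFinite (surfaceMeasure Ω) →
      IsLowerRegular (surfaceMeasure Ω) (frontier Ω) d c R →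
      ∀ f : Euc (d + 1) → ℝ, MemSobolev Ω α q f →
        (q < (d : ℝ) / α →
          eLpNorm f (ENNReal.ofReal (d * q / (d - α * q))) (surfaceMeasure Ω) ≤
            C * (sobolevSeminorm Ω α q f + eLpNorm f (ENNReal.ofReal q) (surfaceMeasure Ω))) ∧
        (∀ β : ℝ, 0 < β → β < α → α - (d : ℝ) / q = β →
          ∃ f' : Euc (d + 1) → ℝ, f' =ᵐ[surfaceMeasure Ω] f ∧
            eLpNorm f' ⊤ (surfaceMeasure Ω) + holderSeminorm β (frontier Ω) f' ≤
              C * (sobolevSeminorm Ω α q f + eLpNorm f (ENNReal.ofReal q) (surfaceMeasure Ω))) := by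
  have hq0 : 0 < q := by linarith
  -- The positivity condition stands after the constant, so that one constant can be fixed in
  -- advance; outside the Morrey range any value works.
  have hmorrey : ∃ C : ℝ≥0, 0 < α - d / q → ∀ Ω : Set (Euc (d + 1)), SFinite (surfaceMeasure Ω) →
      IsLowerRegular (surfaceMeasure Ω) (frontier Ω) d c R →
      ∀ f : Euc (d + 1) → ℝ, MemSobolev Ω α q f →
        ∃ f' : Euc (d + 1) → ℝ, f' =ᵐ[surfaceMeasure Ω] f ∧
          eLpNorm f' ⊤ (surfaceMeasure Ω) + holderSeminorm (α - d / q) (frontier Ω) f' ≤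
            C * (sobolevSeminorm Ω α q f +
              eLpNorm f (ENNReal.ofReal q) (surfaceMeasure Ω)) := by
    by_cases hβ : 0 < α - d / q
    · have hdq : (0 : ℝ) ≤ d / q := by positivity
      obtain ⟨C, hC⟩ := IsLowerRegular.exists_holder_modification (m := d + 1) hc hR hq0 hα hβ
        (by linarith) rfl
      refine ⟨C, fun _ Ω hsf hσ f hf => ?_⟩
      rw [sobolevSeminorm_of_ne_one hα1.ne, eLpNorm_ofReal_eq hq0]
      refine hC _ _ hsf hσ f hf.1.1.aemeasurable ?_ ?_
      · have := lintegral_rpow_enorm_lt_top_of_eLpNorm_lt_top (by simpa using hq0)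
          ENNReal.ofReal_ne_top hf.1.2
        rw [ENNReal.toReal_ofReal hq0.le] at this
        exact this.ne
      · have := hf.2
        rw [sobolevSeminorm_of_ne_one hα1.ne] at this
        exact (ENNReal.rpow_lt_top_iff_of_pos (by positivity)).1 this |>.ne
    · exact ⟨0, fun h => absurd h hβ⟩
  obtain ⟨C₂, hC₂⟩ := hmorrey
  set K := fractionalConst d c R q (α * q / d) ^ (1 / q) with hK
  have hKtop : K ≠ ⊤ := ENNReal.rpow_ne_top_of_nonneg (by positivity) ENNReal.ofReal_ne_top
  refine ⟨max K.toNNReal C₂, fun Ω hsf hσ f hf => ⟨fun hqd => ?_, ?_⟩⟩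
  · refine (hσ.eLpNorm_le hd hc hR hq hα hqd hf.1).trans ?_
    rw [← sobolevSeminorm_of_ne_one hα1.ne]
    gcongr
    rw [← hK, ← ENNReal.coe_toNNReal hKtop]
    exact ENNReal.coe_le_coe.2 (le_max_left _ _)
  · rintro _ hβ - rfl
    obtain ⟨f', hf', hb⟩ := hC₂ hβ Ω hsf hσ f hf
    refine ⟨f', hf', hb.trans ?_⟩
    gcongr
    exact le_max_right _ _

/-- The Sobolev and Morrey inequalities for the tangential gradient. -/
lemma exists_gradient_inequality (hd : 1 ≤ d) {c R q : ℝ} (hc : 0 < c) (hR : 0 < R) (hq : 1 < q) :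
    ∃ C : ℝ≥0, ∀ Ω : Set (Euc (d + 1)), IsSmoothBoundedDomain Ω →
      IsLowerRegular (surfaceMeasure Ω) (frontier Ω) d c R →
      (∀ x ∈ frontier Ω, ∃ L f, IsGraphPatch Ω x L R f) →
      ∀ f : Euc (d + 1) → ℝ, MemSobolev Ω 1 q f →
        (q < d → eLpNorm f (ENNReal.ofReal (d * q / (d - q))) (surfaceMeasure Ω) ≤
            C * (sobolevSeminorm Ω 1 q f + eLpNorm f (ENNReal.ofReal q) (surfaceMeasure Ω))) ∧
        (0 < 1 - (d : ℝ) / q →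
          ∃ f' : Euc (d + 1) → ℝ, f' =ᵐ[surfaceMeasure Ω] f ∧
            eLpNorm f' ⊤ (surfaceMeasure Ω) + holderSeminorm (1 - d / q) (frontier Ω) f' ≤
              C * (sobolevSeminorm Ω 1 q f + eLpNorm f (ENNReal.ofReal q) (surfaceMeasure Ω))) := by
  have hq0 : 0 < q := by linarith
  have hsob : ∃ C : ℝ≥0, q < d → ∀ Ω : Set (Euc (d + 1)), IsSmoothBoundedDomain Ω →
      IsLowerRegular (surfaceMeasure Ω) (frontier Ω) d c R →
      (∀ x ∈ frontier Ω, ∃ L f, IsGraphPatch Ω x L R f) →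
      ∀ F g, MemLp F (ENNReal.ofReal q) (surfaceMeasure Ω) →
        MemLp g (ENNReal.ofReal q) (surfaceMeasure Ω) → IsWeakTangentialGradient Ω F g →
        eLpNorm F (ENNReal.ofReal (d * q / (d - q))) (surfaceMeasure Ω) ≤
          C * (eLpNorm g (ENNReal.ofReal q) (surfaceMeasure Ω) +
            eLpNorm F (ENNReal.ofReal q) (surfaceMeasure Ω)) := by
    by_cases h : q < d
    · obtain ⟨C, hC⟩ := exists_sobolev_of_graphPatch hd hq h hR hc
      exact ⟨C, fun _ => hC⟩
    · exact ⟨0, fun h' => absurd h' h⟩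
  have hmor : ∃ C : ℝ≥0, 0 < 1 - (d : ℝ) / q → ∀ Ω : Set (Euc (d + 1)), IsSmoothBoundedDomain Ω →
      (∀ x ∈ frontier Ω, ∃ L f, IsGraphPatch Ω x L R f) →
      ∀ F g, MemLp F (ENNReal.ofReal q) (surfaceMeasure Ω) →
        MemLp g (ENNReal.ofReal q) (surfaceMeasure Ω) → IsWeakTangentialGradient Ω F g →
        ∃ F' : Euc (d + 1) → ℝ, F' =ᵐ[surfaceMeasure Ω] F ∧
          eLpNorm F' ⊤ (surfaceMeasure Ω) + holderSeminorm (1 - d / q) (frontier Ω) F' ≤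
            C * (eLpNorm g (ENNReal.ofReal q) (surfaceMeasure Ω) +
              eLpNorm F (ENNReal.ofReal q) (surfaceMeasure Ω)) := by
    by_cases h : 0 < 1 - (d : ℝ) / q
    · have hdq : (0 : ℝ) ≤ d / q := by positivity
      obtain ⟨C, hC⟩ := exists_morrey_of_graphPatch (d := d) hq
        (by rw [sub_pos, div_lt_one hq0] at h; exact h) hR (by linarith)
      exact ⟨C, fun _ => hC⟩
    · exact ⟨0, fun h' => absurd h' h⟩
  obtain ⟨C₁, hC₁⟩ := hsob
  obtain ⟨C₂, hC₂⟩ := hmor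
  refine ⟨2 * max C₁ C₂, fun Ω hΩ hσ hpatch f hf => ?_⟩
  set s := sobolevSeminorm Ω 1 q f with hs
  set N := eLpNorm f (ENNReal.ofReal q) (surfaceMeasure Ω) with hN
  -- The gradient is taken within ε = ‖f‖_q of the infimum defining the seminorm. This error is
  -- absorbed into the right-hand side with a factor 2; as ε must be nonzero, f = 0 almost
  -- everywhere is treated apart.
  rcases eq_or_ne N 0 with h0 | h0
  · have hf0 : f =ᵐ[surfaceMeasure Ω] 0 :=
      (eLpNorm_eq_zero_iff hf.1.1 (by simpa using hq0)).1 h0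
    refine ⟨fun _ => ?_, fun hβ => ⟨0, hf0.symm, ?_⟩⟩
    · rw [eLpNorm_congr_ae hf0, eLpNorm_zero]; exact zero_le
    · have h1 : holderSeminorm (1 - d / q) (frontier Ω) (0 : Euc (d + 1) → ℝ) ≤ ENNReal.ofReal 0 :=
        holderSeminorm_le fun x y => by simp
      rw [ENNReal.ofReal_zero, nonpos_iff_eq_zero] at h1
      rw [eLpNorm_zero, h1, add_zero]; exact zero_le
  obtain ⟨g, hg, hfg, hgs⟩ := exists_gradient_eLpNorm_le h0 hf.2
  have hbound : ∀ K : ℝ≥0, K ≤ max C₁ C₂ →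
      (K : ℝ≥0∞) * (eLpNorm g (ENNReal.ofReal q) (surfaceMeasure Ω) + N) ≤
        ((2 * max C₁ C₂ : ℝ≥0) : ℝ≥0∞) * (s + N) := by
    intro K hK
    calc (K : ℝ≥0∞) * (eLpNorm g (ENNReal.ofReal q) (surfaceMeasure Ω) + N)
        ≤ (max C₁ C₂ : ℝ≥0) * (s + N + N) := by gcongr
      _ ≤ (max C₁ C₂ : ℝ≥0) * (2 * (s + N)) := by
          gcongr
          rw [two_mul]
          gcongr
          exact le_add_self
      _ = _ := by rw [ENNReal.coe_mul]; push_cast; ring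
  refine ⟨fun hqd => ?_, fun hβ => ?_⟩
  · exact (hC₁ hqd Ω hΩ hσ hpatch f g hf.1 hg hfg).trans (hbound _ (le_max_left _ _))
  · obtain ⟨f', hf', hb⟩ := hC₂ hβ Ω hΩ hpatch f g hf.1 hg hfg
    exact ⟨f', hf', hb.trans (hbound _ (le_max_right _ _))⟩

end MichaelSimon
end

theorem mainTheorem9 (d : ℕ) (hd : 1 ≤ d) (c s p Λ : ℝ) (hc : 0 < c) (hs₀ : 0 < s) (hs₁ : s < 1)
    (hp : (d : ℝ) / s < p) (hΛ : 0 < Λ) :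
    -- uniform local graph parametrization
    (∃ R > (0 : ℝ), ∃ C : ℝ, ∀ Ω : Set (Euc (d + 1)), IsSmoothBoundedDomain Ω →
      bendingEnergy c s p Ω ≤ ENNReal.ofReal Λ →
      ∀ x₀ ∈ frontier Ω, ∃ P ∈ Matrix.specialOrthogonalGroup (Fin (d + 1)) ℝ,
        ∃ f : Euc d → ℝ, ContDiffOn ℝ ∞ f (Metric.ball 0 R) ∧ f 0 = 0 ∧
          (∀ x ∈ Metric.ball (0 : Euc d) R, ∀ y ∈ Metric.ball (0 : Euc d) R,
            ‖gradient f x - gradient f y‖ ≤ C * ‖x - y‖ ^ (s - (d : ℝ) / p)) ∧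
          IsLocalParametrization (frontier Ω) (Metric.ball 0 R) (graphMap x₀ P f)) ∧
    -- uniform lower Ahlfors regularity
    (∃ c₁ > (0 : ℝ), ∃ R₀ > (0 : ℝ), ∀ Ω : Set (Euc (d + 1)), IsSmoothBoundedDomain Ω →
      bendingEnergy c s p Ω ≤ ENNReal.ofReal Λ →
      ∀ x ∈ frontier Ω,
        ENNReal.ofReal c₁ < ⨅ R ∈ Ioo (0 : ℝ) R₀,
          (ENNReal.ofReal (R ^ d))⁻¹ *
            (μHE[d] : Measure (Euc (d + 1))) (frontier Ω ∩ Metric.ball x R)) ∧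
    -- weak Michael-Simon type inequality
    (∀ α q : ℝ, 0 < α → α ≤ 1 → 1 < q →
      ∃ C : ℝ≥0, ∀ Ω : Set (Euc (d + 1)), IsSmoothBoundedDomain Ω →
        bendingEnergy c s p Ω ≤ ENNReal.ofReal Λ →
        ∀ f : Euc (d + 1) → ℝ, MemSobolev Ω α q f →
          (q < (d : ℝ) / α →
            eLpNorm f (ENNReal.ofReal (d * q / (d - α * q))) (surfaceMeasure Ω) ≤
              C * (sobolevSeminorm Ω α q f +
                eLpNorm f (ENNReal.ofReal q) (surfaceMeasure Ω))) ∧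
          (∀ β : ℝ, 0 < β → β < α → α - (d : ℝ) / q = β →
            ∃ f' : Euc (d + 1) → ℝ, f' =ᵐ[surfaceMeasure Ω] f ∧
              eLpNorm f' ⊤ (surfaceMeasure Ω) + holderSeminorm β (frontier Ω) f' ≤
                C * (sobolevSeminorm Ω α q f +
                  eLpNorm f (ENNReal.ofReal q) (surfaceMeasure Ω)))) ∧
    -- lower area bound
    (∃ c₂ > (0 : ℝ), ∀ Ω : Set (Euc (d + 1)), IsSmoothBoundedDomain Ω →
      bendingEnergy c s p Ω ≤ ENNReal.ofReal Λ →
      ENNReal.ofReal c₂ ≤ (μHE[d] : Measure (Euc (d + 1))) (frontier Ω)) := by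
  have hd0 : (0 : ℝ) < d := by exact_mod_cast hd
  obtain ⟨c₁, hc₁, R₀, hR₀, hA⟩ := exists_lower_ahlfors hd hc hs₀ hp hΛ
  refine ⟨?_, ?_, ?_, ?_⟩
  · obtain ⟨R, hR, C, hmain⟩ := exists_uniform_graphPatch hd hc hs₀ hp hΛ
    refine ⟨R, hR, C, fun Ω hΩ hE x₀ hx₀ => ?_⟩
    obtain ⟨P, hP, L, hPL, f, hf, hfC⟩ := hmain Ω hΩ hE x₀ hx₀
    refine ⟨P, hP, f, hf.smooth, hf.map_zero, hfC, ?_⟩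
    rw [show graphMap x₀ P f = fun u => frameMap x₀ L (u, f u) from
      funext fun u => graphMap_eq_frameMap hPL f u]
    exact hf.isLocalParametrization
  -- Halving the constant yields a strict inequality for the infimum.
  · refine ⟨c₁ / 2, half_pos hc₁, R₀, hR₀, fun Ω hΩ hE x hx => ?_⟩
    refine (ENNReal.ofReal_lt_ofReal_iff hc₁).2 (half_lt_self hc₁) |>.trans_le ?_
    refine le_iInf₂ fun r hr => ?_
    have h := hA Ω hΩ hE x hx r hr.1 hr.2
    rw [surfaceMeasure_ball, ENNReal.ofReal_mul hc₁.le] at h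
    have h0 : ENNReal.ofReal (r ^ d) ≠ 0 := by
      simpa [ENNReal.ofReal_eq_zero] using pow_pos hr.1 d
    rw [mul_comm]
    exact (ENNReal.le_div_iff_mul_le (Or.inl h0) (Or.inl ENNReal.ofReal_ne_top)).2 h
  · intro α q hα hα₁ hq
    obtain ⟨R₁, hR₁, C₁, hpatch⟩ := exists_uniform_graphPatch hd hc hs₀ hp hΛ
    set R := min R₀ R₁ with hR
    have hR0 : 0 < R := lt_min hR₀ hR₁
    have hreg : ∀ Ω : Set (Euc (d + 1)), IsSmoothBoundedDomain Ω →
        bendingEnergy c s p Ω ≤ ENNReal.ofReal Λ →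
        IsLowerRegular (surfaceMeasure Ω) (frontier Ω) d c₁ R := fun Ω hΩ hE =>
      ⟨ae_restrict_mem isClosed_frontier.measurableSet, fun x hx r hr hrR =>
        hA Ω hΩ hE x hx r hr (hrR.trans_le (min_le_left _ _))⟩
    have hpat : ∀ Ω : Set (Euc (d + 1)), IsSmoothBoundedDomain Ω →
        bendingEnergy c s p Ω ≤ ENNReal.ofReal Λ →
        ∀ x ∈ frontier Ω, ∃ L f, IsGraphPatch Ω x L R f := by
      intro Ω hΩ hE x hx
      obtain ⟨-, -, L, -, f, hf, -⟩ := hpatch Ω hΩ hE x hx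
      exact ⟨L, f, hf.mono hR0 (min_le_right _ _)⟩
    -- For α < 1 the patches only show that the surface measure is finite; for α = 1 they carry the
    -- estimate.
    rcases hα₁.lt_or_eq with hα₁ | rfl
    · obtain ⟨C, hC⟩ := exists_fractional_inequality hd hc₁ hR0 hα hα₁ hq
      refine ⟨C, fun Ω hΩ hE f hf => ?_⟩
      have := hΩ.isFiniteMeasure_of_graphPatch (hpat Ω hΩ hE)
      exact hC Ω inferInstance (hreg Ω hΩ hE) f hf
    · obtain ⟨C, hC⟩ := exists_gradient_inequality hd hc₁ hR0 hq
      refine ⟨C, fun Ω hΩ hE f hf => ?_⟩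
      obtain ⟨h1, h2⟩ := hC Ω hΩ (hreg Ω hΩ hE) (hpat Ω hΩ hE) f hf
      refine ⟨fun hqd => ?_, ?_⟩
      · rw [one_mul]
        exact h1 (by rwa [div_one] at hqd)
      · rintro _ hβ - rfl
        exact h2 hβ
  · refine ⟨c₁ * (R₀ / 2) ^ d, by positivity, fun Ω hΩ hE => ?_⟩
    obtain ⟨x, hx⟩ := hΩ.nonempty_frontier
    refine (hA Ω hΩ hE x hx (R₀ / 2) (half_pos hR₀) (half_lt_self hR₀)).trans ?_
    rw [surfaceMeasure_ball]
    exact measure_mono inter_subset_left
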